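/- Let $\mathbb K$ be a field of characteristic $0$. A \emph{commutative $BV_\infty$ algebra} is a $\mathbb Z$-graded unital graded commutative $\mathbb K$-algebra $A$ with operators $\Delta_k$ ($k\ge 0$) of degree $1-2k$, each a differential operator of order at most $k+1$, such that $\Delta_k(1)=0$, $d:=\Delta_0$ is a derivation and $\sum_{i=0}^k\Delta_i\Delta_{k-i}=0$ for all $k\ge0$. Write $H(A)=H(A,d)$, let $\hbar$ be a formal variable of degree $2$, and put $\Delta=\sum_k\hbar^k\Delta_k$ on $A[[\hbar]]$ and $A((\hbar))$. A \emph{cyclic structure} of dimension $n\in\mathbb Z$ is a linear map $\mathrm{Tr}:A\to\mathbb K$ vanishing outside degree $n$ such that $(a,b):=\mathrm{Tr}(ab)$ satisfies $(\Delta_k a,b)=(-1)^{|a|+k+1}(a,\Delta_k b)$ for all $k$, all $H^i(A)$ are finite-dimensional, and the induced pairings $\mathcal K^{(0)}:H^i(A)\times H^{n-i}(A)\to\mathbb K$ are non-degenerate. A \emph{Hodge-to-de Rham degeneration data} consists of graded linear maps $\iota:H(A)\to A$, $p:A\to H(A)$ of degree $0$ and $h:A\to A$ of degree $-1$ with $d\iota=0$,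 $pd=0$, $[\iota x]=x$, $p\iota=\mathrm{id}$, $hd+dh=\iota p-\mathrm{id}$, $h^2=h\iota=ph=0$, and $$\sum_{j_1+\dots+j_l=k,\ j_i\ge1}p\,\Delta_{j_1}h\Delta_{j_2}h\cdots h\Delta_{j_l}\,\iota=0\qquad(k\ge1).$$ It is \emph{compatible} with the pairing if $(h(a),b)=(-1)^{|a|}(a,h(b))$ for all $a,b$. Put $$S(x)=\iota x+\sum_{k\ge1}\hbar^k\sum_{j_1+\dots+j_l=k,\ j_i\ge 1}h\Delta_{j_1}h\Delta_{j_2}\cdots h\Delta_{j_l}\iota x\in A[[\hbar]]\qquad(x\in H(A)).$$ For $\alpha,\beta\in A((\hbar))$ put $\mathcal K(\alpha,\beta)=\mathrm{Tr}(\alpha\bar\beta)\in\mathbb K((\hbar))$, where $\mathrm{Tr}$ is extended $\hbar$-linearly and $\bar\beta(\hbar)=\beta(-\hbar)$. A family of $\Delta$-closed $\alpha_1,\dots,\alpha_\mu\in A[[\hbar]]$ is a \emph{good basis} if their classes form a $\mathbb K[[\hbar]]$-basis of $H(A[[\hbar]],\Delta)$ and every $\mathcal K(\alpha_i,\alpha_j)$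 equals its value at $\hbar=0$, that is $\mathrm{Tr}(\alpha_i|_{\hbar=0}\,\alpha_j|_{\hbar=0})$. \textbf{Theorem.} Let $A$ be a commutative $BV_\infty$ algebra with a cyclic structure of dimension $n$ and a Hodge-to-de Rham degeneration data $(\iota,p,h)$ compatible with the pairing, and let $a_1,\dots,a_\mu$ be a (finite) homogeneous basis of $H(A)$. Then $S(a_1),\dots,S(a_\mu)$ is a good basis, and the formal neighbourhood $\mathcal M$ of $0$ in $H(A)$ carries a formal Frobenius manifold structure obtained as follows. There are a good basis $\alpha_1,\dots,\alpha_\mu$, with $\alpha_i$ homogeneous of degree $|a_i|$ and $[\alpha_i|_{\hbar=0}]=a_i$, and a series $\Gamma=\sum_i\tau^i\alpha_i+O(\tau^2)\in A[[\hbar]][[\tau^1,\dots,\tau^\mu]]$, homogeneous of degree $2$, in graded commuting variables $\tau^i$ of degree $2-|a_i|$, such that: (i) if $S([1])$ and $1$ have the same class in $H(A[[\hbar]],\Delta)$ (for instance, if $h(1)=0$), then $\alpha_i=S(a_i)$ for all $i$; (ii) $\mathcal L:=\hbar^{-1}\mathrm{Span}_{\mathbb K}\{\alpha_1,\dots,\alpha_\mu\}[\hbar^{-1}]$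 is a good opposite filtration: $\hbar^{-1}\mathcal L\subset\mathcal L$, $H(A((\hbar)),\Delta)=H(A[[\hbar]],\Delta)\oplus\mathcal L$, and $\mathrm{Res}_{\hbar=0}\mathcal K(\varphi,\psi)\,d\hbar=0$ for $\varphi,\psi\in\mathcal L$; (iii) $\Gamma$ solves the quantum master equation $\Delta e^{\Gamma/\hbar}=0$, and $[\hbar e^{\Gamma/\hbar}-\hbar]\equiv\sum_i\tau^i[\alpha_i]$ modulo $\mathcal L[[\tau]]$; (iv) there is a formal Frobenius (super)manifold structure on $\mathcal M$ with flat coordinates $\tau^i$, $\partial_i=\partial/\partial\tau^i$, whose product $\partial_i\circ\partial_j=\sum_kA_{ij}^k\partial_k$, $A_{ij}^k\in\mathbb K[[\tau]]$, satisfies $$\hbar\partial_i\,\hbar\partial_j\,[e^{\Gamma/\hbar}]=\sum_kA_{ij}^k\,\hbar\partial_k[e^{\Gamma/\hbar}]\quad\text{in }H(A((\hbar)),\Delta)[[\tau]],$$ whose metric is $g(\partial_i,\partial_j)=\mathcal K^{(0)}(a_i,a_j)=\mathcal K(\hbar\partial_ie^{\Gamma/\hbar},\hbar\partial_je^{\Gamma/\hbar})$,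 whose unit is $\sum_ie^i\partial_i$ with constants $e^i\in\mathbb K$ given by $[1]=\sum_ie^ia_i$, and whose Euler field is $E=\sum_i(1-\tfrac{|a_i|}2)\tau^i\partial_i$. Here a formal Frobenius (super)manifold structure means, with the Koszul sign rule throughout: $g$ is constant, graded symmetric and non-degenerate; $\circ$ is graded commutative, associative, with flat unit $e$, and $g(X\circ Y,Z)=g(X,Y\circ Z)$; there is a potential $\Phi\in\mathbb K[[\tau]]$ with $g(\partial_i\circ\partial_j,\partial_k)=\partial_i\partial_j\partial_k\Phi$; and $L_E(\circ)=\circ$, $L_Eg=(2-\tfrac n2)g$, $L_Ee=-e$. -/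

import Mathlib

noncomputable section

namespace BVInfty

/-! ### Commutative BV-infinity algebras -/

section Algebra

variable {K A : Type*} [Field K] [Ring A] [Algebra K A]

/-- The sign `(-1)^i`, for an integer `i`. -/
def sgn (i : ℤ) : ℤ := ((Int.negOnePow i : ℤˣ) : ℤ)

/-- `IsDiffOp 𝒜 k δ D`: the operator `D`, homogeneous of degree `δ`, is a differential operator of
order at most `k` on the graded commutative algebra `A = ⨁ 𝒜 i`. The recursion is on the graded
commutators `[D, a] = D ∘ (a ·) - (-1)^{δ |a|} (a ·) ∘ D`, which have to vanish when `k = 0` and to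
have order at most `k - 1` otherwise. -/
def IsDiffOp (𝒜 : ℤ → Submodule K A) : ℕ → ℤ → (A →ₗ[K] A) → Prop
  | 0, δ, D => ∀ i, ∀ a ∈ 𝒜 i,
      D ∘ₗ LinearMap.mulLeft K a - sgn (δ * i) • (LinearMap.mulLeft K a ∘ₗ D) = 0
  | k + 1, δ, D => ∀ i, ∀ a ∈ 𝒜 i,
      IsDiffOp 𝒜 k (δ + i)
        (D ∘ₗ LinearMap.mulLeft K a - sgn (δ * i) • (LinearMap.mulLeft K a ∘ₗ D))

/-- A commutative `BV_∞` algebra structure `(A, ·, Δ₀ = d, Δ₁, Δ₂, …)` on a `ℤ`-graded algebra. -/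
structure IsCommBV (𝒜 : ℤ → Submodule K A) [GradedAlgebra 𝒜] (Δ : ℕ → A →ₗ[K] A) : Prop where
  graded_comm : ∀ i j, ∀ a ∈ 𝒜 i, ∀ b ∈ 𝒜 j, a * b = sgn (i * j) • (b * a)
  degree : ∀ (k : ℕ) (i : ℤ), ∀ a ∈ 𝒜 i, Δ k a ∈ 𝒜 (i + 1 - 2 * k)
  leibniz : ∀ i, ∀ a ∈ 𝒜 i, ∀ b, Δ 0 (a * b) = Δ 0 a * b + sgn i • (a * Δ 0 b)
  order : ∀ k : ℕ, IsDiffOp 𝒜 (k + 1) (1 - 2 * k) (Δ k)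
  map_one : ∀ k, Δ k 1 = 0
  square_zero : ∀ k, ∑ q ∈ Finset.HasAntidiagonal.antidiagonal k, Δ q.1 ∘ₗ Δ q.2 = 0

/-- The cohomology `ker d / im d`. -/
abbrev Coh (d : A →ₗ[K] A) : Type _ :=
  LinearMap.ker d ⧸ (LinearMap.range d).submoduleOf (LinearMap.ker d)

/-- The class of a cocycle. -/
abbrev cls (d : A →ₗ[K] A) (z : LinearMap.ker d) : Coh d :=
  ((LinearMap.range d).submoduleOf (LinearMap.ker d)).mkQ z

/-- The part `H^i` of the cohomology, made of the classes of cocycles of degree `i`. -/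
def cohDeg (𝒜 : ℤ → Submodule K A) (d : A →ₗ[K] A) (i : ℤ) : Submodule K (Coh d) :=
  ((𝒜 i).submoduleOf (LinearMap.ker d)).map
    ((LinearMap.range d).submoduleOf (LinearMap.ker d)).mkQ

/-- A cyclic structure of dimension `n`: a trace `Tr : A → K[-n]` for which every `Δ_k` is
(anti-)selfadjoint and which induces perfect pairings `H^i × H^{n-i} → K`. -/
structure IsCyclicBV (𝒜 : ℤ → Submodule K A) (n : ℤ) (Δ : ℕ → A →ₗ[K] A) (Tr : A →ₗ[K] K) :
    Prop where
  degree : ∀ i, i ≠ n → ∀ a ∈ 𝒜 i, Tr a = 0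
  adjoint : ∀ k : ℕ, ∀ i, ∀ a ∈ 𝒜 i, ∀ b, Tr (Δ k a * b) = sgn (i + k + 1) • Tr (a * Δ k b)
  finite : ∀ i, Module.Finite K (cohDeg 𝒜 (Δ 0) i)
  nondegenerate_left : ∀ i, ∀ a ∈ 𝒜 i, Δ 0 a = 0 →
    (∀ b ∈ 𝒜 (n - i), Δ 0 b = 0 → Tr (a * b) = 0) → a ∈ LinearMap.range (Δ 0)
  nondegenerate_right : ∀ i, ∀ b ∈ 𝒜 (n - i), Δ 0 b = 0 →
    (∀ a ∈ 𝒜 i, Δ 0 a = 0 → Tr (a * b) = 0) → b ∈ LinearMap.range (Δ 0)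

/-- A (special) homotopy retract of `(A, d)` onto `(H(A), 0)`. The map `ι` picks a representing
cocycle of every class. -/
structure HomotopyRetract (𝒜 : ℤ → Submodule K A) (d : A →ₗ[K] A) where
  ι : Coh d →ₗ[K] A
  p : A →ₗ[K] Coh d
  h : A →ₗ[K] A
  ι_degree : ∀ i, ∀ x ∈ cohDeg 𝒜 d i, ι x ∈ 𝒜 i
  p_degree : ∀ i, ∀ a ∈ 𝒜 i, p a ∈ cohDeg 𝒜 d i
  h_degree : ∀ i, ∀ a ∈ 𝒜 i, h a ∈ 𝒜 (i - 1)
  d_ι : d ∘ₗ ι = 0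
  p_d : p ∘ₗ d = 0
  ι_cls : ∀ z : LinearMap.ker d, ι (cls d z) - z ∈ LinearMap.range d
  p_ι : p ∘ₗ ι = LinearMap.id
  homotopy : h ∘ₗ d + d ∘ₗ h = ι ∘ₗ p - LinearMap.id
  h_h : h ∘ₗ h = 0
  h_ι : h ∘ₗ ι = 0
  p_h : p ∘ₗ h = 0

/-- The operator `Δ_{j₁} h Δ_{j₂} h ⋯ h Δ_{j_l}` of a list `j₁, …, j_l`. -/
def word (Δ : ℕ → A →ₗ[K] A) (h : A →ₗ[K] A) : List ℕ → (A →ₗ[K] A)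
  | [] => LinearMap.id
  | [j] => Δ j
  | j :: l => Δ j ∘ₗ h ∘ₗ word Δ h l

/-- `∑ Δ_{j₁} h Δ_{j₂} h ⋯ h Δ_{j_l}` over all `l` and all `j₁ + ⋯ + j_l = k` with `j_i ≥ 1`. -/
def wordSum (Δ : ℕ → A →ₗ[K] A) (h : A →ₗ[K] A) (k : ℕ) : A →ₗ[K] A :=
  ∑ c : Composition k, word Δ h c.blocks

/-- The homotopy retract is a Hodge-to-de Rham degeneration data. -/
def IsHodgeDeRham {𝒜 : ℤ → Submodule K A} (Δ : ℕ → A →ₗ[K] A)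
    (R : HomotopyRetract 𝒜 (Δ 0)) : Prop :=
  ∀ k, 1 ≤ k → R.p ∘ₗ wordSum Δ R.h k ∘ₗ R.ι = 0

/-- The homotopy `h` is compatible with the pairing `(a, b) = Tr (a b)`. -/
def IsCompatible {𝒜 : ℤ → Submodule K A} {d : A →ₗ[K] A} (Tr : A →ₗ[K] K)
    (R : HomotopyRetract 𝒜 d) : Prop :=
  ∀ i, ∀ a ∈ 𝒜 i, ∀ b, Tr (R.h a * b) = sgn i • Tr (a * R.h b)

/-! ### Power series and Laurent series in `ħ` -/

/-- `Δ = ∑ ħ^k Δ_k` on `A[[ħ]]`. -/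
def deltaPS (Δ : ℕ → A →ₗ[K] A) (f : PowerSeries A) : PowerSeries A :=
  PowerSeries.mk fun n => ∑ q ∈ Finset.HasAntidiagonal.antidiagonal n, Δ q.1 (PowerSeries.coeff q.2 f)

/-- The inclusion `A[[ħ]] ⊆ A((ħ))`. -/
abbrev toLaurent {B : Type*} [Semiring B] (f : PowerSeries B) : LaurentSeries B :=
  HahnSeries.ofPowerSeries ℤ B f

/-- `Δ = ∑ ħ^k Δ_k` on `A((ħ))`: the action of the element `∑ ħ^k Δ_k` of `End(A)((ħ))`. -/
def deltaL (Δ : ℕ → A →ₗ[K] A) (f : LaurentSeries A) : LaurentSeries A :=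
  (HahnModule.of (Module.End K A)).symm
    ((toLaurent (PowerSeries.mk fun k => (Δ k : Module.End K A)) :
      LaurentSeries (Module.End K A)) • HahnModule.of (Module.End K A) f)

/-- `ħ^k` in `B((ħ))`. -/
abbrev hbar (B : Type*) [Semiring B] (k : ℤ) : LaurentSeries B := HahnSeries.single k 1

/-- The substitution `ħ ↦ -ħ` on `A((ħ))`. -/
def bar (f : LaurentSeries A) : LaurentSeries A where
  coeff k := sgn k • f.coeff k
  isPWO_support' := f.isPWO_support.mono fun k hk hf => hk (by simp [hf])

/-- The pairing `(α, β̄)_ħ` with values in `K((ħ))`, which induces the pairing `𝒦` on cohomology. -/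
def pairing (Tr : A →ₗ[K] K) (f g : LaurentSeries A) : LaurentSeries K :=
  (f * bar g).map Tr

/-- The canonical splitting
`S x = ι x + ∑_{k ≥ 1} ħ^k ∑_{j₁ + ⋯ + j_l = k} h Δ_{j₁} h Δ_{j₂} ⋯ h Δ_{j_l} ι x`. -/
def splitting {𝒜 : ℤ → Submodule K A} (Δ : ℕ → A →ₗ[K] A) (R : HomotopyRetract 𝒜 (Δ 0))
    (x : Coh (Δ 0)) : PowerSeries A :=
  PowerSeries.mk fun k => if k = 0 then R.ι x else R.h (wordSum Δ R.h k (R.ι x))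

/-- The classes of `α₁, …, α_μ` form a good basis of `H(A[[ħ]], Δ)`: they form a basis over
`K[[ħ]]`, and the pairings `𝒦(α_i, α_j)` are constant in `ħ`. -/
structure IsGoodBasis (Δ : ℕ → A →ₗ[K] A) (Tr : A →ₗ[K] K) {μ : ℕ}
    (α : Fin μ → PowerSeries A) : Prop where
  closed : ∀ i, deltaPS Δ (α i) = 0
  basis : ∀ f, deltaPS Δ f = 0 → ∃! c : Fin μ → PowerSeries K, ∃ g,
    f = ∑ i, PowerSeries.map (algebraMap K A) (c i) * α i + deltaPS Δ g
  good : ∀ i j, pairing Tr (toLaurent (α i)) (toLaurent (α j)) =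
    HahnSeries.C (Tr (PowerSeries.coeff 0 (α i) * PowerSeries.coeff 0 (α j)))

/-- `ħ⁻¹ Span_K {α₁, …, α_μ}[ħ⁻¹]`. -/
def oppSpan (K : Type*) {A : Type*} [Field K] [Ring A] [Algebra K A] {μ : ℕ}
    (α : Fin μ → PowerSeries A) : Submodule K (LaurentSeries A) :=
  Submodule.span K
    (Set.range fun q : Fin μ × ℕ => hbar A (-(q.2 : ℤ) - 1) * toLaurent (α q.1))

/-- The classes of the elements of `L` form a good opposite filtration: `ħ⁻¹ L ⊆ L`,
`H(A((ħ)), Δ) = H(A[[ħ]], Δ) ⊕ L`, and `Res_{ħ = 0} 𝒦(x, y) dħ = 0` for all `x, y ∈ L`. -/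
structure IsGoodOpposite (Δ : ℕ → A →ₗ[K] A) (Tr : A →ₗ[K] K)
    (L : Submodule K (LaurentSeries A)) : Prop where
  closed : ∀ x ∈ L, deltaL Δ x = 0
  hbar_inv : ∀ x ∈ L, hbar A (-1) * x ∈ L
  sum : ∀ f, deltaL Δ f = 0 →
    ∃ g, deltaPS Δ g = 0 ∧ ∃ x ∈ L, ∃ u, f = toLaurent g + x + deltaL Δ u
  direct : ∀ g, deltaPS Δ g = 0 → ∀ x ∈ L, ∀ u, toLaurent g + x = deltaL Δ u →
    (∃ v, g = deltaPS Δ v) ∧ ∃ v, x = deltaL Δ v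
  isotropic : ∀ x ∈ L, ∀ y ∈ L, (pairing Tr x y).coeff (-1) = 0

/-- The parity operator `a ↦ (-1)^{|a|} a` of a graded algebra. -/
def parity (𝒜 : ℤ → Submodule K A) [GradedAlgebra 𝒜] : A →ₗ[K] A :=
  DirectSum.toModule K ℤ A (fun i => sgn i • (𝒜 i).subtype) ∘ₗ
    (DirectSum.decomposeLinearEquiv 𝒜).toLinearMap

end Algebra

/-! ### Formal power series in graded commuting variables

The variable `τ_i` has degree `2 - deg i`, where `deg : Fin μ → ℤ`; its parity is that of `deg i`.
A series `∑ τ^m x_m`, with coefficients to the right of the ordered monomials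
`τ^m = τ_1^{m_1} ⋯ τ_μ^{m_μ}`, is given by the function `m ↦ x_m`, which has to vanish on the
exponents `m` with `m_i ≥ 2` for an odd `i` (the predicate `Reduced`). -/

section Series

variable {μ : ℕ}

/-- Series in `τ_1, …, τ_μ` with coefficients in `B`. -/
abbrev Series (μ : ℕ) (B : Type*) : Type _ := (Fin μ →₀ ℕ) → B

/-- The parity (`0` or `1`) of the `i`-th variable. -/
def par (deg : Fin μ → ℤ) (i : Fin μ) : ℕ := if Odd (deg i) then 1 else 0

/-- The number of odd factors in `τ^m`. -/
def oddPart (deg : Fin μ → ℤ) (m : Fin μ →₀ ℕ) : ℕ := ∑ i, par deg i * m i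

/-- The degree of the monomial `τ^m`. -/
def monDeg (deg : Fin μ → ℤ) (m : Fin μ →₀ ℕ) : ℤ := ∑ i, (m i : ℤ) * (2 - deg i)

/-- No square of an odd variable occurs in `f`. -/
def Reduced {B : Type*} [Zero B] (deg : Fin μ → ℤ) (f : Series μ B) : Prop :=
  ∀ m, (∃ i, Odd (deg i) ∧ 2 ≤ m i) → f m = 0

/-- The sign `ε` (possibly `0`) in `τ^m τ^{m'} = ε τ^{m + m'}`. -/
def koszul (deg : Fin μ → ℤ) (m m' : Fin μ →₀ ℕ) : ℤ :=
  if ∃ i, Odd (deg i) ∧ 2 ≤ m i + m' i then 0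
  else (-1) ^ (∑ i, ∑ j, if j < i then par deg i * par deg j * (m i * m' j) else 0)

/-- The product of series with coefficients in a graded algebra `B` with parity operator `σ`:
`(τ^m x) (τ^{m'} y) = (-1)^{|x| |τ^{m'}|} τ^m τ^{m'} x y`. -/
def mulS {B : Type*} [Ring B] (deg : Fin μ → ℤ) (σ : B → B) (f g : Series μ B) : Series μ B :=
  fun m => ∑ q ∈ Finset.HasAntidiagonal.antidiagonal m,
    koszul deg q.1 q.2 • (σ^[oddPart deg q.2] (f q.1) * g q.2)

/-- The product of a scalar series `c` (on the left) with a series `f`. -/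
def smulS {K B : Type*} [Field K] [AddCommGroup B] [Module K B] (deg : Fin μ → ℤ)
    (c : Series μ K) (f : Series μ B) : Series μ B :=
  fun m => ∑ q ∈ Finset.HasAntidiagonal.antidiagonal m, koszul deg q.1 q.2 • (c q.1 • f q.2)

/-- The (left) derivative `∂/∂τ_i`. -/
def dS {B : Type*} [AddCommGroup B] (deg : Fin μ → ℤ) (i : Fin μ) (f : Series μ B) :
    Series μ B :=
  fun m => ((-1 : ℤ) ^ (∑ j, if j < i then par deg i * par deg j * m j else 0) * ((m i : ℤ) + 1)) •
    f (m + Finsupp.single i 1)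

/-- The constant series. -/
def constS {B : Type*} [Zero B] (x : B) : Series μ B := fun m => if m = 0 then x else 0

/-- The linear series `∑ τ_i x_i`. -/
def linS {B : Type*} [AddCommMonoid B] (x : Fin μ → B) : Series μ B :=
  fun m => ∑ i, if m = Finsupp.single i 1 then x i else 0

/-- The powers of a series. -/
def powS {B : Type*} [Ring B] (deg : Fin μ → ℤ) (σ : B → B) (f : Series μ B) : ℕ → Series μ B
  | 0 => constS 1
  | k + 1 => mulS deg σ f (powS deg σ f k)

/-- The exponential of a series without constant term. (The coefficient of `τ^m` in `f^k` is zero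
for `k` larger than the total degree of `m`.) -/
def expS (K : Type*) {B : Type*} [Field K] [Ring B] [Module K B] (deg : Fin μ → ℤ) (σ : B → B)
    (f : Series μ B) : Series μ B :=
  fun m => ∑ k ∈ Finset.range (m.degree + 1), ((k.factorial : K)⁻¹) • powS deg σ f k m

/-- The action on functions of the Euler vector field `E = ∑ (1 - deg i / 2) τ_i ∂_i`. -/
def eulerS {K : Type*} [Field K] (deg : Fin μ → ℤ) (f : Series μ K) : Series μ K :=
  fun m => ((monDeg deg m : K) / 2) * f m

/-- A formal Frobenius (super)manifold structure of charge `n / 2` on the formal neighbourhood of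
`0` in a graded vector space with a homogeneous basis of degrees `deg i`, written in the flat
coordinates `τ_i` dual to this basis. The metric is `g(∂_i, ∂_j) = metric i j`, the product is
`∂_i ∘ ∂_j = ∑_k prod i j k ∂_k`, the unit is `∑ unit i ∂_i` and the Euler vector field is
`E = ∑ (1 - deg i / 2) τ_i ∂_i`. Both the metric and the product are linear over functions on the
left. -/
structure FormalFrobenius (K : Type*) [Field K] (deg : Fin μ → ℤ) (n : ℤ) where
  metric : Matrix (Fin μ) (Fin μ) K
  prod : Fin μ → Fin μ → Fin μ → Series μ K
  unit : Fin μ → K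
  potential : Series μ K
  prod_reduced : ∀ i j k, Reduced deg (prod i j k)
  potential_reduced : Reduced deg potential
  /-- The metric is constant in the coordinates `τ_i`, graded symmetric and nondegenerate. -/
  metric_symm : ∀ i j, metric i j = sgn (deg i * deg j) • metric j i
  metric_nondegenerate : IsUnit metric.det
  prod_comm : ∀ i j k, prod i j k = sgn (deg i * deg j) • prod j i k
  /-- `(∂_i ∘ ∂_j) ∘ ∂_k = ∂_i ∘ (∂_j ∘ ∂_k)`. -/
  prod_assoc : ∀ i j k l,
    ∑ s, mulS deg id (prod i j s) (prod s k l) =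
      ∑ s, sgn (deg i * (deg j + deg k + deg s)) • mulS deg id (prod j k s) (prod i s l)
  /-- `g(∂_i ∘ ∂_j, ∂_k) = g(∂_i, ∂_j ∘ ∂_k)`. -/
  invariant : ∀ i j k,
    ∑ s, metric s k • prod i j s =
      ∑ s, sgn (deg i * (deg j + deg k + deg s)) • (metric i s • prod j k s)
  /-- `g(∂_i ∘ ∂_j, ∂_k) = ∂_i ∂_j ∂_k Φ` for the potential `Φ`. -/
  potential_eq : ∀ i j k,
    ∑ s, metric s k • prod i j s = dS deg i (dS deg j (dS deg k potential))
  /-- The flat vector field `e = ∑ unit i ∂_i` is the unit of the product. -/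
  unit_eq : ∀ j k, ∑ i, unit i • prod i j k = constS (if j = k then 1 else 0)
  /-- `L_E e = -e`. -/
  unit_degree : ∀ i, unit i ≠ 0 → deg i = 0
  /-- `L_E g = (2 - n / 2) g`. -/
  metric_degree : ∀ i j, metric i j ≠ 0 → deg i + deg j = n
  /-- `L_E (∘) = ∘`. -/
  prod_degree : ∀ i j k,
    eulerS deg (prod i j k) = (((deg i + deg j - deg k : ℤ) : K) / 2) • prod i j k

end Series

/-! ### Solutions of the quantum master equation -/

section Master

variable {K A : Type*} [Field K] [Ring A] [Algebra K A] {μ : ℕ}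

/-- `e^{Γ/ħ}`, a series in the variables `τ_i` with coefficients in `A((ħ))`. -/
def expGamma (𝒜 : ℤ → Submodule K A) [GradedAlgebra 𝒜] (deg : Fin μ → ℤ)
    (Γ : Series μ (PowerSeries A)) : Series μ (LaurentSeries A) :=
  expS K deg (fun f : LaurentSeries A => f.map (parity 𝒜))
    (fun m => hbar A (-1) * toLaurent (Γ m))

/-- The section `ħ ∂_i e^{Γ/ħ}`. -/
def sec (𝒜 : ℤ → Submodule K A) [GradedAlgebra 𝒜] (deg : Fin μ → ℤ)
    (Γ : Series μ (PowerSeries A)) (i : Fin μ) : Series μ (LaurentSeries A) :=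
  fun m => hbar A 1 * dS deg i (expGamma 𝒜 deg Γ) m

/-- `Γ = ∑ τ_i α_i + O(τ²)`, with coefficients in `A[[ħ]]` and homogeneous of degree `2`, is a
universal solution of the quantum master equation `Δ e^{Γ/ħ} = 0`, and the `τ_i` are its flat
coordinates: `[ħ e^{Γ/ħ} - ħ] = ∑ τ_i [α_i]` modulo the classes of `L[[τ]]`, where
`L = ħ⁻¹ Span_K {α_i}[ħ⁻¹]`. -/
structure IsFlatSolution (𝒜 : ℤ → Submodule K A) [GradedAlgebra 𝒜] (Δ : ℕ → A →ₗ[K] A)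
    (deg : Fin μ → ℤ) (α : Fin μ → PowerSeries A) (Γ : Series μ (PowerSeries A)) : Prop where
  reduced : Reduced deg Γ
  constant : Γ 0 = 0
  linear : ∀ i, Γ (Finsupp.single i 1) = α i
  degree : ∀ (m : Fin μ →₀ ℕ) (k : ℕ), PowerSeries.coeff k (Γ m) ∈ 𝒜 (2 - 2 * k - monDeg deg m)
  master : ∀ m, deltaL Δ (expGamma 𝒜 deg Γ m) = 0
  flat : ∀ m, ∃ x ∈ oppSpan K α, ∃ u : LaurentSeries A,
    hbar A 1 * expGamma 𝒜 deg Γ m - constS (hbar A 1) m =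
      linS (fun i => toLaurent (α i)) m + x + deltaL Δ u

/-- The Frobenius structure `F` is the one defined by `Γ`. Its product is determined by
`ħ∂_i ħ∂_j e^{Γ/ħ} = ∑_k (∂_i ∘ ∂_j)^k ħ∂_k e^{Γ/ħ}` in `H(A((ħ)), Δ)[[τ]]`, and its metric is the
pairing `𝒦(ħ∂_i e^{Γ/ħ}, ħ∂_j e^{Γ/ħ})`. -/
structure IsInducedBy (𝒜 : ℤ → Submodule K A) [GradedAlgebra 𝒜] (Δ : ℕ → A →ₗ[K] A)
    (Tr : A →ₗ[K] K) {deg : Fin μ → ℤ} {n : ℤ} (Γ : Series μ (PowerSeries A))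
    (F : FormalFrobenius K deg n) : Prop where
  prod : ∀ i j m, ∃ u : LaurentSeries A,
    hbar A 1 * dS deg i (sec 𝒜 deg Γ j) m =
      ∑ k, smulS deg (F.prod i j k) (sec 𝒜 deg Γ k) m + deltaL Δ u
  metric : ∀ i j m,
    (mulS deg (fun f : LaurentSeries A => f.map (parity 𝒜)) (sec 𝒜 deg Γ i)
      (fun m' => bar (sec 𝒜 deg Γ j m')) m).map Tr = constS (HahnSeries.C (F.metric i j)) m

end Master

end BVInfty

end

open BVInfty

/-!
The operator `Δ = d + ħ Δ_1 + ⋯` on `A[[ħ]]` is a perturbation of `d`. Homological perturbation theory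
turns the retract `(ι, p, h)` of `A` onto `H(A)` into maps `S`, `P`, `H` with `ΔH + HΔ = SP - 1`
(`perturbed_homotopy`), and the degeneration condition says that the perturbed differential `PΔS` on
`H(A)[[ħ]]` is zero, so that `ΔS = 0` (`deltaOp_mul_inclOp`) and the `S(a_i)` generate the cohomology
of `A[[ħ]]` (`exists_splitting_expansion`). Compatibility with the pairing makes the pairings of the
`S(a_i)` constant (`isFrame_splitting`). Given such a *frame* `α_i`, with constant invertible pairing
matrix, all questions about cohomology classes become questions about their coordinates, which are
computed by pairing with the `α_j`: a closed element is exact if and only if its coordinates vanish.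

A flat unit requires that the class of `1` is a combination of the `α_i` with constant coefficients.
If it is not so for `S(a_i)`, an Eichler transformation moving `S([1])` to `1` produces a frame for
which it is (`exists_frame`).

The master equation is solved by induction on the degree in `τ`. If it holds in lower degrees, its
failure in the next degree is a coefficient of `e^{-Γ/ħ} Δ e^{Γ/ħ}`, a sum of iterated commutators of
`Δ` with `Γ/ħ`. As `Δ_l` has order at most `l + 1`, its `j`-fold commutators vanish for `j > l + 1`, so
the failure lies in `ħ⁻¹ A[[ħ]]` (`exists_hbar_mul_deltaL_exp`). It is exact in `A((ħ))`, hence its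
coordinates vanish and it is exact in `ħ⁻¹ A[[ħ]]` too; so it can be corrected. The freedom left, a
closed element of `A[[ħ]]`, is used to remove the nonnegative powers of `ħ` in the coordinates of
`ħ e^{Γ/ħ}` beyond `ħ + ∑ τ_i α_i`. This gives the solution in flat coordinates
(`IsPartial.exists_correction`, `exists_isPartial`).

The Frobenius structure rests on one principle. Series in `A[[ħ]][[τ]] e^{Γ/ħ}` pair without poles,
because `Γ(ħ)/ħ - Γ(-ħ)/ħ` has none (`coeff_pairing_of_isExpInt`). Hence such a series, if it is closed
and has coordinates in `ħ⁻¹ K[ħ⁻¹]`, is exact (`IsExpInt.coord_eq_zero`). The sections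
`s_j = ħ ∂_j e^{Γ/ħ}` and their derivatives `ħ ∂_i s_j` are of this form, and the coordinates of `s_j`
are `δ_{jl} + ħ⁻¹ ∂_j Φ_l + O(ħ⁻²)`. So `ħ ∂_i s_j` and `∑_k (∂_i ∂_j Φ_k) s_k` differ by an exact series,
which is the product formula (`coord_product`); the same argument shows that `∑_i e_i s_i` is
cohomologous to `e^{Γ/ħ}`, which is the unit axiom (`coordS_unit`). The pairings of the `s_i` have
neither poles nor positive powers of `ħ`, so they are constant (`pairing_secS`); the vanishing of their
coefficient of `ħ⁻¹` says that the one-form with components `∑_k G_{kj} Φ_k` is closed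
(`lowered_closed`), and a primitive of it is the potential (`SS.exists_potential`). Commutativity and
invariance follow from the symmetry of its derivatives, associativity from that of the second
derivatives of the coordinates of `s_k` (`sum_twist_structConst`), and the Euler field records that
everything is homogeneous (`structConst_degree`).
-/

noncomputable section

namespace BVInfty

/-! ### Signs of monomials in graded commuting variables -/

section Signs

variable {μ : ℕ} (deg : Fin μ → ℤ)

/-- The monomial `τ^m` vanishes, since it contains the square of an odd variable. -/
def IsBad (m : Fin μ →₀ ℕ) : Prop := ∃ i, Odd (deg i) ∧ 2 ≤ m i

/-- The number of transpositions of odd variables needed to order `τ^m τ^{m'}`. -/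
def swapCount (m m' : Fin μ →₀ ℕ) : ℕ :=
  ∑ i, ∑ j, if j < i then par deg i * par deg j * (m i * m' j) else 0

variable {deg}

theorem IsBad.add_right {m : Fin μ →₀ ℕ} (h : IsBad deg m) (m' : Fin μ →₀ ℕ) :
    IsBad deg (m + m') := by
  obtain ⟨i, hi, h⟩ := h
  exact ⟨i, hi, by simp only [Finsupp.add_apply]; omega⟩

theorem IsBad.add_left {m : Fin μ →₀ ℕ} (h : IsBad deg m) (m' : Fin μ →₀ ℕ) :
    IsBad deg (m' + m) := by
  rw [add_comm]; exact h.add_right m'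

open Classical in
theorem koszul_def (m m' : Fin μ →₀ ℕ) :
    koszul deg m m' = if IsBad deg (m + m') then 0 else (-1) ^ swapCount deg m m' := by
  unfold koszul IsBad swapCount
  simp only [Finsupp.add_apply]
  congr

theorem koszul_of_isBad {m m' : Fin μ →₀ ℕ} (h : IsBad deg (m + m')) : koszul deg m m' = 0 := by
  rw [koszul_def, if_pos h]

theorem koszul_of_not_isBad {m m' : Fin μ →₀ ℕ} (h : ¬ IsBad deg (m + m')) :
    koszul deg m m' = (-1) ^ swapCount deg m m' := by
  rw [koszul_def, if_neg h]

theorem swapCount_add_left (a b c : Fin μ →₀ ℕ) :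
    swapCount deg (a + b) c = swapCount deg a c + swapCount deg b c := by
  simp only [swapCount, ← Finset.sum_add_distrib]
  refine Finset.sum_congr rfl fun i _ => Finset.sum_congr rfl fun j _ => ?_
  split_ifs <;> simp [add_mul, mul_add]

theorem swapCount_add_right (a b c : Fin μ →₀ ℕ) :
    swapCount deg a (b + c) = swapCount deg a b + swapCount deg a c := by
  simp only [swapCount, ← Finset.sum_add_distrib]
  refine Finset.sum_congr rfl fun i _ => Finset.sum_congr rfl fun j _ => ?_
  split_ifs <;> simp [mul_add]

@[simp] theorem swapCount_zero_left (a : Fin μ →₀ ℕ) : swapCount deg 0 a = 0 := by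
  simp [swapCount]

@[simp] theorem swapCount_zero_right (a : Fin μ →₀ ℕ) : swapCount deg a 0 = 0 := by
  simp [swapCount]

theorem koszul_zero_left {a : Fin μ →₀ ℕ} (h : ¬ IsBad deg a) : koszul deg 0 a = 1 := by
  rw [koszul_of_not_isBad (by simpa using h)]; simp

theorem koszul_zero_right {a : Fin μ →₀ ℕ} (h : ¬ IsBad deg a) : koszul deg a 0 = 1 := by
  rw [koszul_of_not_isBad (by simpa using h)]; simp

/-- The signs form a two-cocycle, which makes the product of series associative. -/
theorem koszul_assoc (a b c : Fin μ →₀ ℕ) :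
    koszul deg a b * koszul deg (a + b) c = koszul deg b c * koszul deg a (b + c) := by
  by_cases h : IsBad deg (a + b + c)
  · rw [koszul_of_isBad h, koszul_of_isBad (m := a) (m' := b + c) (by rwa [← add_assoc])]; simp
  · rw [koszul_of_not_isBad h, koszul_of_not_isBad (m := a) (m' := b + c) (by rwa [← add_assoc]),
      koszul_of_not_isBad (fun h' => h (h'.add_right c)),
      koszul_of_not_isBad (m := b) (fun h' => h (by rw [add_assoc]; exact h'.add_left a)),
      swapCount_add_left, swapCount_add_right, ← pow_add, ← pow_add]
    congr 1; omega

theorem oddPart_add (a b : Fin μ →₀ ℕ) : oddPart deg (a + b) = oddPart deg a + oddPart deg b := by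
  simp [oddPart, ← Finset.sum_add_distrib, mul_add]

@[simp] theorem oddPart_zero : oddPart deg (0 : Fin μ →₀ ℕ) = 0 := by simp [oddPart]

@[simp] theorem oddPart_single (i : Fin μ) : oddPart deg (Finsupp.single i 1) = par deg i := by
  simp [oddPart, Finsupp.single_apply]

theorem par_eq_zero_or_one (i : Fin μ) : par deg i = 0 ∨ par deg i = 1 := by
  unfold par; split_ifs <;> simp

theorem par_eq_one {i : Fin μ} (h : Odd (deg i)) : par deg i = 1 := by simp [par, h]

theorem odd_of_par {i : Fin μ} (h : par deg i = 1) : Odd (deg i) := by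
  unfold par at h; by_contra h'; simp [h'] at h

theorem even_of_par {i : Fin μ} (h : par deg i = 0) : ¬ Odd (deg i) := by
  intro h'; simp [par, h'] at h

theorem neg_one_pow_par (i : Fin μ) : ((-1 : ℤ)) ^ par deg i = sgn (deg i) := by
  unfold par sgn
  split_ifs with h
  · simp [Int.negOnePow_odd _ h]
  · simp [Int.negOnePow_even _ (Int.not_odd_iff_even.mp h)]

theorem oddPart_mul_oddPart {a b : Fin μ →₀ ℕ} (h : ¬ IsBad deg (a + b)) :
    oddPart deg a * oddPart deg b = swapCount deg a b + swapCount deg b a := by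
  have h1 : swapCount deg b a =
      ∑ i, ∑ j, if i < j then par deg i * par deg j * (a i * b j) else 0 := by
    rw [swapCount, Finset.sum_comm]
    refine Finset.sum_congr rfl fun i _ => Finset.sum_congr rfl fun j _ => ?_
    split_ifs
    · ring
    · rfl
  rw [h1, oddPart, oddPart, Finset.sum_mul_sum, swapCount, ← Finset.sum_add_distrib]
  refine Finset.sum_congr rfl fun i _ => ?_
  rw [← Finset.sum_add_distrib]
  refine Finset.sum_congr rfl fun j _ => ?_
  rcases lt_trichotomy i j with hij | rfl | hij
  · simp [hij, hij.not_gt]; ring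
  · simp only [lt_irrefl, if_false, add_zero]
    rcases par_eq_zero_or_one (deg := deg) i with h0 | h0
    · simp [h0]
    · have : ¬ 2 ≤ a i + b i := fun h2 => h ⟨i, odd_of_par h0, by simpa using h2⟩
      have : a i = 0 ∨ b i = 0 := by omega
      rcases this with h | h <;> simp [h]
  · simp [hij, hij.not_gt]; ring

/-- Monomials in the `τ_i` are graded commutative. -/
theorem koszul_comm (a b : Fin μ →₀ ℕ) :
    koszul deg a b = (-1) ^ (oddPart deg a * oddPart deg b) * koszul deg b a := by
  by_cases h : IsBad deg (a + b)
  · rw [koszul_of_isBad h, koszul_of_isBad (by rwa [add_comm])]; simp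
  · rw [koszul_of_not_isBad h, koszul_of_not_isBad (m := b) (by rwa [add_comm]),
      oddPart_mul_oddPart h, pow_add, mul_assoc, ← pow_add, ← two_mul, pow_mul]
    simp

/-- The number of odd variables with index smaller than `i` in `τ^m`, if `τ_i` is odd. -/
def leftCount (deg : Fin μ → ℤ) (i : Fin μ) (m : Fin μ →₀ ℕ) : ℕ :=
  ∑ j, if j < i then par deg i * par deg j * m j else 0

theorem leftCount_add (i : Fin μ) (a b : Fin μ →₀ ℕ) :
    leftCount deg i (a + b) = leftCount deg i a + leftCount deg i b := by
  simp only [leftCount, ← Finset.sum_add_distrib]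
  refine Finset.sum_congr rfl fun j _ => ?_
  split_ifs <;> simp [mul_add]

theorem leftCount_single (i j : Fin μ) :
    leftCount deg i (Finsupp.single j 1) = if j < i then par deg i * par deg j else 0 := by
  rw [leftCount, Finset.sum_eq_single j]
  · simp
  · intro k _ hk; simp [hk.symm]
  · simp

@[simp] theorem leftCount_zero (i : Fin μ) : leftCount deg i 0 = 0 := by simp [leftCount]

theorem leftCount_of_par {i : Fin μ} (h : par deg i = 0) (m : Fin μ →₀ ℕ) :
    leftCount deg i m = 0 := by simp [leftCount, h]

theorem swapCount_single_left (i : Fin μ) (m : Fin μ →₀ ℕ) :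
    swapCount deg (Finsupp.single i 1) m = leftCount deg i m := by
  rw [swapCount, leftCount, Finset.sum_eq_single i]
  · simp
  · intro k _ hk; simp [hk.symm]
  · simp

theorem swapCount_single_right {i : Fin μ} {m : Fin μ →₀ ℕ}
    (h : ¬ IsBad deg (m + Finsupp.single i 1)) :
    swapCount deg m (Finsupp.single i 1) + leftCount deg i m = oddPart deg m * par deg i := by
  rw [← oddPart_single (deg := deg) i, oddPart_mul_oddPart h, swapCount_single_left]

theorem swapCount_single_right_of_par {i : Fin μ} (h : par deg i = 0) (m : Fin μ →₀ ℕ) :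
    swapCount deg m (Finsupp.single i 1) = 0 := by
  rw [swapCount]
  refine Finset.sum_eq_zero fun k _ => Finset.sum_eq_zero fun j _ => ?_
  by_cases hj : j = i
  · subst hj; simp [h]
  · simp [Ne.symm hj]

theorem dS_apply {B : Type*} [AddCommGroup B] (i : Fin μ) (f : Series μ B) (m : Fin μ →₀ ℕ) :
    dS deg i f m = ((-1 : ℤ) ^ leftCount deg i m * ((m i : ℤ) + 1)) • f (m + Finsupp.single i 1) :=
  rfl

theorem isBad_iff_of_par {i : Fin μ} (h : par deg i = 0) (m : Fin μ →₀ ℕ) :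
    IsBad deg (m + Finsupp.single i 1) ↔ IsBad deg m := by
  refine ⟨fun ⟨k, hk, h2⟩ => ⟨k, hk, ?_⟩, fun h => h.add_right _⟩
  have : k ≠ i := by rintro rfl; exact even_of_par h hk
  simpa [Finsupp.single_apply, this.symm] using h2

end Signs

/-! ### The algebra of series in graded commuting variables -/

section SuperSeries

variable {μ : ℕ} {K B B' : Type*} [Field K] [Ring B] [Algebra K B] [Ring B'] [Algebra K B']

open Finset.HasAntidiagonal (antidiagonal)

/-- Reduced series with coefficients in an algebra `B` with a parity operator `σ`. They form an
associative algebra under `mulS`; this only needs `σ` to be an algebra endomorphism. -/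
structure SS (deg : Fin μ → ℤ) (σ : B →ₐ[K] B) where
  val : Series μ B
  reduced : Reduced deg val

theorem Reduced.of_isBad {B : Type*} [Zero B] {deg : Fin μ → ℤ} {f : Series μ B}
    (hf : Reduced deg f) {m : Fin μ →₀ ℕ} (hm : IsBad deg m) : f m = 0 := hf m hm

theorem reduced_mulS {B : Type*} [Ring B] (deg : Fin μ → ℤ) (σ : B → B) (f g : Series μ B) :
    Reduced deg (mulS deg σ f g) := by
  intro m hm
  refine Finset.sum_eq_zero fun q hq => ?_
  rw [koszul_of_isBad, zero_smul]
  rw [Finset.HasAntidiagonal.mem_antidiagonal.mp hq]; exact hm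

theorem reduced_constS {B : Type*} [Zero B] (deg : Fin μ → ℤ) (x : B) :
    Reduced deg (constS x : Series μ B) := by
  rintro m ⟨i, _, hi⟩
  rw [constS, if_neg]
  rintro rfl
  simp at hi

theorem reduced_dS {B : Type*} [AddCommGroup B] {deg : Fin μ → ℤ} (i : Fin μ) {f : Series μ B}
    (hf : Reduced deg f) : Reduced deg (dS deg i f) := by
  intro m hm
  rw [dS_apply, hf.of_isBad (IsBad.add_right hm _), smul_zero]

namespace SS

variable {deg : Fin μ → ℤ} {σ : B →ₐ[K] B} {σ' : B' →ₐ[K] B'}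

instance : CoeFun (SS deg σ) fun _ => (Fin μ →₀ ℕ) → B := ⟨SS.val⟩

theorem ext {f g : SS deg σ} (h : ∀ m, f m = g m) : f = g := by
  cases f; cases g; congr; exact funext h

theorem val_injective : Function.Injective (SS.val : SS deg σ → Series μ B) :=
  fun _ _ h => ext fun m => congrFun h m

instance : Add (SS deg σ) := ⟨fun f g => ⟨f.val + g.val, fun m hm => by
  simp [f.reduced m hm, g.reduced m hm]⟩⟩
instance : Zero (SS deg σ) := ⟨⟨0, fun _ _ => rfl⟩⟩
instance : Neg (SS deg σ) := ⟨fun f => ⟨-f.val, fun m hm => by simp [f.reduced m hm]⟩⟩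
instance : Sub (SS deg σ) := ⟨fun f g => ⟨f.val - g.val, fun m hm => by
  simp [f.reduced m hm, g.reduced m hm]⟩⟩
instance : SMul ℕ (SS deg σ) := ⟨fun n f => ⟨n • f.val, fun m hm => by simp [f.reduced m hm]⟩⟩
instance : SMul ℤ (SS deg σ) := ⟨fun n f => ⟨n • f.val, fun m hm => by simp [f.reduced m hm]⟩⟩

instance : AddCommGroup (SS deg σ) :=
  val_injective.addCommGroup _ rfl (fun _ _ => rfl) (fun _ => rfl) (fun _ _ => rfl)
    (fun _ _ => rfl) (fun _ _ => rfl)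

@[simp] theorem add_apply (f g : SS deg σ) (m) : (f + g) m = f m + g m := rfl
@[simp] theorem zero_apply (m) : (0 : SS deg σ) m = 0 := rfl
@[simp] theorem sub_apply (f g : SS deg σ) (m) : (f - g) m = f m - g m := rfl

instance : One (SS deg σ) := ⟨⟨constS 1, reduced_constS _ _⟩⟩

instance : Mul (SS deg σ) := ⟨fun f g => ⟨mulS deg σ f g, reduced_mulS _ _ _ _⟩⟩

theorem iterate_apply (n : ℕ) (x : B) : σ^[n] x = (σ ^ n) x := by
  induction n with
  | zero => rfl
  | succ n ih => rw [Function.iterate_succ_apply', ih, pow_succ', AlgHom.mul_apply]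

theorem mul_apply (f g : SS deg σ) (m) : (f * g) m =
    ∑ q ∈ antidiagonal m, koszul deg q.1 q.2 • ((σ ^ oddPart deg q.2) (f q.1) * g q.2) := by
  simp only [← iterate_apply]; rfl

theorem mk_mul (f g : SS deg σ) : (f * g).1 = mulS deg σ f.1 g.1 := rfl

theorem one_apply (m) : (1 : SS deg σ) m = if m = 0 then 1 else 0 := rfl

/-- Constant series. -/
def const (σ : B →ₐ[K] B) (x : B) : SS deg σ := ⟨constS x, reduced_constS _ _⟩

theorem const_apply (x : B) (m) : (const σ x : SS deg σ) m = if m = 0 then x else 0 := rfl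

theorem mul_const_apply (f : SS deg σ) (x : B) (m) : (f * const σ x : SS deg σ) m = f m * x := by
  rw [mul_apply, Finset.sum_eq_single (m, 0)]
  · by_cases h : IsBad deg m
    · rw [f.reduced.of_isBad h]; simp
    · simp [koszul_zero_right h, const_apply]
  · rintro ⟨a, b⟩ hq hne
    have : b ≠ 0 := by
      rintro rfl; apply hne; simpa using Finset.HasAntidiagonal.mem_antidiagonal.mp hq
    simp [const_apply, this]
  · intro h; simp at h

theorem const_mul_apply (f : SS deg σ) (x : B) (m) :
    (const σ x * f : SS deg σ) m = (σ ^ oddPart deg m) x * f m := by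
  rw [mul_apply, Finset.sum_eq_single (0, m)]
  · by_cases h : IsBad deg m
    · rw [f.reduced.of_isBad h]; simp
    · simp [koszul_zero_left h, const_apply]
  · rintro ⟨a, b⟩ hq hne
    have : a ≠ 0 := by
      rintro rfl; apply hne; simpa using Finset.HasAntidiagonal.mem_antidiagonal.mp hq
    simp [const_apply, this]
  · intro h; simp at h

theorem one_eq : (1 : SS deg σ) = const σ 1 := rfl

protected theorem mul_assoc (f g h : SS deg σ) : f * g * h = f * (g * h) := by
  refine ext fun m => ?_
  simp only [mul_apply, map_sum, Finset.sum_mul, Finset.mul_sum, Finset.smul_sum,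
    Finset.sum_sigma']
  refine Finset.sum_nbij' (fun ⟨⟨_i, j⟩, ⟨k, l⟩⟩ ↦ ⟨(k, l + j), (l, j)⟩)
    (fun ⟨⟨i, _j⟩, ⟨k, l⟩⟩ ↦ ⟨(i + k, l), (i, k)⟩) ?_ ?_ ?_ ?_ ?_
  · rintro ⟨⟨i, j⟩, ⟨k, l⟩⟩ hq
    simp only [Finset.mem_sigma, Finset.HasAntidiagonal.mem_antidiagonal] at hq ⊢
    simp [← hq.1, ← hq.2, add_assoc]
  · rintro ⟨⟨i, j⟩, ⟨k, l⟩⟩ hq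
    simp only [Finset.mem_sigma, Finset.HasAntidiagonal.mem_antidiagonal] at hq ⊢
    simp [← hq.1, ← hq.2, add_assoc]
  · rintro ⟨⟨i, j⟩, ⟨k, l⟩⟩ hq
    simp only [Finset.mem_sigma, Finset.HasAntidiagonal.mem_antidiagonal] at hq ⊢
    simp [← hq.2]
  · rintro ⟨⟨i, j⟩, ⟨k, l⟩⟩ hq
    simp only [Finset.mem_sigma, Finset.HasAntidiagonal.mem_antidiagonal] at hq ⊢
    simp [← hq.2]
  · rintro ⟨⟨i, c⟩, ⟨a, b⟩⟩ hq
    simp only [Finset.mem_sigma, Finset.HasAntidiagonal.mem_antidiagonal] at hq ⊢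
    obtain ⟨-, rfl⟩ := hq
    simp only [map_zsmul, map_mul, smul_mul_assoc, mul_smul_comm, smul_smul]
    rw [mul_comm (koszul deg (a + b) c), koszul_assoc, mul_comm, oddPart_add,
      add_comm (oddPart deg b), pow_add,
      AlgHom.mul_apply, mul_assoc]

instance : Ring (SS deg σ) where
  __ := (inferInstance : AddCommGroup (SS deg σ))
  mul_assoc := SS.mul_assoc
  one_mul f := ext fun m => by rw [one_eq, const_mul_apply, map_one, one_mul]
  mul_one f := ext fun m => by rw [one_eq, mul_const_apply, mul_one]
  left_distrib f g h := ext fun m => by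
    simp only [mul_apply, add_apply, mul_add, smul_add, Finset.sum_add_distrib]
  right_distrib f g h := ext fun m => by
    simp only [mul_apply, add_apply, map_add, add_mul, smul_add, Finset.sum_add_distrib]
  zero_mul f := ext fun m => by simp [mul_apply]
  mul_zero f := ext fun m => by simp [mul_apply]

/-- The coefficient of `τ^m`. -/
def coeff (m : Fin μ →₀ ℕ) : SS deg σ →+ B where
  toFun f := f m
  map_zero' := rfl
  map_add' _ _ := rfl

@[simp] theorem zsmul_apply (n : ℤ) (f : SS deg σ) (m) : (n • f) m = n • f m :=
  map_zsmul (coeff m) n f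

@[simp] theorem nsmul_apply (n : ℕ) (f : SS deg σ) (m) : (n • f) m = n • f m :=
  map_nsmul (coeff m) n f

theorem sum_apply {ι : Type*} (s : Finset ι) (f : ι → SS deg σ) (m) :
    (∑ i ∈ s, f i) m = ∑ i ∈ s, f i m :=
  map_sum (coeff m) f s

instance : SMul K (SS deg σ) := ⟨fun c f => ⟨fun m => c • f m, fun m hm => by
  simp [f.reduced m hm]⟩⟩

@[simp] theorem smul_apply (c : K) (f : SS deg σ) (m) : (c • f) m = c • f m := rfl

instance : Module K (SS deg σ) where
  one_smul f := ext fun m => by simp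
  mul_smul c d f := ext fun m => by simp [mul_smul]
  smul_zero c := ext fun m => by simp
  smul_add c f g := ext fun m => by simp
  add_smul c d f := ext fun m => by simp [add_smul]
  zero_smul f := ext fun m => by simp

instance : Algebra K (SS deg σ) := Algebra.ofModule
  (fun c f g => ext fun m => by
    simp only [mul_apply, smul_apply, map_smul, smul_mul_assoc, Finset.smul_sum]
    exact Finset.sum_congr rfl fun q _ => smul_comm _ _ _)
  (fun c f g => ext fun m => by
    simp only [mul_apply, smul_apply, mul_smul_comm, Finset.smul_sum]
    exact Finset.sum_congr rfl fun q _ => smul_comm _ _ _)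

/-- Functoriality in the coefficients. -/
def map (φ : B →+* B') (h : ∀ x, φ (σ x) = σ' (φ x)) : SS deg σ →+* SS deg σ' where
  toFun f := ⟨fun m => φ (f m), fun m hm => by simp [f.reduced m hm]⟩
  map_one' := ext fun m => by
    change φ ((1 : SS deg σ) m) = _
    rw [one_apply, one_apply]; split_ifs <;> simp
  map_zero' := ext fun m => map_zero φ
  map_add' f g := ext fun m => map_add φ _ _
  map_mul' f g := ext fun m => by
    have hn : ∀ (n : ℕ) x, φ ((σ ^ n) x) = (σ' ^ n) (φ x) := by
      intro n
      induction n with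
      | zero => intro x; rfl
      | succ n ih => intro x; rw [pow_succ, pow_succ, AlgHom.mul_apply, AlgHom.mul_apply, ih, h]
    change φ ((f * g) m) = _
    rw [mul_apply, mul_apply, map_sum]
    refine Finset.sum_congr rfl fun q _ => ?_
    rw [map_zsmul, map_mul, hn]

@[simp] theorem map_apply (φ : B →+* B') (h : ∀ x, φ (σ x) = σ' (φ x)) (f : SS deg σ) (m) :
    map φ h f m = φ (f m) := rfl

/-! #### Even series are central -/

/-- The coefficient of `τ^m` in `f` has the parity of `τ^m`, so that `f` is even. -/
def IsEven (f : SS deg σ) : Prop := ∀ m, σ (f m) = (-1 : ℤ) ^ oddPart deg m • f m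

theorem IsEven.pow_apply {f : SS deg σ} (hf : f.IsEven) (n : ℕ) (m) :
    (σ ^ n) (f m) = (-1 : ℤ) ^ (n * oddPart deg m) • f m := by
  induction n with
  | zero => simp
  | succ n ih =>
    rw [pow_succ', AlgHom.mul_apply, ih, map_zsmul, hf m, smul_smul, ← pow_add]
    congr 2; ring

/-- The algebra `B` is graded commutative for the parity operator `σ`. -/
def IsSuperComm (σ : B →ₐ[K] B) : Prop :=
  ∀ (s : ℕ) (x y : B), σ x = (-1 : ℤ) ^ s • x → x * y = (σ ^ s) y * x

theorem IsEven.commute (hσ : IsSuperComm σ) {f : SS deg σ} (hf : f.IsEven) (g : SS deg σ) :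
    f * g = g * f := by
  refine ext fun m => ?_
  rw [mul_apply, mul_apply]
  refine Finset.sum_bij' (fun q _ => q.swap) (fun q _ => q.swap) ?_ ?_ ?_ ?_ ?_
  · intro q hq; simpa [add_comm] using hq
  · intro q hq; simpa [add_comm] using hq
  · intro q _; simp
  · intro q _; simp
  · rintro ⟨a, b⟩ _
    simp only [Prod.swap_prod_mk, hf.pow_apply]
    rw [smul_mul_assoc, hσ _ _ _ (hf a), smul_smul, koszul_comm b a]
    congr 1
    rw [mul_comm]

theorem IsEven.mul {f g : SS deg σ} (hf : f.IsEven) (hg : g.IsEven) : (f * g).IsEven := by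
  intro m
  rw [mul_apply, map_sum, Finset.smul_sum]
  refine Finset.sum_congr rfl fun q hq => ?_
  rw [hf.pow_apply, map_zsmul, map_mul, map_zsmul, hf, hg, ← Finset.HasAntidiagonal.mem_antidiagonal.mp hq,
    oddPart_add, pow_add]
  simp only [smul_mul_assoc, mul_smul_comm, smul_smul]
  congr 1; ring

theorem isEven_one : (1 : SS deg σ).IsEven := by
  intro m
  rw [one_apply]; split_ifs with h <;> simp [h]

theorem IsEven.pow {f : SS deg σ} (hf : f.IsEven) (n : ℕ) : (f ^ n).IsEven := by
  induction n with
  | zero => simpa using isEven_one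
  | succ n ih => rw [pow_succ]; exact ih.mul hf

theorem IsEven.smul {f : SS deg σ} (hf : f.IsEven) (c : K) : (c • f).IsEven := by
  intro m; rw [smul_apply, map_smul, hf m, smul_comm]

/-! #### Derivatives -/

/-- The derivative `∂/∂τ_i`. -/
def d (i : Fin μ) : SS deg σ →+ SS deg σ where
  toFun f := ⟨dS deg i f, reduced_dS i f.reduced⟩
  map_zero' := ext fun m => by simp [dS_apply]
  map_add' f g := ext fun m => by
    simp [dS_apply]

theorem d_apply (i : Fin μ) (f : SS deg σ) (m) :
    d i f m = ((-1 : ℤ) ^ leftCount deg i m * ((m i : ℤ) + 1)) • f (m + Finsupp.single i 1) := rfl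

theorem d_val (i : Fin μ) (f : SS deg σ) : (d i f).1 = dS deg i f.1 := rfl

theorem d_smul (i : Fin μ) (c : K) (f : SS deg σ) : d i (c • f) = c • d i f :=
  ext fun m => by rw [d_apply, smul_apply, smul_apply, d_apply, smul_comm]

theorem d_comm (i j : Fin μ) (f : SS deg σ) :
    d i (d j f) = (-1 : ℤ) ^ (par deg i * par deg j) • d j (d i f) := by
  refine ext fun m => ?_
  rw [zsmul_apply]
  simp only [d_apply, smul_smul, leftCount_add, leftCount_single, Finsupp.add_apply]
  rw [add_right_comm m]
  rcases lt_trichotomy i j with h | rfl | h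
  · simp only [h, h.not_gt, if_true, if_false, add_zero, pow_add, Finsupp.single_eq_of_ne h.ne,
      Finsupp.single_eq_of_ne h.ne']
    congr 1
    rw [mul_comm (par deg j)]; ring
  · rcases par_eq_zero_or_one (deg := deg) i with h0 | h0
    · simp [h0]
    · rw [f.reduced.of_isBad ⟨i, odd_of_par h0, by simp⟩]; simp
  · simp only [h, h.not_gt, if_true, if_false, add_zero, pow_add, Finsupp.single_eq_of_ne h.ne,
      Finsupp.single_eq_of_ne h.ne']
    congr 1
    have : ((-1 : ℤ) ^ (par deg i * par deg j)) * ((-1 : ℤ) ^ (par deg i * par deg j)) = 1 := by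
      rw [← mul_pow]; simp
    linear_combination (-((-1 : ℤ) ^ leftCount deg i m * (↑(m i) + 1) *
      ((-1) ^ leftCount deg j m * (↑(m j) + 1)))) * this

/-- The total parity operator, to the power `|τ_i|`. -/
def twist (i : Fin μ) (f : SS deg σ) : SS deg σ :=
  ⟨fun m => (-1 : ℤ) ^ (par deg i * oddPart deg m) • (σ ^ par deg i) (f m), fun m hm => by
    simp [f.reduced m hm]⟩

theorem twist_apply (i : Fin μ) (f : SS deg σ) (m) :
    twist i f m = (-1 : ℤ) ^ (par deg i * oddPart deg m) • (σ ^ par deg i) (f m) := rfl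

theorem IsEven.twist {f : SS deg σ} (hf : f.IsEven) (i : Fin μ) : SS.twist i f = f := by
  refine ext fun m => ?_
  rw [twist_apply, hf.pow_apply, smul_smul, ← mul_pow]
  simp

theorem sum_antidiagonal_shift_fst {M : Type*} [AddCommMonoid M] (i : Fin μ) (m : Fin μ →₀ ℕ)
    (H : (Fin μ →₀ ℕ) → (Fin μ →₀ ℕ) → M) (hH : ∀ a b, a i = 0 → H a b = 0) :
    ∑ q ∈ antidiagonal m, H (q.1 + Finsupp.single i 1) q.2 =
      ∑ q ∈ antidiagonal (m + Finsupp.single i 1), H q.1 q.2 := by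
  refine Finset.sum_of_injOn (fun q => (q.1 + Finsupp.single i 1, q.2)) ?_ ?_ ?_ ?_
  · rintro ⟨a, b⟩ _ ⟨a', b'⟩ _ h; simpa using h
  · rintro ⟨a, b⟩ h
    simp only [Finset.mem_coe, Finset.HasAntidiagonal.mem_antidiagonal] at h ⊢
    rw [← h, add_right_comm]
  · rintro ⟨a, b⟩ h hn
    apply hH
    by_contra h0
    apply hn
    have hle : Finsupp.single i 1 ≤ a := by
      simpa [Finsupp.single_le_iff] using Nat.one_le_iff_ne_zero.mpr h0
    refine ⟨(a - Finsupp.single i 1, b), ?_, ?_⟩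
    · simp only [Finset.mem_coe, Finset.HasAntidiagonal.mem_antidiagonal] at h ⊢
      apply add_right_cancel (b := Finsupp.single i 1)
      rw [← h, add_right_comm, tsub_add_cancel_of_le hle]
    · simp [tsub_add_cancel_of_le hle]
  · intro q _; rfl

theorem sum_antidiagonal_shift_snd {M : Type*} [AddCommMonoid M] (i : Fin μ) (m : Fin μ →₀ ℕ)
    (H : (Fin μ →₀ ℕ) → (Fin μ →₀ ℕ) → M) (hH : ∀ a b, b i = 0 → H a b = 0) :
    ∑ q ∈ antidiagonal m, H q.1 (q.2 + Finsupp.single i 1) =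
      ∑ q ∈ antidiagonal (m + Finsupp.single i 1), H q.1 q.2 := by
  have hs : ∀ (k : Fin μ →₀ ℕ) (f : (Fin μ →₀ ℕ) × (Fin μ →₀ ℕ) → M),
      ∑ q ∈ antidiagonal k, f q = ∑ q ∈ antidiagonal k, f q.swap := fun k f =>
    Finset.sum_bij' (fun q _ => q.swap) (fun q _ => q.swap)
      (fun q hq => by simpa [add_comm] using hq) (fun q hq => by simpa [add_comm] using hq)
      (fun _ _ => rfl) (fun _ _ => rfl) (fun _ _ => rfl)
  rw [hs, hs (m + _)]
  exact sum_antidiagonal_shift_fst i m (fun a b => H b a) fun a b h => hH b a h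

end SS
end SuperSeries

section SuperSeries

variable {μ : ℕ} {K B B' : Type*} [Field K] [Ring B] [Algebra K B] [Ring B'] [Algebra K B']

open Finset.HasAntidiagonal (antidiagonal mem_antidiagonal)

theorem koszul_add_single_left_of_par {deg : Fin μ → ℤ} {i : Fin μ} (h : par deg i = 0)
    (a b : Fin μ →₀ ℕ) : koszul deg (a + Finsupp.single i 1) b = koszul deg a b := by
  by_cases hb : IsBad deg (a + b)
  · rw [koszul_of_isBad hb, koszul_of_isBad (by rw [add_right_comm]; exact hb.add_right _)]
  · rw [koszul_of_not_isBad hb, koszul_of_not_isBad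
      (by rwa [add_right_comm, isBad_iff_of_par h]), swapCount_add_left, swapCount_single_left,
      leftCount_of_par h, add_zero]

theorem koszul_add_single_right_of_par {deg : Fin μ → ℤ} {i : Fin μ} (h : par deg i = 0)
    (a b : Fin μ →₀ ℕ) : koszul deg a (b + Finsupp.single i 1) = koszul deg a b := by
  by_cases hb : IsBad deg (a + b)
  · rw [koszul_of_isBad hb, koszul_of_isBad (by rw [← add_assoc]; exact hb.add_right _)]
  · rw [koszul_of_not_isBad hb, koszul_of_not_isBad
      (by rwa [← add_assoc, isBad_iff_of_par h]), swapCount_add_right,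
      swapCount_single_right_of_par h, add_zero]

/-- The signs in the Leibniz rule for the term in which `∂_i` acts on the left factor. For an odd
`τ_i` this needs that the factors which remain do not contain it. -/
theorem koszul_leibniz_left {deg : Fin μ → ℤ} {i : Fin μ} {a b m : Fin μ →₀ ℕ}
    (h : a + b = m) (hm : par deg i = 1 → m i = 0) :
    (-1) ^ leftCount deg i m * koszul deg (a + Finsupp.single i 1) b =
      koszul deg a b * (-1) ^ leftCount deg i a := by
  subst h
  rcases par_eq_zero_or_one (deg := deg) i with h0 | h1
  · rw [koszul_add_single_left_of_par h0, leftCount_of_par h0, leftCount_of_par h0]; ring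
  have hm := hm h1
  by_cases hb : IsBad deg (a + b)
  · rw [koszul_of_isBad hb, koszul_of_isBad (by rw [add_right_comm]; exact hb.add_right _)]; simp
  · have hb' : ¬ IsBad deg (a + Finsupp.single i 1 + b) := by
      rintro ⟨k, hk, h2⟩
      by_cases hki : k = i
      · subst hki; simp at h2 hm; omega
      · exact hb ⟨k, hk, by simpa [Finsupp.single_apply, Ne.symm hki] using h2⟩
    rw [koszul_of_not_isBad hb, koszul_of_not_isBad hb', swapCount_add_left,
      swapCount_single_left, leftCount_add]
    simp only [← pow_add]
    rw [show leftCount deg i a + leftCount deg i b + (swapCount deg a b + leftCount deg i b) =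
      swapCount deg a b + leftCount deg i a + 2 * leftCount deg i b by ring, pow_add, pow_mul]
    simp

/-- The signs in the Leibniz rule for the term in which `∂_i` acts on the right factor. For an odd
`τ_i` this needs that the factors which remain do not contain it. -/
theorem koszul_leibniz_right {deg : Fin μ → ℤ} {i : Fin μ} {a b m : Fin μ →₀ ℕ}
    (h : a + b = m) (hm : par deg i = 1 → m i = 0) :
    (-1) ^ leftCount deg i m * koszul deg a (b + Finsupp.single i 1) =
      koszul deg a b * ((-1) ^ (par deg i * oddPart deg a) * (-1) ^ leftCount deg i b) := by
  subst h
  rcases par_eq_zero_or_one (deg := deg) i with h0 | h1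
  · rw [koszul_add_single_right_of_par h0, leftCount_of_par h0, leftCount_of_par h0, h0]; ring
  have hm := hm h1
  by_cases hb : IsBad deg (a + b)
  · rw [koszul_of_isBad hb, koszul_of_isBad (by rw [← add_assoc]; exact hb.add_right _)]; simp
  · have hb' : ¬ IsBad deg (a + b + Finsupp.single i 1) := by
      rintro ⟨k, hk, h2⟩
      by_cases hki : k = i
      · subst hki; simp at h2 hm; omega
      · exact hb ⟨k, hk, by simpa [Finsupp.single_apply, Ne.symm hki] using h2⟩
    have ha : ¬ IsBad deg (a + Finsupp.single i 1) := fun h => hb' (by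
      rw [add_right_comm]; exact h.add_right b)
    rw [koszul_of_not_isBad hb, koszul_of_not_isBad (by rwa [← add_assoc]), swapCount_add_right,
      leftCount_add, mul_comm (par deg i), ← swapCount_single_right ha]
    simp only [← pow_add]
    congr 1; ring

/-- The two contributions to `∂_i` of a product of two terms containing the odd `τ_i` cancel. -/
theorem koszul_leibniz_both {deg : Fin μ → ℤ} {i : Fin μ} (h1 : par deg i = 1)
    (a b : Fin μ →₀ ℕ) :
    koszul deg a (b + Finsupp.single i 1) * (-1) ^ leftCount deg i a +
      koszul deg (a + Finsupp.single i 1) b *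
        ((-1) ^ (par deg i * oddPart deg (a + Finsupp.single i 1)) * (-1) ^ leftCount deg i b) =
      0 := by
  have e : a + Finsupp.single i 1 + b = a + (b + Finsupp.single i 1) := by
    rw [add_assoc, add_comm b]
  by_cases hbad : IsBad deg (a + (b + Finsupp.single i 1))
  · rw [koszul_of_isBad hbad, koszul_of_isBad (by rwa [e])]; simp
  · have ha' : ¬ IsBad deg (a + Finsupp.single i 1) := fun h => hbad (by
      rw [← e]; exact h.add_right b)
    rw [koszul_of_not_isBad hbad, koszul_of_not_isBad (by rwa [e]), swapCount_add_right,
      swapCount_add_left, swapCount_single_left, oddPart_add, oddPart_single, h1,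
      one_mul]
    have := swapCount_single_right ha'
    rw [h1, mul_one] at this
    rw [← this]
    simp only [← pow_add]
    rw [show swapCount deg a b + leftCount deg i b + (swapCount deg a (Finsupp.single i 1) +
      leftCount deg i a + 1 + leftCount deg i b) = swapCount deg a b +
      swapCount deg a (Finsupp.single i 1) + leftCount deg i a + 1 + 2 * leftCount deg i b by ring,
      pow_add _ _ (2 * _), pow_mul, pow_succ]
    simp

namespace SS

variable {deg : Fin μ → ℤ} {σ : B →ₐ[K] B} {σ' : B' →ₐ[K] B'}

theorem eq_add_single {a : Fin μ →₀ ℕ} {i : Fin μ} (h : a i ≠ 0) :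
    ∃ a', a = a' + Finsupp.single i 1 :=
  ⟨a - Finsupp.single i 1, (tsub_add_cancel_of_le (by
    simpa [Finsupp.single_le_iff] using Nat.one_le_iff_ne_zero.mpr h)).symm⟩

/-- The Leibniz rule. -/
theorem d_mul (i : Fin μ) (f g : SS deg σ) :
    d i (f * g) = d i f * g + twist i f * d i g := by
  refine ext fun m => ?_
  set t : (Fin μ →₀ ℕ) → (Fin μ →₀ ℕ) → B := fun a b => (σ ^ oddPart deg b) (f a) * g b with ht
  let H1 : (Fin μ →₀ ℕ) → (Fin μ →₀ ℕ) → B := fun a b => if a i = 0 then 0 else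
    (koszul deg (a - Finsupp.single i 1) b *
      ((-1) ^ leftCount deg i (a - Finsupp.single i 1) * (a i : ℤ))) • t a b
  let H2 : (Fin μ →₀ ℕ) → (Fin μ →₀ ℕ) → B := fun a b => if b i = 0 then 0 else
    (koszul deg a (b - Finsupp.single i 1) * ((-1) ^ (par deg i * oddPart deg a) *
      ((-1) ^ leftCount deg i (b - Finsupp.single i 1) * (b i : ℤ)))) • t a b
  have h1 : (d i f * g : SS deg σ) m =
      ∑ q ∈ antidiagonal (m + Finsupp.single i 1), H1 q.1 q.2 := by
    rw [mul_apply, ← sum_antidiagonal_shift_fst i m H1 (fun a b h => if_pos h)]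
    refine Finset.sum_congr rfl fun q _ => ?_
    simp only [H1, ht]
    rw [if_neg (by simp), add_tsub_cancel_right, d_apply, map_zsmul, smul_mul_assoc, smul_smul]
    simp
  have h2 : (twist i f * d i g : SS deg σ) m =
      ∑ q ∈ antidiagonal (m + Finsupp.single i 1), H2 q.1 q.2 := by
    rw [mul_apply, ← sum_antidiagonal_shift_snd i m H2 (fun a b h => if_pos h)]
    refine Finset.sum_congr rfl fun q _ => ?_
    simp only [H2, ht]
    rw [if_neg (by simp), add_tsub_cancel_right, d_apply, twist_apply, map_zsmul, smul_mul_assoc,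
      mul_smul_comm, smul_smul, smul_smul, oddPart_add, oddPart_single, pow_add, AlgHom.mul_apply]
    congr 1
    rw [Finsupp.add_apply, Finsupp.single_eq_same]
    push_cast
    ring
  rw [add_apply, h1, h2, d_apply, mul_apply, Finset.smul_sum, ← Finset.sum_add_distrib]
  refine Finset.sum_congr rfl ?_
  rintro ⟨a, b⟩ hq
  rw [mem_antidiagonal] at hq
  simp only at hq
  rw [smul_smul]
  change _ • t a b = H1 a b + H2 a b
  have hi : a i + b i = m i + 1 := by simpa using DFunLike.congr_fun hq i
  by_cases hbig : par deg i = 1 ∧ (2 ≤ a i ∨ 2 ≤ b i)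
  · have : t a b = 0 := by
      rcases hbig with ⟨hp, h | h⟩
      · simp [ht, f.reduced.of_isBad ⟨i, odd_of_par hp, h⟩]
      · simp [ht, g.reduced.of_isBad ⟨i, odd_of_par hp, h⟩]
    simp [H1, H2, this]
  by_cases ha : a i = 0
  · have hb : b i ≠ 0 := by omega
    obtain ⟨b, rfl⟩ := eq_add_single hb
    simp only [Finsupp.add_apply, Finsupp.single_eq_same] at hi hb hbig
    have hab : a + b = m := by
      apply add_right_cancel (b := Finsupp.single i 1); rw [← hq, add_assoc]
    simp only [H1, H2]
    rw [if_pos ha, if_neg (by simp), add_tsub_cancel_right, zero_add]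
    congr 1
    have := koszul_leibniz_right (deg := deg) (i := i) hab (fun hp => by
      by_contra h; exact hbig ⟨hp, Or.inr (by omega)⟩)
    have hmi : (m i : ℤ) = b i := by exact_mod_cast (by omega)
    rw [hmi]
    simp only [Finsupp.add_apply, Finsupp.single_eq_same]
    push_cast
    linear_combination ((b i : ℤ) + 1) * this
  obtain ⟨a, rfl⟩ := eq_add_single ha
  simp only [Finsupp.add_apply, Finsupp.single_eq_same] at hi ha hbig
  have hab : a + b = m := by
    apply add_right_cancel (b := Finsupp.single i 1); rw [← hq, add_right_comm]
  have hl := koszul_leibniz_left (deg := deg) (i := i) hab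
  by_cases hb : b i = 0
  · simp only [H1, H2]
    rw [if_neg (by simp), if_pos hb, add_tsub_cancel_right, add_zero]
    congr 1
    have := hl (fun hp => by by_contra h; exact hbig ⟨hp, Or.inl (by omega)⟩)
    have hmi : (m i : ℤ) = a i := by exact_mod_cast (by omega)
    rw [hmi]
    simp only [Finsupp.add_apply, Finsupp.single_eq_same]
    push_cast
    linear_combination ((a i : ℤ) + 1) * this
  obtain ⟨b, rfl⟩ := eq_add_single hb
  simp only [Finsupp.add_apply, Finsupp.single_eq_same] at hi hb hbig
  simp only [H1, H2]
  rw [if_neg (by simp), if_neg (by simp), add_tsub_cancel_right, add_tsub_cancel_right, ← add_smul]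
  congr 1
  rcases par_eq_zero_or_one (deg := deg) i with h0 | h1
  · simp only [koszul_add_single_right_of_par h0, koszul_add_single_left_of_par h0,
      leftCount_of_par h0, h0, Finsupp.add_apply, Finsupp.single_eq_same]
    have : (m i : ℤ) = a i + b i + 1 := by exact_mod_cast (by omega)
    rw [this]; push_cast; ring
  · have ha0 : a i = 0 := by by_contra h; exact hbig ⟨h1, Or.inl (by omega)⟩
    have hb0 : b i = 0 := by by_contra h; exact hbig ⟨h1, Or.inr (by omega)⟩
    have := koszul_leibniz_both h1 a b
    rw [koszul_of_isBad ⟨i, odd_of_par h1, by simp; omega⟩]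
    simp only [Finsupp.add_apply, Finsupp.single_eq_same, ha0, hb0]
    push_cast
    linear_combination -this

/-! #### The order of a series, and exponentials -/

/-- All terms of `f` have at least `n` factors `τ_i`. -/
def OrdGE (n : ℕ) (f : SS deg σ) : Prop := ∀ m, m.degree < n → f m = 0

theorem OrdGE.mul {a b : ℕ} {f g : SS deg σ} (hf : f.OrdGE a) (hg : g.OrdGE b) :
    (f * g).OrdGE (a + b) := by
  intro m hm
  rw [mul_apply]
  refine Finset.sum_eq_zero fun q hq => ?_
  have : q.1.degree + q.2.degree = m.degree := by
    rw [← map_add, mem_antidiagonal.mp hq]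
  by_cases h : q.1.degree < a
  · simp [hf _ h]
  · simp [hg q.2 (by omega)]

theorem ordGE_zero (f : SS deg σ) : f.OrdGE 0 := fun _ h => absurd h (by simp)

theorem OrdGE.pow {f : SS deg σ} (hf : f.OrdGE 1) (n : ℕ) : (f ^ n).OrdGE n := by
  induction n with
  | zero => exact ordGE_zero _
  | succ n ih => rw [pow_succ]; exact ih.mul hf

theorem ordGE_one {f : SS deg σ} (h : f 0 = 0) : f.OrdGE 1 := by
  intro m hm
  rw [Nat.lt_one_iff, Finsupp.degree_eq_zero_iff] at hm
  rw [hm, h]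

theorem mul_apply_congr {f f' g g' : SS deg σ} {m : Fin μ →₀ ℕ}
    (hf : ∀ a : Fin μ →₀ ℕ, a.degree ≤ m.degree → f a = f' a)
    (hg : ∀ a : Fin μ →₀ ℕ, a.degree ≤ m.degree → g a = g' a) :
    (f * g) m = (f' * g') m := by
  rw [mul_apply, mul_apply]
  refine Finset.sum_congr rfl fun q hq => ?_
  have : q.1.degree + q.2.degree = m.degree := by
    rw [← map_add, mem_antidiagonal.mp hq]
  rw [hf q.1 (by omega), hg q.2 (by omega)]

theorem pow_val (f : SS deg σ) (k : ℕ) : (f ^ k).val = powS deg σ f.val k := by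
  induction k with
  | zero => rfl
  | succ k ih => rw [pow_succ', mk_mul, ih]; rfl

/-- The truncated exponential series. -/
def expTrunc (M : ℕ) (f : SS deg σ) : SS deg σ :=
  ∑ k ∈ Finset.range M, ((k.factorial : K)⁻¹) • f ^ k

/-- The exponential of a series without constant term. -/
def exp (f : SS deg σ) : SS deg σ where
  val := expS K deg σ f.val
  reduced m hm := by
    refine Finset.sum_eq_zero fun k _ => ?_
    rw [← pow_val, (f ^ k).reduced m hm, smul_zero]

theorem exp_val (f : SS deg σ) : (exp f).val = expS K deg σ f.val := rfl

theorem exp_apply (f : SS deg σ) (m : Fin μ →₀ ℕ) :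
    exp f m = ∑ k ∈ Finset.range (m.degree + 1), ((k.factorial : K)⁻¹) • (f ^ k) m := by
  simp only [pow_val]; rfl

theorem expTrunc_apply (M : ℕ) (f : SS deg σ) (m : Fin μ →₀ ℕ) :
    expTrunc M f m = ∑ k ∈ Finset.range M, ((k.factorial : K)⁻¹) • (f ^ k) m := by
  rw [expTrunc, sum_apply]; rfl

theorem exp_apply_of_lt {f : SS deg σ} (hf : f.OrdGE 1) {M : ℕ} {m : Fin μ →₀ ℕ}
    (h : m.degree < M) : exp f m = expTrunc M f m := by
  rw [exp_apply, expTrunc_apply]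
  refine Finset.sum_subset (Finset.range_subset_range.mpr h) fun k _ hk => ?_
  rw [hf.pow k m (by simpa using hk), smul_zero]

theorem exp_apply_zero (f : SS deg σ) : exp f 0 = 1 := by
  rw [exp_apply]; simp [one_apply]

theorem IsEven.exp {f : SS deg σ} (hf : f.IsEven) : (SS.exp f).IsEven := by
  intro m
  rw [exp_apply, map_sum, Finset.smul_sum]
  exact Finset.sum_congr rfl fun k _ => ((hf.pow k).smul _) m

/-- The product of `exp f` with a series `∑ Z_j / j!`, collected by total order. -/
theorem exp_mul_sum_apply [CharZero K] {f : SS deg σ} (hf : f.OrdGE 1) {Z : ℕ → SS deg σ}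
    (hZ : ∀ j, (Z j).OrdGE j) {M : ℕ} {m : Fin μ →₀ ℕ} (hm : m.degree < M) :
    (exp f * ∑ j ∈ Finset.range M, ((j.factorial : K)⁻¹) • Z j) m =
      ∑ k ∈ Finset.range M, ((k.factorial : K)⁻¹) •
        (∑ q ∈ antidiagonal k, k.choose q.1 • (f ^ q.1 * Z q.2)) m := by
  rw [mul_apply_congr (f' := expTrunc M f) (g' := ∑ j ∈ Finset.range M, ((j.factorial : K)⁻¹) • Z j)
    (fun a ha => exp_apply_of_lt hf (by omega)) (fun _ _ => rfl),
    expTrunc, Finset.sum_mul_sum, ← Finset.sum_product', sum_apply]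
  let T : ℕ × ℕ → B := fun q => ((q.1.factorial : K)⁻¹ * (q.2.factorial : K)⁻¹) •
    (f ^ q.1 * Z q.2) m
  have h1 : ∀ k : ℕ, ((k.factorial : K)⁻¹) •
      (∑ q ∈ antidiagonal k, k.choose q.1 • (f ^ q.1 * Z q.2)) m = ∑ q ∈ antidiagonal k, T q := by
    intro k
    rw [sum_apply, Finset.smul_sum]
    refine Finset.sum_congr rfl fun q hq => ?_
    rw [nsmul_apply, ← Nat.cast_smul_eq_nsmul K, smul_smul]
    congr 1
    have hq' : q.1 + q.2 = k := mem_antidiagonal.mp hq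
    have hc := Nat.choose_mul_factorial_mul_factorial (n := k) (k := q.1) (by omega)
    rw [show k - q.1 = q.2 by omega] at hc
    have : ((k.factorial : ℕ) : K) = (k.choose q.1 : K) * q.1.factorial * q.2.factorial := by
      exact_mod_cast hc.symm
    have h1 : (q.1.factorial : K) ≠ 0 := by exact_mod_cast q.1.factorial_ne_zero
    have h2 : (q.2.factorial : K) ≠ 0 := by exact_mod_cast q.2.factorial_ne_zero
    have h3 : (k.factorial : K) ≠ 0 := by exact_mod_cast k.factorial_ne_zero
    rw [this] at h3 ⊢
    have h4 : (k.choose q.1 : K) ≠ 0 := fun h => h3 (by rw [h]; ring)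
    field_simp
  simp only [h1]
  have h2 : ∀ q ∈ Finset.range M ×ˢ Finset.range M,
      (((q.1.factorial : K)⁻¹ • f ^ q.1) * ((q.2.factorial : K)⁻¹ • Z q.2) : SS deg σ) m =
        if q.1 + q.2 < M then T q else 0 := by
    intro q _
    rw [smul_mul_assoc, mul_smul_comm, smul_smul, smul_apply]
    split_ifs with h
    · rfl
    · rw [((hf.pow q.1).mul (hZ q.2)) m (by omega), smul_zero]
  rw [Finset.sum_congr rfl h2, ← Finset.sum_filter,
    ← Finset.sum_fiberwise_of_maps_to (t := Finset.range M) (g := fun q : ℕ × ℕ => q.1 + q.2)]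
  · refine Finset.sum_congr rfl fun k hk => Finset.sum_congr ?_ fun _ _ => rfl
    ext q
    simp only [mem_antidiagonal, Finset.mem_filter, Finset.mem_product, Finset.mem_range] at hk ⊢
    omega
  · intro q hq
    simpa using (Finset.mem_filter.mp hq).2

theorem exp_add {f g : SS deg σ} [CharZero K] (hfg : Commute f g) (hf : f.OrdGE 1)
    (hg : g.OrdGE 1) : exp (f + g) = exp f * exp g := by
  refine ext fun m => ?_
  rw [mul_apply_congr (f' := exp f) (g' := expTrunc (m.degree + 1) g) (fun _ _ => rfl)
    (fun a ha => exp_apply_of_lt hg (by omega)), expTrunc,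
    exp_mul_sum_apply hf hg.pow (Nat.lt_succ_self _), exp_apply]
  exact Finset.sum_congr rfl fun k _ => by rw [hfg.add_pow']

theorem d_pow (hσ : IsSuperComm σ) (i : Fin μ) {f : SS deg σ} (hf : f.IsEven) (k : ℕ) :
    d i (f ^ (k + 1)) = (k + 1) • (d i f * f ^ k) := by
  induction k with
  | zero => simp
  | succ k ih =>
    rw [pow_succ' _ (k + 1), d_mul, hf.twist, ih, mul_smul_comm, ← mul_assoc, hf.commute hσ,
      mul_assoc, ← pow_succ', succ_nsmul' _ (k + 1)]

theorem d_exp [CharZero K] (hσ : IsSuperComm σ) (i : Fin μ) {f : SS deg σ} (hf : f.IsEven)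
    (h1 : f.OrdGE 1) : d i (exp f) = d i f * exp f := by
  refine ext fun m => ?_
  rw [mul_apply_congr (f' := d i f) (g' := expTrunc (m.degree + 1) f) (fun _ _ => rfl)
    (fun a ha => exp_apply_of_lt h1 (by omega))]
  have : d i (exp f) m = d i (expTrunc (m.degree + 2) f) m := by
    rw [d_apply, d_apply, exp_apply_of_lt h1]
    simp
  rw [this, expTrunc, Finset.sum_range_succ', map_add, map_sum, expTrunc, Finset.mul_sum]
  have h0 : d i ((((Nat.factorial 0 : ℕ) : K)⁻¹) • f ^ 0) = 0 := by
    refine ext fun m => ?_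
    rw [d_apply, smul_apply, pow_zero, one_apply, if_neg]
    · simp
    · intro h; simpa using DFunLike.congr_fun h i
  rw [h0, add_zero]
  congr 1
  refine Finset.sum_congr rfl fun k _ => ?_
  rw [d_smul, d_pow hσ i hf, mul_smul_comm, ← Nat.cast_smul_eq_nsmul K, smul_smul]
  congr 1
  rw [Nat.factorial_succ]
  have h1 : ((k + 1 : ℕ) : K) ≠ 0 := by exact_mod_cast k.succ_ne_zero
  push_cast at h1 ⊢
  field_simp

/-- If two series without constant term agree in degrees below `N`, then so do their powers, and the
second and higher powers agree in degree `N` as well. -/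
theorem pow_apply_congr {f g : SS deg σ} {N : ℕ} (hf : f.OrdGE 1) (hg : g.OrdGE 1)
    (h : ∀ a : Fin μ →₀ ℕ, a.degree < N → f a = g a) (k : ℕ) :
    (∀ a : Fin μ →₀ ℕ, a.degree < N → (f ^ k) a = (g ^ k) a) ∧
    (2 ≤ k → ∀ a : Fin μ →₀ ℕ, a.degree ≤ N → (f ^ k) a = (g ^ k) a) := by
  induction k with
  | zero => exact ⟨fun _ _ => rfl, fun h => absurd h (by simp)⟩
  | succ k ih =>
    refine ⟨fun a ha => ?_, fun hk a ha => ?_⟩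
    · rw [pow_succ', pow_succ']
      exact mul_apply_congr (fun b hb => h b (by omega)) (fun b hb => ih.1 b (by omega))
    · rw [pow_succ', pow_succ', mul_apply, mul_apply]
      refine Finset.sum_congr rfl fun q hq => ?_
      have hdeg : q.1.degree + q.2.degree = a.degree := by
        rw [← map_add, mem_antidiagonal.mp hq]
      by_cases h1 : q.1.degree = 0
      · rw [hf q.1 (by omega), hg q.1 (by omega)]
        simp
      by_cases h2 : q.2.degree = 0
      · rw [hf.pow k q.2 (by omega), hg.pow k q.2 (by omega)]
        simp
      · rw [h q.1 (by omega), ih.1 q.2 (by omega)]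

/-- The coefficient of `τ^m` in `e^f` is that of `f` plus a term that depends only on the
coefficients of lower degree. -/
theorem exp_sub_exp {f g : SS deg σ} {m : Fin μ →₀ ℕ} (hf : f.OrdGE 1) (hg : g.OrdGE 1)
    (h : ∀ a : Fin μ →₀ ℕ, a.degree < m.degree → f a = g a) :
    exp f m - exp g m = f m - g m := by
  rw [exp_apply, exp_apply, ← Finset.sum_sub_distrib]
  have hz : m.degree = 0 → f m - g m = 0 := fun h0 => by
    rw [hf m (by omega), hg m (by omega), sub_zero]
  rw [Finset.sum_eq_single 1]
  · simp
  · intro k _ hk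
    rcases Nat.lt_or_ge k 2 with h2 | h2
    · have : k = 0 := by omega
      subst this; simp
    · rw [(pow_apply_congr hf hg h k).2 h2 m le_rfl, sub_self]
  · intro h1
    have : m.degree = 0 := by simpa using h1
    simp [hz this]

theorem map_exp (φ : B →+* B') (h : ∀ x, φ (σ x) = σ' (φ x)) (hφ : ∀ (c : K) x, φ (c • x) = c • φ x)
    (f : SS deg σ) : map φ h (exp f) = exp (map φ h f) := by
  refine ext fun m => ?_
  rw [map_apply, exp_apply, exp_apply, map_sum]
  refine Finset.sum_congr rfl fun k _ => ?_
  rw [hφ, ← map_pow]; rfl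

theorem map_d (φ : B →+* B') (h : ∀ x, φ (σ x) = σ' (φ x)) (i : Fin μ) (f : SS deg σ) :
    map φ h (d i f) = d i (map φ h f) := by
  refine ext fun m => ?_
  rw [map_apply, d_apply, d_apply, map_zsmul]; rfl

end SS
end SuperSeries

/-! ### Signs and parity on graded algebras -/

section Parity

theorem sgn_add (i j : ℤ) : sgn (i + j) = sgn i * sgn j := by simp [sgn, Int.negOnePow_add]

@[simp] theorem sgn_zero : sgn 0 = 1 := by simp [sgn]

theorem sgn_mul_self (i : ℤ) : sgn i * sgn i = 1 := by
  rcases Int.units_eq_one_or (Int.negOnePow i) with h | h <;> simp [sgn, h]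

theorem sgn_natCast (n : ℕ) : sgn n = (-1) ^ n := by simp [sgn, Int.coe_negOnePow_natCast]

theorem sgn_even {i : ℤ} (h : Even i) : sgn i = 1 := by simp [sgn, Int.negOnePow_even _ h]

theorem sgn_odd {i : ℤ} (h : Odd i) : sgn i = -1 := by simp [sgn, Int.negOnePow_odd _ h]

theorem sgn_eq_iff {i j : ℤ} : sgn i = sgn j ↔ Even (i - j) := by
  rw [Int.even_sub]
  rcases Int.even_or_odd i with hi | hi <;> rcases Int.even_or_odd j with hj | hj
  · simp [sgn_even hi, sgn_even hj, hi, hj]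
  · simp [sgn_even hi, sgn_odd hj, hi, Int.not_even_iff_odd.mpr hj]
  · simp [sgn_odd hi, sgn_even hj, hj, Int.not_even_iff_odd.mpr hi]
  · simp [sgn_odd hi, sgn_odd hj, Int.not_even_iff_odd.mpr hi, Int.not_even_iff_odd.mpr hj]

theorem sgn_neg (i : ℤ) : sgn (-i) = sgn i := sgn_eq_iff.mpr ⟨-i, by ring⟩

theorem sgn_sub (i j : ℤ) : sgn (i - j) = sgn i * sgn j := by rw [sub_eq_add_neg, sgn_add, sgn_neg]

theorem sgn_two_mul (i : ℤ) : sgn (2 * i) = 1 := sgn_even ⟨i, by ring⟩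

theorem sgn_monDeg {μ : ℕ} (deg : Fin μ → ℤ) (m : Fin μ →₀ ℕ) :
    sgn (monDeg deg m) = (-1) ^ oddPart deg m := by
  rw [← sgn_natCast, sgn_eq_iff, monDeg, oddPart]
  push_cast
  rw [← Finset.sum_sub_distrib]
  refine Finset.even_sum _ fun i _ => ?_
  unfold par
  split_ifs with h
  · obtain ⟨k, hk⟩ := h
    exact ⟨-(m i * k), by rw [hk]; push_cast; ring⟩
  · obtain ⟨k, hk⟩ := Int.not_odd_iff_even.mp h
    exact ⟨m i * (1 - k), by rw [hk]; push_cast; ring⟩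

theorem monDeg_add {μ : ℕ} (deg : Fin μ → ℤ) (a b : Fin μ →₀ ℕ) :
    monDeg deg (a + b) = monDeg deg a + monDeg deg b := by
  simp [monDeg, ← Finset.sum_add_distrib, add_mul]

@[simp] theorem monDeg_zero {μ : ℕ} (deg : Fin μ → ℤ) : monDeg deg 0 = 0 := by simp [monDeg]

@[simp] theorem monDeg_single {μ : ℕ} (deg : Fin μ → ℤ) (i : Fin μ) :
    monDeg deg (Finsupp.single i 1) = 2 - deg i := by
  rw [monDeg, Finset.sum_eq_single i]
  · simp
  · intro k _ hk; simp [hk]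
  · simp

variable {K A : Type*} [Field K] [Ring A] [Algebra K A] (𝒜 : ℤ → Submodule K A) [GradedAlgebra 𝒜]

theorem parity_of_mem {i : ℤ} {a : A} (h : a ∈ 𝒜 i) : parity 𝒜 a = sgn i • a := by
  have := DirectSum.decompose_of_mem 𝒜 h
  change DirectSum.toModule K ℤ A _ (DirectSum.decompose 𝒜 a) = _
  rw [this, ← DirectSum.lof_eq_of K, DirectSum.toModule_lof]
  rfl

/-- The parity operator as a homomorphism of algebras. -/
def parityHom : A →ₐ[K] A := AlgHom.ofLinearMap (parity 𝒜)
  (by simpa using parity_of_mem 𝒜 (SetLike.GradedOne.one_mem (A := 𝒜)))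
  (fun x y => by
    induction x using DirectSum.Decomposition.inductionOn 𝒜 with
    | zero => simp
    | add x x' hx hx' => simp [add_mul, hx, hx']
    | @homogeneous i x =>
      induction y using DirectSum.Decomposition.inductionOn 𝒜 with
      | zero => simp
      | add y y' hy hy' => simp [mul_add, hy, hy']
      | @homogeneous j y =>
        rw [parity_of_mem 𝒜 (SetLike.GradedMul.mul_mem x.2 y.2), parity_of_mem 𝒜 x.2,
          parity_of_mem 𝒜 y.2, sgn_add, smul_mul_smul_comm])

@[simp] theorem parityHom_apply (a : A) : parityHom 𝒜 a = parity 𝒜 a := rfl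

theorem parity_parity (a : A) : parity 𝒜 (parity 𝒜 a) = a := by
  induction a using DirectSum.Decomposition.inductionOn 𝒜 with
  | zero => simp
  | add x y hx hy => simp [hx, hy]
  | @homogeneous i x =>
    rw [parity_of_mem 𝒜 x.2, map_zsmul, parity_of_mem 𝒜 x.2, smul_smul, sgn_mul_self, one_smul]

theorem decompose_zsmul_coe (z : ℤ) (a : A) (i : ℤ) :
    (DirectSum.decompose 𝒜 (z • a) i : A) = z • (DirectSum.decompose 𝒜 a i : A) :=
  map_zsmul (GradedRing.proj 𝒜 i) z a

theorem decompose_parity (a : A) (i : ℤ) :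
    (DirectSum.decompose 𝒜 (parity 𝒜 a) i : A) = sgn i • (DirectSum.decompose 𝒜 a i : A) := by
  induction a using DirectSum.Decomposition.inductionOn 𝒜 with
  | zero => simp
  | add x y hx hy => simp [hx, hy]
  | @homogeneous j x =>
    rw [parity_of_mem 𝒜 x.2, decompose_zsmul_coe]
    by_cases h : j = i
    · subst h; rfl
    · simp [DirectSum.decompose_coe, DirectSum.of_eq_of_ne _ _ _ (Ne.symm h)]

variable {𝒜}

theorem parityHom_pow_of_mem {i : ℤ} {a : A} (h : a ∈ 𝒜 i) (n : ℕ) :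
    (parityHom 𝒜 ^ n) a = sgn (i * n) • a := by
  induction n with
  | zero => simp
  | succ n ih =>
    rw [pow_succ', AlgHom.mul_apply, ih, map_zsmul, parityHom_apply, parity_of_mem 𝒜 h, smul_smul,
      ← sgn_add]
    congr 2; push_cast; ring

/-- The components of an element of definite parity. -/
theorem sgn_eq_of_parity [CharZero K] {s : ℕ} {x : A} (hx : parity 𝒜 x = (-1 : ℤ) ^ s • x) {i : ℤ}
    (hi : (DirectSum.decompose 𝒜 x i : A) ≠ 0) : sgn i = (-1) ^ s := by
  have h := decompose_parity 𝒜 x i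
  rw [hx, decompose_zsmul_coe] at h
  have h : ((-1 : ℤ) ^ s - sgn i) • (DirectSum.decompose 𝒜 x i : A) = 0 := by
    rw [sub_smul, ← h]; simp
  rw [← Int.cast_smul_eq_zsmul K, smul_eq_zero] at h
  rcases h with h | h
  · have : ((-1 : ℤ) ^ s - sgn i) = 0 := by exact_mod_cast h
    omega
  · exact absurd h hi

theorem isSuperComm_parityHom [CharZero K] {Δ : ℕ → A →ₗ[K] A} (hΔ : IsCommBV 𝒜 Δ) :
    SS.IsSuperComm (parityHom 𝒜) := by
  intro s x y hx
  rw [parityHom_apply] at hx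
  classical
  induction y using DirectSum.Decomposition.inductionOn 𝒜 with
  | zero => simp
  | add y y' hy hy' => simp only [mul_add, map_add, add_mul, hy, hy']
  | @homogeneous j y =>
    conv_lhs => rw [← DirectSum.sum_support_decompose 𝒜 x]
    conv_rhs => rw [← DirectSum.sum_support_decompose 𝒜 x]
    rw [Finset.sum_mul, Finset.mul_sum]
    refine Finset.sum_congr rfl fun i hi => ?_
    have hi : (DirectSum.decompose 𝒜 x i : A) ≠ 0 := by simpa using hi
    rw [hΔ.graded_comm i j _ (SetLike.coe_mem _) _ y.2, parityHom_pow_of_mem y.2, smul_mul_assoc]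
    congr 1
    have h := sgn_eq_of_parity hx hi
    rw [← sgn_natCast, sgn_eq_iff] at h
    obtain ⟨k, hk⟩ := h
    rw [sgn_eq_iff]
    exact ⟨k * j, by linear_combination (j : ℤ) * hk⟩

theorem map_parity_of_degree {T : A →ₗ[K] A} {e : ℤ} (h : ∀ i, ∀ a ∈ 𝒜 i, T a ∈ 𝒜 (i + e)) (a : A) :
    parity 𝒜 (T a) = sgn e • T (parity 𝒜 a) := by
  induction a using DirectSum.Decomposition.inductionOn 𝒜 with
  | zero => simp
  | add x y hx hy => simp [hx, hy]
  | @homogeneous i x =>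
    rw [parity_of_mem 𝒜 (h i x x.2), parity_of_mem 𝒜 x.2, map_zsmul, smul_smul, sgn_add, mul_comm]

end Parity

/-! ### Power series and Laurent series in `ħ` -/

section Laurent

variable {K B B' : Type*} [Field K] [Ring B] [Algebra K B] [Ring B'] [Algebra K B']

open Finset.HasAntidiagonal (antidiagonal mem_antidiagonal)

@[simp] theorem coeff_hbar_mul (k n : ℤ) (f : LaurentSeries B) :
    (hbar B k * f).coeff n = f.coeff (n - k) := by
  rw [hbar, HahnSeries.coeff_single_mul, one_mul]

theorem hbar_comm (k : ℤ) (f : LaurentSeries B) : hbar B k * f = f * hbar B k := by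
  ext n
  rw [coeff_hbar_mul, HahnSeries.coeff_mul_single, mul_one]

theorem hbar_mul_hbar (j k : ℤ) : hbar B j * hbar B k = hbar B (j + k) := by
  rw [hbar, HahnSeries.single_mul_single, mul_one]

@[simp] theorem hbar_zero : hbar B 0 = 1 := rfl

theorem hbar_mul_hbar_mul (j k : ℤ) (f : LaurentSeries B) :
    hbar B j * (hbar B k * f) = hbar B (j + k) * f := by
  rw [← mul_assoc, hbar_mul_hbar]

theorem coeff_toLaurent_natCast (f : PowerSeries B) (n : ℕ) :
    (toLaurent f).coeff n = PowerSeries.coeff n f := HahnSeries.ofPowerSeries_apply_coeff f n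

theorem coeff_toLaurent_neg (f : PowerSeries B) {n : ℤ} (h : n < 0) :
    (toLaurent f).coeff n = 0 := by
  have := PowerSeries.coeff_coe f n
  rwa [if_pos h] at this

theorem toLaurent_injective : Function.Injective (toLaurent : PowerSeries B → LaurentSeries B) :=
  HahnSeries.ofPowerSeries_injective

theorem exists_eq_hbar_mul (f : LaurentSeries B) :
    ∃ (k : ℤ) (g : PowerSeries B), f = hbar B k * toLaurent g :=
  ⟨_, _, (LaurentSeries.single_order_mul_powerSeriesPart f).symm⟩

theorem eq_toLaurent {f : LaurentSeries B} (h : ∀ n < 0, f.coeff n = 0) :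
    f = toLaurent (PowerSeries.mk fun n => f.coeff n) := by
  ext n
  rcases lt_or_ge n 0 with hn | hn
  · rw [h n hn, coeff_toLaurent_neg _ hn]
  · obtain ⟨n, rfl⟩ := Int.eq_ofNat_of_zero_le hn
    rw [coeff_toLaurent_natCast, PowerSeries.coeff_mk]

theorem exists_shift (f : LaurentSeries B) :
    ∃ (N : ℕ) (g : PowerSeries B), f = hbar B (-N) * toLaurent g := by
  obtain ⟨k, g, rfl⟩ := exists_eq_hbar_mul f
  refine ⟨k.natAbs, PowerSeries.mk fun n => (hbar B (k + k.natAbs) * toLaurent g).coeff n, ?_⟩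
  rw [← eq_toLaurent, hbar_mul_hbar_mul]
  · congr 2; ring
  · intro n hn
    rw [coeff_hbar_mul, coeff_toLaurent_neg]
    omega

/-- The action of a homomorphism of rings on the coefficients of Laurent series. -/
def mapR (φ : B →+* B') : LaurentSeries B →+* LaurentSeries B' where
  toFun f := f.map φ
  map_one' := by
    ext n
    simp only [HahnSeries.map_coeff, HahnSeries.coeff_one]
    split_ifs <;> simp
  map_mul' f g := HahnSeries.map_mul (φ : B →ₙ+* B')
  map_zero' := by ext; simp
  map_add' f g := by ext; simp

@[simp] theorem coeff_mapR (φ : B →+* B') (f : LaurentSeries B) (n : ℤ) :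
    (mapR φ f).coeff n = φ (f.coeff n) := rfl

theorem mapR_toLaurent (φ : B →+* B') (f : PowerSeries B) :
    mapR φ (toLaurent f) = toLaurent (PowerSeries.map φ f) := by
  ext n
  rcases lt_or_ge n 0 with hn | hn
  · rw [coeff_mapR, coeff_toLaurent_neg _ hn, coeff_toLaurent_neg _ hn, map_zero]
  · obtain ⟨n, rfl⟩ := Int.eq_ofNat_of_zero_le hn
    rw [coeff_mapR, coeff_toLaurent_natCast, coeff_toLaurent_natCast]; simp

@[simp] theorem mapR_hbar (φ : B →+* B') (k : ℤ) : mapR φ (hbar B k) = hbar B' k := by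
  ext n
  simp only [coeff_mapR, HahnSeries.coeff_single]
  split_ifs <;> simp

/-- The action of a homomorphism of algebras on the coefficients of Laurent series. -/
def mapL (φ : B →ₐ[K] B') : LaurentSeries B →ₐ[K] LaurentSeries B' where
  __ := mapR (φ : B →+* B')
  commutes' c := by
    ext n
    simp only [HahnSeries.algebraMap_apply, HahnSeries.C_apply]
    change φ (HahnSeries.coeff _ _) = _
    simp only [HahnSeries.coeff_single]
    split_ifs <;> simp

@[simp] theorem coeff_mapL (φ : B →ₐ[K] B') (f : LaurentSeries B) (n : ℤ) :
    (mapL φ f).coeff n = φ (f.coeff n) := rfl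

theorem mapL_toLaurent (φ : B →ₐ[K] B') (f : PowerSeries B) :
    mapL φ (toLaurent f) = toLaurent (PowerSeries.map (φ : B →+* B') f) :=
  mapR_toLaurent (φ : B →+* B') f

@[simp] theorem mapL_hbar (φ : B →ₐ[K] B') (k : ℤ) : mapL φ (hbar B k) = hbar B' k :=
  mapR_hbar (φ : B →+* B') k

theorem mapL_pow (φ : B →ₐ[K] B) (n : ℕ) : mapL φ ^ n = mapL (φ ^ n) := by
  induction n with
  | zero => ext; rfl
  | succ n ih => rw [pow_succ, ih, pow_succ]; rfl

/-- Scalar power series are central. -/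
theorem map_algebraMap_comm (c : PowerSeries K) (x : PowerSeries B) :
    PowerSeries.map (algebraMap K B) c * x = x * PowerSeries.map (algebraMap K B) c := by
  ext n
  rw [PowerSeries.coeff_mul, PowerSeries.coeff_mul, ← Finset.Nat.sum_antidiagonal_swap]
  refine Finset.sum_congr rfl fun q _ => ?_
  simp [Algebra.commutes]

/-- Scalar Laurent series inside those with coefficients in an algebra. -/
def scal (B : Type*) [Ring B] [Algebra K B] : LaurentSeries K →+* LaurentSeries B :=
  mapR (algebraMap K B)

@[simp] theorem coeff_scal (c : LaurentSeries K) (n : ℤ) :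
    (scal B c).coeff n = algebraMap K B (c.coeff n) := rfl

@[simp] theorem scal_hbar (k : ℤ) : scal B (hbar K k) = hbar B k :=
  mapR_hbar _ k

theorem scal_toLaurent (c : PowerSeries K) :
    scal B (toLaurent c) = toLaurent (PowerSeries.map (algebraMap K B) c) :=
  mapR_toLaurent _ c

theorem toLaurent_mul (f g : PowerSeries B) : toLaurent (f * g) = toLaurent f * toLaurent g :=
  map_mul _ _ _

theorem toLaurent_add (f g : PowerSeries B) : toLaurent (f + g) = toLaurent f + toLaurent g :=
  map_add _ _ _

theorem toLaurent_sub (f g : PowerSeries B) : toLaurent (f - g) = toLaurent f - toLaurent g :=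
  map_sub _ _ _

theorem toLaurent_neg (f : PowerSeries B) : toLaurent (-f) = -toLaurent f := map_neg _ _

@[simp] theorem toLaurent_zero : toLaurent (0 : PowerSeries B) = 0 := map_zero _

@[simp] theorem toLaurent_one : toLaurent (1 : PowerSeries B) = 1 := map_one _

theorem toLaurent_sum {ι : Type*} (s : Finset ι) (f : ι → PowerSeries B) :
    toLaurent (∑ i ∈ s, f i) = ∑ i ∈ s, toLaurent (f i) := map_sum _ _ _

/-- Powers of `ħ` are central. -/
theorem hbar_mul_mul_hbar_mul (a b : ℤ) (u v : LaurentSeries B) :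
    hbar B a * u * (hbar B b * v) = hbar B (a + b) * (u * v) := by
  rw [mul_assoc, ← mul_assoc u, ← hbar_comm, mul_assoc, ← mul_assoc, hbar_mul_hbar]

theorem scal_comm (c : LaurentSeries K) (x : LaurentSeries B) : scal B c * x = x * scal B c := by
  obtain ⟨k, c, rfl⟩ := exists_eq_hbar_mul c
  obtain ⟨l, x, rfl⟩ := exists_eq_hbar_mul x
  rw [map_mul, scal_hbar, scal_toLaurent, hbar_mul_mul_hbar_mul, hbar_mul_mul_hbar_mul,
    ← toLaurent_mul, map_algebraMap_comm, toLaurent_mul, add_comm]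

/-! #### The substitution `ħ ↦ -ħ` -/

theorem coeff_bar (f : LaurentSeries B) (n : ℤ) : (bar f).coeff n = sgn n • f.coeff n := rfl

/-- The substitution `ħ ↦ -ħ` on power series. -/
def barP (f : PowerSeries B) : PowerSeries B :=
  PowerSeries.mk fun n => (-1 : ℤ) ^ n • PowerSeries.coeff n f

theorem bar_toLaurent (f : PowerSeries B) : bar (toLaurent f) = toLaurent (barP f) := by
  ext n
  rw [coeff_bar]
  rcases lt_or_ge n 0 with hn | hn
  · rw [coeff_toLaurent_neg _ hn, coeff_toLaurent_neg _ hn, smul_zero]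
  · obtain ⟨n, rfl⟩ := Int.eq_ofNat_of_zero_le hn
    rw [coeff_toLaurent_natCast, coeff_toLaurent_natCast, barP, PowerSeries.coeff_mk, sgn_natCast]

theorem bar_hbar_mul (k : ℤ) (f : LaurentSeries B) :
    bar (hbar B k * f) = sgn k • (hbar B k * bar f) := by
  ext n
  rw [HahnSeries.coeff_smul]
  simp only [coeff_bar, coeff_hbar_mul]
  rw [smul_smul, ← sgn_add]
  congr 2; ring

theorem barP_mul (f g : PowerSeries B) : barP (f * g) = barP f * barP g := by
  ext n
  rw [barP, PowerSeries.coeff_mk, PowerSeries.coeff_mul, PowerSeries.coeff_mul, Finset.smul_sum]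
  refine Finset.sum_congr rfl fun q hq => ?_
  rw [barP, barP, PowerSeries.coeff_mk, PowerSeries.coeff_mk, ← mem_antidiagonal.mp hq, pow_add,
    smul_mul_smul_comm]

theorem bar_add (f g : LaurentSeries B) : bar (f + g) = bar f + bar g := by
  ext n; simp [coeff_bar]

theorem bar_mul (f g : LaurentSeries B) : bar (f * g) = bar f * bar g := by
  obtain ⟨k, f, rfl⟩ := exists_eq_hbar_mul f
  obtain ⟨l, g, rfl⟩ := exists_eq_hbar_mul g
  rw [hbar_mul_mul_hbar_mul, ← toLaurent_mul, bar_hbar_mul, bar_hbar_mul, bar_hbar_mul,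
    bar_toLaurent, bar_toLaurent, bar_toLaurent, barP_mul, toLaurent_mul, smul_mul_smul_comm,
    sgn_add, hbar_mul_mul_hbar_mul]

/-- The substitution `ħ ↦ -ħ` as a homomorphism. -/
def barHom (B : Type*) [Ring B] : LaurentSeries B →+* LaurentSeries B where
  toFun := bar
  map_one' := by
    ext n
    simp only [coeff_bar, HahnSeries.coeff_one]
    split_ifs with h <;> simp [h]
  map_mul' := bar_mul
  map_zero' := by ext; simp [coeff_bar]
  map_add' := bar_add

@[simp] theorem barHom_apply (f : LaurentSeries B) : barHom B f = bar f := rfl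

theorem bar_bar (f : LaurentSeries B) : bar (bar f) = f := by
  ext n; rw [coeff_bar, coeff_bar, smul_smul, sgn_mul_self, one_smul]

theorem bar_scal (c : LaurentSeries K) : bar (scal B c) = scal B (bar c) := by
  ext n; rw [coeff_bar, coeff_scal, coeff_scal, coeff_bar, map_zsmul]

theorem bar_smul (c : K) (f : LaurentSeries B) : bar (c • f) = c • bar f := by
  ext n; simp only [coeff_bar, HahnSeries.coeff_smul, smul_comm c]

theorem isSuperComm_mapL {σ : B →ₐ[K] B} (h : SS.IsSuperComm σ) : SS.IsSuperComm (mapL σ) := by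
  intro s x y hx
  obtain ⟨k, x, rfl⟩ := exists_eq_hbar_mul x
  obtain ⟨l, y, rfl⟩ := exists_eq_hbar_mul y
  have hc : ∀ n, σ (PowerSeries.coeff n x) = (-1 : ℤ) ^ s • PowerSeries.coeff n x := by
    intro n
    have := congrArg (fun f => f.coeff (n + k)) hx
    simpa only [coeff_mapL, HahnSeries.coeff_smul, coeff_hbar_mul, add_sub_cancel_right,
      coeff_toLaurent_natCast] using this
  have hxy : x * y = PowerSeries.map ((σ ^ s : B →ₐ[K] B) : B →+* B) y * x := by
    ext n
    rw [PowerSeries.coeff_mul, PowerSeries.coeff_mul, ← Finset.Nat.sum_antidiagonal_swap]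
    refine Finset.sum_congr rfl fun q _ => ?_
    simp only [Prod.fst_swap, Prod.snd_swap, PowerSeries.coeff_map]
    exact h s _ _ (hc _)
  rw [mapL_pow, map_mul, mapL_hbar, mapL_toLaurent, hbar_mul_mul_hbar_mul,
    hbar_mul_mul_hbar_mul, ← toLaurent_mul, ← toLaurent_mul, hxy, add_comm]

end Laurent

/-! ### Homological perturbation -/

section Operators

variable {K A : Type*} [Field K] [Ring A] [Algebra K A]

open Finset.HasAntidiagonal (antidiagonal mem_antidiagonal)

/-- Multiplication operators, with coefficients depending on `ħ`. -/
def lm (K : Type*) {A : Type*} [Field K] [Ring A] [Algebra K A] :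
    PowerSeries A →+* PowerSeries (Module.End K A) :=
  PowerSeries.map (Algebra.lmul K A : A →+* Module.End K A)

@[simp] theorem coeff_lm (f : PowerSeries A) (n : ℕ) (x : A) :
    PowerSeries.coeff n (lm K f) x = PowerSeries.coeff n f * x := by simp [lm]

/-- The value at `1` of an operator depending on `ħ`. -/
def ev : PowerSeries (Module.End K A) →+ PowerSeries A where
  toFun U := PowerSeries.mk fun n => PowerSeries.coeff n U 1
  map_zero' := by ext; simp
  map_add' _ _ := by ext; simp

@[simp] theorem coeff_ev (U : PowerSeries (Module.End K A)) (n : ℕ) :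
    PowerSeries.coeff n (ev U) = PowerSeries.coeff n U 1 := by simp [ev]

theorem ev_lm (f : PowerSeries A) : ev (lm K f) = f := by ext n; simp

theorem ev_mul_lm_ev (U W : PowerSeries (Module.End K A)) : ev (U * lm K (ev W)) = ev (U * W) := by
  ext n
  simp [PowerSeries.coeff_mul, LinearMap.sum_apply]

theorem ev_lm_mul (f : PowerSeries A) (U : PowerSeries (Module.End K A)) :
    ev (lm K f * U) = f * ev U := by
  ext n
  simp [PowerSeries.coeff_mul, LinearMap.sum_apply]

/-- The action of `End(A)[[ħ]]` on `A[[ħ]]`. -/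
def act (U : PowerSeries (Module.End K A)) : PowerSeries A →+ PowerSeries A :=
  ev.comp ((AddMonoidHom.mulLeft U).comp (lm K).toAddMonoidHom)

theorem act_apply (U : PowerSeries (Module.End K A)) (f : PowerSeries A) :
    act U f = ev (U * lm K f) := rfl

theorem coeff_act (U : PowerSeries (Module.End K A)) (f : PowerSeries A) (n : ℕ) :
    PowerSeries.coeff n (act U f) =
      ∑ q ∈ antidiagonal n, PowerSeries.coeff q.1 U (PowerSeries.coeff q.2 f) := by
  simp [act_apply, PowerSeries.coeff_mul, LinearMap.sum_apply]

theorem act_mul (U V : PowerSeries (Module.End K A)) (f : PowerSeries A) :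
    act (U * V) f = act U (act V f) := by
  rw [act_apply, act_apply, act_apply, ev_mul_lm_ev, mul_assoc]

theorem act_one (f : PowerSeries A) : act (1 : PowerSeries (Module.End K A)) f = f := by
  rw [act_apply, one_mul, ev_lm]

theorem act_add_left (U V : PowerSeries (Module.End K A)) (f : PowerSeries A) :
    act (U + V) f = act U f + act V f := by
  rw [act_apply, add_mul, map_add]; rfl

theorem act_sub_left (U V : PowerSeries (Module.End K A)) (f : PowerSeries A) :
    act (U - V) f = act U f - act V f := by
  rw [act_apply, sub_mul, map_sub]; rfl

theorem act_scalar_mul (U : PowerSeries (Module.End K A)) (c : PowerSeries K) (f : PowerSeries A) :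
    act U (PowerSeries.map (algebraMap K A) c * f) =
      PowerSeries.map (algebraMap K A) c * act U f := by
  have h : lm K (PowerSeries.map (algebraMap K A) c) =
      PowerSeries.map (algebraMap K (Module.End K A)) c := by
    ext n x; simp [Algebra.smul_def]
  rw [act_apply, (lm K).map_mul, h, ← mul_assoc, ← map_algebraMap_comm, ← h, mul_assoc, ev_lm_mul]
  rfl

/-- The operator `Δ = ∑ ħ^k Δ_k`. -/
def deltaOp (Δ : ℕ → A →ₗ[K] A) : PowerSeries (Module.End K A) := PowerSeries.mk Δ

theorem deltaPS_eq (Δ : ℕ → A →ₗ[K] A) (f : PowerSeries A) : deltaPS Δ f = act (deltaOp Δ) f := by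
  ext n
  rw [coeff_act]
  simp [deltaPS, deltaOp]

theorem coeff_deltaPS (Δ : ℕ → A →ₗ[K] A) (f : PowerSeries A) (n : ℕ) :
    PowerSeries.coeff n (deltaPS Δ f) =
      ∑ q ∈ antidiagonal n, Δ q.1 (PowerSeries.coeff q.2 f) := by simp [deltaPS]

theorem deltaPS_add (Δ : ℕ → A →ₗ[K] A) (f g : PowerSeries A) :
    deltaPS Δ (f + g) = deltaPS Δ f + deltaPS Δ g := by simp [deltaPS_eq]

theorem deltaPS_sub (Δ : ℕ → A →ₗ[K] A) (f g : PowerSeries A) :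
    deltaPS Δ (f - g) = deltaPS Δ f - deltaPS Δ g := by simp [deltaPS_eq]

theorem deltaPS_neg (Δ : ℕ → A →ₗ[K] A) (f : PowerSeries A) :
    deltaPS Δ (-f) = -deltaPS Δ f := by simp [deltaPS_eq]

@[simp] theorem deltaPS_zero (Δ : ℕ → A →ₗ[K] A) : deltaPS Δ 0 = 0 := by simp [deltaPS_eq]

theorem deltaPS_sum (Δ : ℕ → A →ₗ[K] A) {ι : Type*} (s : Finset ι) (f : ι → PowerSeries A) :
    deltaPS Δ (∑ i ∈ s, f i) = ∑ i ∈ s, deltaPS Δ (f i) := by simp [deltaPS_eq]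

theorem deltaPS_scalar_mul (Δ : ℕ → A →ₗ[K] A) (c : PowerSeries K) (f : PowerSeries A) :
    deltaPS Δ (PowerSeries.map (algebraMap K A) c * f) =
      PowerSeries.map (algebraMap K A) c * deltaPS Δ f := by
  simp [deltaPS_eq, act_scalar_mul]

variable {𝒜 : ℤ → Submodule K A} {Δ : ℕ → A →ₗ[K] A}

theorem deltaOp_mul_self [GradedAlgebra 𝒜] (hΔ : IsCommBV 𝒜 Δ) : deltaOp Δ * deltaOp Δ = 0 := by
  ext1 n
  rw [PowerSeries.coeff_mul, map_zero, ← hΔ.square_zero n]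
  simp [deltaOp, Module.End.mul_eq_comp]

theorem deltaPS_deltaPS [GradedAlgebra 𝒜] (hΔ : IsCommBV 𝒜 Δ) (f : PowerSeries A) : deltaPS Δ (deltaPS Δ f) = 0 := by
  rw [deltaPS_eq, deltaPS_eq, ← act_mul, deltaOp_mul_self hΔ, act_apply]; simp

theorem deltaPS_one [GradedAlgebra 𝒜] (hΔ : IsCommBV 𝒜 Δ) : deltaPS Δ 1 = 0 := by
  ext n
  rw [coeff_deltaPS, map_zero]
  refine Finset.sum_eq_zero fun q _ => ?_
  rw [PowerSeries.coeff_one]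
  split_ifs <;> simp [hΔ.map_one]

/-! #### Sums over compositions -/

/-- The block lists of the compositions of `k`. -/
def blockLists (k : ℕ) : Finset (List ℕ) :=
  Finset.univ.image (Composition.blocks : Composition k → List ℕ)

theorem mem_blockLists {k : ℕ} {l : List ℕ} :
    l ∈ blockLists k ↔ (∀ i ∈ l, 0 < i) ∧ l.sum = k := by
  simp only [blockLists, Finset.mem_image, Finset.mem_univ, true_and]
  constructor
  · rintro ⟨c, rfl⟩
    exact ⟨fun i hi => c.blocks_pos hi, c.blocks_sum⟩
  · rintro ⟨h1, h2⟩
    exact ⟨⟨l, fun hi => h1 _ hi, h2⟩, rfl⟩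

theorem wordSum_eq (h : A →ₗ[K] A) (k : ℕ) :
    wordSum Δ h k = ∑ l ∈ blockLists k, word Δ h l := by
  rw [wordSum, blockLists, Finset.sum_image]
  intro c _ c' _ hc
  exact Composition.ext hc

theorem word_cons (h : A →ₗ[K] A) (j : ℕ) {l : List ℕ} (hl : l ≠ []) :
    word Δ h (j :: l) = Δ j ∘ₗ h ∘ₗ word Δ h l := by
  cases l with
  | nil => exact absurd rfl hl
  | cons => rfl

/-- The operator `∑ ħ^k Δ_{j₁} h ⋯ h Δ_{j_l}`, over all `j₁ + ⋯ + j_l = k ≥ 1`. -/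
def wordOp (Δ : ℕ → A →ₗ[K] A) (h : A →ₗ[K] A) : PowerSeries (Module.End K A) :=
  PowerSeries.mk fun k => if k = 0 then 0 else wordSum Δ h k

/-- The operator `∑_{k ≥ 1} ħ^k Δ_k`. -/
def deltaPos (Δ : ℕ → A →ₗ[K] A) : PowerSeries (Module.End K A) :=
  PowerSeries.mk fun k => if k = 0 then 0 else Δ k

theorem deltaOp_eq : deltaOp Δ = PowerSeries.C (Δ 0 : Module.End K A) + deltaPos Δ := by
  ext1 n
  rw [map_add, deltaOp, deltaPos, PowerSeries.coeff_mk, PowerSeries.coeff_mk, PowerSeries.coeff_C]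
  split_ifs with h
  · simp [h]
  · simp

/-- Splitting off the first block of a composition. -/
theorem wordOp_eq (h : Module.End K A) :
    wordOp Δ h = deltaPos Δ + deltaPos Δ * PowerSeries.C h * wordOp Δ h := by
  have key : wordOp Δ h = deltaPos Δ * (1 + PowerSeries.C h * wordOp Δ h) := by
    ext1 k
    rw [PowerSeries.coeff_mul]
    by_cases hk : k = 0
    · subst hk; simp [wordOp, deltaPos]
    rw [wordOp, PowerSeries.coeff_mk, if_neg hk, wordSum_eq]
    have h1 : ∀ q ∈ antidiagonal k, PowerSeries.coeff q.1 (deltaPos Δ) *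
        PowerSeries.coeff q.2 (1 + PowerSeries.C h * wordOp Δ h) =
          ∑ l ∈ blockLists q.2, if q.1 = 0 then 0 else word Δ h (q.1 :: l) := by
      rintro ⟨i, j⟩ _
      simp only [deltaPos, PowerSeries.coeff_mk]
      by_cases hi : i = 0
      · simp [hi]
      simp only [if_neg hi]
      by_cases hj : j = 0
      · subst hj
        have : blockLists 0 = {[]} := by
          ext l
          simp only [mem_blockLists, Finset.mem_singleton]
          constructor
          · rintro ⟨h1, h2⟩
            cases l with
            | nil => rfl
            | cons a l =>
              have := h1 a (by simp)
              simp only [List.sum_cons] at h2; omega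
          · rintro rfl; simp
        rw [this, Finset.sum_singleton]
        simp [wordOp, word]
      · have : ∀ l ∈ blockLists j, word Δ h (i :: l) = (Δ i * h : Module.End K A) * word Δ h l := by
          intro l hl
          rw [word_cons, mul_assoc]; rfl
          rintro rfl
          exact hj (by simpa using (mem_blockLists.mp hl).2.symm)
        rw [Finset.sum_congr rfl this, ← Finset.mul_sum, ← wordSum_eq, map_add,
          PowerSeries.coeff_C_mul, PowerSeries.coeff_one, if_neg hj, zero_add, wordOp,
          PowerSeries.coeff_mk, if_neg hj, mul_assoc]
    rw [eq_comm]
    refine (Finset.sum_congr rfl h1).trans ?_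
    rw [Finset.sum_sigma']
    refine Finset.sum_bij_ne_zero (fun x _ _ => x.1.1 :: x.2) ?_ ?_ ?_ ?_
    · rintro ⟨⟨i, j⟩, l⟩ hx hne
      simp only [Finset.mem_sigma, mem_antidiagonal, mem_blockLists] at hx ⊢
      have hi : i ≠ 0 := fun hi => hne (by simp [hi])
      refine ⟨?_, by simp [hx.2.2, hx.1]⟩
      intro a ha
      rcases List.mem_cons.mp ha with rfl | ha
      · omega
      · exact hx.2.1 a ha
    · rintro ⟨⟨i, j⟩, l⟩ hx _ ⟨⟨i', j'⟩, l'⟩ hx' _ he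
      simp only [Finset.mem_sigma, mem_antidiagonal, mem_blockLists, List.cons.injEq] at hx hx' he
      obtain ⟨rfl, rfl⟩ := he
      obtain rfl : j = j' := by rw [← hx.2.2, ← hx'.2.2]
      rfl
    · intro l hl hne
      rw [mem_blockLists] at hl
      cases l with
      | nil => exact absurd hl.2.symm (by simpa using hk)
      | cons a l =>
        have ha : a ≠ 0 := (hl.1 a (by simp)).ne'
        refine ⟨⟨(a, l.sum), l⟩, ?_, ?_, rfl⟩
        · simp only [Finset.mem_sigma, mem_antidiagonal, mem_blockLists]
          exact ⟨by simpa using hl.2, fun i hi => hl.1 i (by simp [hi]), trivial⟩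
        · simpa [ha] using hne
    · rintro ⟨⟨i, j⟩, l⟩ hx hne
      have hi : i ≠ 0 := fun hi => hne (by simp [hi])
      simp [hi]
  conv_lhs => rw [key]
  rw [mul_add, mul_one, mul_assoc]

theorem perturbation_aux {E : Type*} [Ring E] (D c W : E) :
    (D + D * c * W) - D - (D + D * c * W) * c * D = D * c * (W - D - W * c * D) := by
  noncomm_ring

/-- The algebraic identity behind the perturbation lemma. Here `W` is the sum
`D + D h D + D h D h D + ⋯`, and `π` stands for `ι p`. -/
theorem perturbation_identity {E : Type*} [Ring E] {d D h π W : E} (hW : W = D + D * h * W)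
    (hW' : W = D + W * h * D) (hsq : (d + D) * (d + D) = 0) (hd : d * d = 0)
    (hhom : h * d + d * h = π - 1) (hpp : π * π = π) :
    (d + D) * (h + h * W * h) + (h + h * W * h) * (d + D) =
      (π + h * W * π) * (π + π * W * h) - 1 := by
  rw [← sub_eq_zero]
  set X := (d + D) * (h + h * W * h) + (h + h * W * h) * (d + D) -
    ((π + h * W * π) * (π + π * W * h) - 1) with hX
  have a1 : (1 + h * W) * (1 - h * D) = 1 := by
    calc _ = 1 + h * (W - (D + W * h * D)) := by noncomm_ring
      _ = 1 := by rw [← hW']; simp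
  have a2 : (1 - D * h) * (1 + W * h) = 1 := by
    calc _ = 1 + (W - (D + D * h * W)) * h := by noncomm_ring
      _ = 1 := by rw [← hW]; simp
  have b1 : (1 - h * D) * (h + h * W * h) = h := by
    calc _ = h + h * (W - (D + D * h * W)) * h := by noncomm_ring
      _ = h := by rw [← hW]; simp
  have b2 : (h + h * W * h) * (1 - D * h) = h := by
    calc _ = h + h * (W - (D + W * h * D)) * h := by noncomm_ring
      _ = h := by rw [← hW']; simp
  have b3 : (1 - h * D) * (π + h * W * π) = π := by
    calc _ = π + h * (W - (D + D * h * W)) * π := by noncomm_ring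
      _ = π := by rw [← hW]; simp
  have b4 : (π + π * W * h) * (1 - D * h) = π := by
    calc _ = π + π * (W - (D + W * h * D)) * h := by noncomm_ring
      _ = π := by rw [← hW']; simp
  -- multiplication by the invertible elements `1 - h D` and `1 - D h` removes all occurrences of `W`
  have key : (1 - h * D) * X * (1 - D * h) = 0 := by
    calc (1 - h * D) * X * (1 - D * h) =
        (1 - h * D) * (d + D) * ((h + h * W * h) * (1 - D * h)) +
        ((1 - h * D) * (h + h * W * h)) * (d + D) * (1 - D * h) -
        ((1 - h * D) * (π + h * W * π)) * ((π + π * W * h) * (1 - D * h)) +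
        (1 - h * D) * (1 - D * h) := by rw [hX]; noncomm_ring
      _ = (h * d + d * h - (π - 1)) - h * ((d + D) * (d + D) - d * d) * h + (π - π * π) := by
        rw [b1, b2, b3, b4]; noncomm_ring
      _ = 0 := by rw [hhom, hsq, hd, hpp]; simp
  calc X = ((1 + h * W) * (1 - h * D)) * X * ((1 - D * h) * (1 + W * h)) := by
        rw [a1, a2]; simp
    _ = (1 + h * W) * ((1 - h * D) * X * (1 - D * h)) * (1 + W * h) := by noncomm_ring
    _ = 0 := by rw [key]; simp

/-- The perturbed differential `P Δ S` on the cohomology is `p W ι`, so it vanishes if `p W ι`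
does. -/
theorem perturbation_vanishing {E : Type*} [Ring E] {d D h π W : E}
    (hW' : W = D + W * h * D) (hhom : h * d + d * h = π - 1) (h1 : h * h = 0) (h3 : π * h = 0)
    (h5 : d * π = 0) (h6 : π * d = 0) (h7 : π * W * π = 0) :
    (π + π * W * h) * (d + D) * (π + h * W * π) = 0 := by
  calc (π + π * W * h) * (d + D) * (π + h * W * π)
      = (π * d) * (π + h * W * π) + π * (D + W * h * D) * (π + h * W * π) +
        π * W * h * (d * π) + π * W * (h * d + d * h) * h * W * π - π * W * d * (h * h) * W * π := by
        noncomm_ring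
    _ = π * W * π + π * W * h * W * π - π * W * h * W * π + π * W * (π * h) * W * π := by
        rw [h6, ← hW', h5, hhom, h1]; noncomm_ring
    _ = 0 := by rw [h7, h3]; simp

/-- Multiplication by a series without constant term is contracting, so its only fixed point is
`0`. -/
theorem eq_zero_of_eq_mul {R : Type*} [Ring R] {U X : PowerSeries R}
    (hU : PowerSeries.coeff 0 U = 0) (h : X = U * X) : X = 0 := by
  ext n
  rw [map_zero]
  induction n using Nat.strong_induction_on with
  | _ n ih =>
    rw [h, PowerSeries.coeff_mul]
    refine Finset.sum_eq_zero fun q hq => ?_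
    have hq := mem_antidiagonal.mp hq
    by_cases h0 : q.1 = 0
    · rw [h0, hU, zero_mul]
    · rw [ih q.2 (by omega), mul_zero]

/-- Splitting off the last block of a composition. -/
theorem wordOp_eq' (h : Module.End K A) :
    wordOp Δ h = deltaPos Δ + wordOp Δ h * PowerSeries.C h * deltaPos Δ := by
  have hW := wordOp_eq (Δ := Δ) h
  set W := wordOp Δ h
  set D := deltaPos Δ
  set c := PowerSeries.C h
  have : W - D - W * c * D = 0 := by
    refine eq_zero_of_eq_mul (U := D * c) (by simp [D, c, deltaPos, PowerSeries.coeff_mul]) ?_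
    calc W - D - W * c * D = (D + D * c * W) - D - (D + D * c * W) * c * D := by rw [← hW]
      _ = _ := perturbation_aux D c W
  rw [sub_sub, sub_eq_zero] at this
  exact this

/-- The degree of the operators `Δ_{j₁} h ⋯ h Δ_{j_l}`. -/
theorem coeff_wordOp_mem [GradedAlgebra 𝒜] (hΔ : IsCommBV 𝒜 Δ) {h : Module.End K A}
    (hh : ∀ i, ∀ a ∈ 𝒜 i, h a ∈ 𝒜 (i - 1)) (k : ℕ) :
    ∀ i, ∀ a ∈ 𝒜 i, PowerSeries.coeff k (wordOp Δ h) a ∈ 𝒜 (i + 1 - 2 * k) := by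
  have hD : ∀ k : ℕ, ∀ i, ∀ a ∈ 𝒜 i, PowerSeries.coeff k (deltaPos Δ) a ∈ 𝒜 (i + 1 - 2 * k) := by
    intro k i a ha
    rw [deltaPos, PowerSeries.coeff_mk]
    split_ifs
    · simp
    · exact hΔ.degree k i a ha
  induction k using Nat.strong_induction_on with
  | _ k ih =>
    intro i a ha
    rw [wordOp_eq, map_add, mul_assoc, PowerSeries.coeff_mul, LinearMap.add_apply,
      LinearMap.sum_apply]
    refine Submodule.add_mem _ (hD k i a ha) (Submodule.sum_mem _ fun q hq => ?_)
    have hq := mem_antidiagonal.mp hq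
    rw [PowerSeries.coeff_C_mul]
    by_cases h0 : q.1 = 0
    · simp [h0, deltaPos]
    · have := hD q.1 _ _ (hh _ _ (ih q.2 (by omega) i a ha))
      rw [Module.End.mul_apply, Module.End.mul_apply]
      convert this using 2
      rw [← hq]; push_cast; ring

/-! #### The perturbed retract -/

variable (R : HomotopyRetract 𝒜 (Δ 0))

/-- The projection `ι p`. -/
def projOp : PowerSeries (Module.End K A) := PowerSeries.C (R.ι ∘ₗ R.p : Module.End K A)

/-- The homotopy `h`, as an operator on `A[[ħ]]`. -/
def homOp : PowerSeries (Module.End K A) := PowerSeries.C (R.h : Module.End K A)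

/-- The perturbed inclusion (precomposed with `p`). -/
def inclOp : PowerSeries (Module.End K A) := projOp R + homOp R * wordOp Δ R.h * projOp R

/-- The perturbed projection (followed by `ι`). -/
def prOp : PowerSeries (Module.End K A) := projOp R + projOp R * wordOp Δ R.h * homOp R

/-- The perturbed homotopy. -/
def pertHomOp : PowerSeries (Module.End K A) := homOp R + homOp R * wordOp Δ R.h * homOp R

theorem homOp_mul_homOp : homOp R * homOp R = 0 := by
  rw [homOp, ← map_mul, Module.End.mul_eq_comp, R.h_h, map_zero]

theorem homOp_mul_projOp : homOp R * projOp R = 0 := by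
  rw [homOp, projOp, ← map_mul, Module.End.mul_eq_comp, ← LinearMap.comp_assoc, R.h_ι,
    LinearMap.zero_comp, map_zero]

theorem projOp_mul_homOp : projOp R * homOp R = 0 := by
  rw [homOp, projOp, ← map_mul, Module.End.mul_eq_comp, LinearMap.comp_assoc, R.p_h,
    LinearMap.comp_zero, map_zero]

theorem projOp_mul_projOp : projOp R * projOp R = projOp R := by
  rw [projOp, ← map_mul, Module.End.mul_eq_comp, LinearMap.comp_assoc,
    ← LinearMap.comp_assoc R.p, R.p_ι, LinearMap.id_comp]

theorem d_mul_projOp : PowerSeries.C (Δ 0 : Module.End K A) * projOp R = 0 := by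
  rw [projOp, ← map_mul, Module.End.mul_eq_comp, ← LinearMap.comp_assoc, R.d_ι,
    LinearMap.zero_comp, map_zero]

theorem projOp_mul_d : projOp R * PowerSeries.C (Δ 0 : Module.End K A) = 0 := by
  rw [projOp, ← map_mul, Module.End.mul_eq_comp, LinearMap.comp_assoc, R.p_d,
    LinearMap.comp_zero, map_zero]

theorem homOp_homotopy : homOp R * PowerSeries.C (Δ 0 : Module.End K A) +
    PowerSeries.C (Δ 0 : Module.End K A) * homOp R = projOp R - 1 := by
  rw [homOp, projOp, ← map_mul, ← map_mul, ← map_add, Module.End.mul_eq_comp,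
    Module.End.mul_eq_comp, R.homotopy, map_sub]
  rfl

/-- The perturbation lemma: `Δ H + H Δ = S P - 1`. -/
theorem perturbed_homotopy [GradedAlgebra 𝒜] (hΔ : IsCommBV 𝒜 Δ) :
    deltaOp Δ * pertHomOp R + pertHomOp R * deltaOp Δ = inclOp R * prOp R - 1 := by
  have hW := wordOp_eq (Δ := Δ) R.h
  have hW' := wordOp_eq' (Δ := Δ) R.h
  have hsq := deltaOp_mul_self hΔ
  have hd : PowerSeries.C (Δ 0 : Module.End K A) * PowerSeries.C (Δ 0 : Module.End K A) = 0 := by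
    rw [← map_mul]
    have := hΔ.square_zero 0
    rw [Finset.Nat.antidiagonal_zero, Finset.sum_singleton] at this
    rw [Module.End.mul_eq_comp, this, map_zero]
  have hhom := homOp_homotopy R
  have hpp := projOp_mul_projOp R
  rw [deltaOp_eq] at hsq ⊢
  unfold inclOp prOp pertHomOp
  change wordOp Δ R.h = _ + _ * homOp R * _ at hW
  change wordOp Δ R.h = _ + _ * homOp R * _ at hW'
  set W := wordOp Δ R.h
  set D := deltaPos Δ
  set d := PowerSeries.C (Δ 0 : Module.End K A)
  set h := homOp R
  set π := projOp R
  exact perturbation_identity hW hW' hsq hd hhom hpp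

theorem prOp_mul_inclOp : prOp R * inclOp R = projOp R := by
  have h1 := homOp_mul_homOp R
  have h2 := homOp_mul_projOp R
  have h3 := projOp_mul_homOp R
  have h4 := projOp_mul_projOp R
  unfold prOp inclOp
  set W := wordOp Δ R.h
  set h := homOp R
  set π := projOp R
  have : (π + π * W * h) * (π + h * W * π) = π * π + (π * h) * W * π + π * W * (h * π) +
      π * W * (h * h) * W * π := by
    simp only [mul_add, add_mul, mul_assoc]; abel
  rw [this, h1, h2, h3, h4]; simp

theorem projOp_mul_prOp : projOp R * prOp R = prOp R := by
  have h4 := projOp_mul_projOp R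
  unfold prOp
  rw [mul_add, h4, ← mul_assoc, ← mul_assoc, h4]

theorem inclOp_mul_projOp : inclOp R * projOp R = inclOp R := by
  have h4 := projOp_mul_projOp R
  unfold inclOp
  rw [add_mul, h4, mul_assoc _ (projOp R), h4]

variable {R}

theorem projOp_mul_wordOp_mul_projOp (hR : IsHodgeDeRham Δ R) :
    projOp R * wordOp Δ R.h * projOp R = 0 := by
  ext1 n
  rw [projOp, PowerSeries.coeff_mul_C, PowerSeries.coeff_C_mul, map_zero, wordOp,
    PowerSeries.coeff_mk]
  split_ifs with h
  · simp
  · have := hR n (by omega)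
    simp only [Module.End.mul_eq_comp]
    calc _ = R.ι ∘ₗ (R.p ∘ₗ wordSum Δ R.h n ∘ₗ R.ι) ∘ₗ R.p := by
          simp only [LinearMap.comp_assoc]
      _ = 0 := by rw [this]; simp

/-- The degeneration condition says that the perturbed differential `P Δ S` vanishes. -/
theorem prOp_mul_deltaOp_mul_inclOp (hR : IsHodgeDeRham Δ R) :
    prOp R * deltaOp Δ * inclOp R = 0 := by
  have hW' := wordOp_eq' (Δ := Δ) R.h
  have hhom := homOp_homotopy R
  have h1 := homOp_mul_homOp R
  have h2 := homOp_mul_projOp R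
  have h3 := projOp_mul_homOp R
  have h5 := d_mul_projOp R
  have h6 := projOp_mul_d R
  have h7 := projOp_mul_wordOp_mul_projOp hR
  rw [deltaOp_eq]
  unfold prOp inclOp
  change wordOp Δ R.h = _ + _ * homOp R * _ at hW'
  set W := wordOp Δ R.h
  set D := deltaPos Δ
  set d := PowerSeries.C (Δ 0 : Module.End K A)
  set h := homOp R
  set π := projOp R
  exact perturbation_vanishing hW' hhom h1 h3 h5 h6 h7

/-- `S` takes values in closed elements: since `Δ` commutes with `S P` by the perturbation lemma and
`P S = ι p`, one has `Δ S = S (P Δ S) = 0`. -/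
theorem deltaOp_mul_inclOp [GradedAlgebra 𝒜] (hΔ : IsCommBV 𝒜 Δ) (hR : IsHodgeDeRham Δ R) :
    deltaOp Δ * inclOp R = 0 := by
  have hp := perturbed_homotopy R hΔ
  have hsq := deltaOp_mul_self hΔ
  have hps := prOp_mul_inclOp R
  have hpd := prOp_mul_deltaOp_mul_inclOp hR
  have hcomm : deltaOp Δ * (inclOp R * prOp R - 1) = (inclOp R * prOp R - 1) * deltaOp Δ := by
    rw [← hp, mul_add, add_mul, ← mul_assoc, hsq, mul_assoc (pertHomOp R), hsq, mul_zero, zero_mul,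
      add_zero, zero_add, mul_assoc]
  rw [mul_sub, sub_mul, mul_one, one_mul] at hcomm
  have hcomm := sub_left_injective hcomm
  calc deltaOp Δ * inclOp R = deltaOp Δ * (inclOp R * prOp R) * inclOp R := by
        rw [mul_assoc, mul_assoc (inclOp R), hps, inclOp_mul_projOp]
    _ = inclOp R * (prOp R * deltaOp Δ * inclOp R) := by
          rw [hcomm]; simp only [mul_assoc]
    _ = 0 := by rw [hpd, mul_zero]

/-- The splitting `S` is the perturbed inclusion. -/
theorem splitting_eq (x : Coh (Δ 0)) :
    splitting Δ R x = act (inclOp R) (PowerSeries.C (R.ι x)) := by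
  have hp : R.p (R.ι x) = x := congrArg (fun f => f x) R.p_ι
  ext n
  rw [coeff_act, splitting, PowerSeries.coeff_mk, Finset.sum_eq_single (n, 0)]
  · simp only [inclOp, homOp, projOp, map_add, PowerSeries.coeff_mul_C, PowerSeries.coeff_C_mul,
      LinearMap.add_apply, wordOp, PowerSeries.coeff_mk]
    split_ifs with h
    · simp [h, hp]
    · rw [PowerSeries.coeff_C, if_neg h]
      simp [hp]
  · rintro ⟨i, j⟩ hq hne
    have hq : i + j = n := by simpa using hq
    have hj : j ≠ 0 := by rintro rfl; exact hne (by simpa using hq)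
    simp [PowerSeries.coeff_C, hj]
  · intro h; simp at h

theorem coeff_zero_splitting (x : Coh (Δ 0)) :
    PowerSeries.coeff 0 (splitting Δ R x) = R.ι x := by
  simp [splitting]

theorem deltaPS_splitting [GradedAlgebra 𝒜] (hΔ : IsCommBV 𝒜 Δ) (hR : IsHodgeDeRham Δ R) (x : Coh (Δ 0)) :
    deltaPS Δ (splitting Δ R x) = 0 := by
  rw [splitting_eq, deltaPS_eq, ← act_mul, deltaOp_mul_inclOp hΔ hR, act_apply]; simp

theorem splitting_smul_sum {ι : Type*} (s : Finset ι) (c : ι → K) (x : ι → Coh (Δ 0)) :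
    splitting Δ R (∑ i ∈ s, c i • x i) = ∑ i ∈ s, c i • splitting Δ R (x i) := by
  ext n
  by_cases h : n = 0 <;>
    simp [splitting, h]

theorem splitting_mem [GradedAlgebra 𝒜] (hΔ : IsCommBV 𝒜 Δ) {i : ℤ} {x : Coh (Δ 0)} (hx : x ∈ cohDeg 𝒜 (Δ 0) i)
    (k : ℕ) : PowerSeries.coeff k (splitting Δ R x) ∈ 𝒜 (i - 2 * k) := by
  rw [splitting, PowerSeries.coeff_mk]
  split_ifs with h
  · subst h; simpa using R.ι_degree i x hx
  · have := R.h_degree _ _ (coeff_wordOp_mem hΔ R.h_degree k i _ (R.ι_degree i x hx))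
    rw [wordOp, PowerSeries.coeff_mk, if_neg h] at this
    convert this using 2
    ring

/-- A closed element of `A[[ħ]]` is a `K[[ħ]]`-combination of the `S(a_i)` up to exact terms. -/
theorem exists_splitting_expansion [GradedAlgebra 𝒜] (hΔ : IsCommBV 𝒜 Δ) {μ : ℕ}
    (a : Module.Basis (Fin μ) K (Coh (Δ 0))) {f : PowerSeries A} (hf : deltaPS Δ f = 0) :
    ∃ (c : Fin μ → PowerSeries K) (g : PowerSeries A),
      f = ∑ i, PowerSeries.map (algebraMap K A) (c i) * splitting Δ R (a i) + deltaPS Δ g := by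
  refine ⟨fun i => PowerSeries.mk fun n => a.repr (R.p (PowerSeries.coeff n (act (prOp R) f))) i,
    -act (pertHomOp R) f, ?_⟩
  have h1 : f = act (inclOp R) (act (prOp R) f) - deltaPS Δ (act (pertHomOp R) f) := by
    have := congrArg (fun U => act U f) (perturbed_homotopy R hΔ)
    simp only [act_add_left, act_sub_left, act_mul, act_one, ← deltaPS_eq, hf, map_zero,
      add_zero] at this
    rw [this]; abel
  conv_lhs => rw [h1]
  rw [deltaPS_neg, sub_eq_add_neg]
  congr 1
  have h2 : act (prOp R) f = ∑ i, PowerSeries.map (algebraMap K A) (PowerSeries.mk fun n =>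
      a.repr (R.p (PowerSeries.coeff n (act (prOp R) f))) i) * PowerSeries.C (R.ι (a i)) := by
    ext n
    have h3 : PowerSeries.coeff n (act (prOp R) f) =
        R.ι (R.p (PowerSeries.coeff n (act (prOp R) f))) := by
      conv_lhs => rw [← projOp_mul_prOp, act_mul, coeff_act]
      rw [Finset.sum_eq_single (0, n)]
      · simp [projOp]
      · rintro ⟨i, j⟩ hq hne
        have hq : i + j = n := by simpa using hq
        have hj : i ≠ 0 := by rintro rfl; exact hne (by simpa using hq)
        simp [PowerSeries.coeff_C, projOp, hj]
      · intro h; simp at h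
    conv_lhs => rw [h3, ← a.sum_repr (R.p (PowerSeries.coeff n (act (prOp R) f)))]
    simp only [map_sum, map_smul, PowerSeries.coeff_mul_C, PowerSeries.coeff_map,
      PowerSeries.coeff_mk, Algebra.smul_def]
  conv_lhs => rw [h2]
  rw [map_sum]
  simp only [act_scalar_mul, splitting_eq]

end Operators

/-! ### The operator `Δ` and the pairing on Laurent series -/

section LaurentDelta

variable {K A : Type*} [Field K] [Ring A] [Algebra K A]

open Finset.HasAntidiagonal (antidiagonal mem_antidiagonal)

/-- The coefficients of `Δ f`, as finite sums with an arbitrary large number of terms. -/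
theorem coeff_deltaL (Δ : ℕ → A →ₗ[K] A) (f : LaurentSeries A) (n : ℤ) {N : ℕ}
    (hN : ∀ i : ℕ, N ≤ i → f.coeff (n - i) = 0) :
    (deltaL Δ f).coeff n = ∑ i ∈ Finset.range N, Δ i (f.coeff (n - i)) := by
  classical
  rw [deltaL, HahnModule.coeff_smul]
  refine Finset.sum_of_injOn (fun q => q.1.toNat) ?_ ?_ ?_ ?_
  · rintro ⟨i, j⟩ hq ⟨i', j'⟩ hq' h
    simp only [Finset.mem_coe, Finset.mem_vaddAntidiagonal, HahnSeries.mem_support,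
      vadd_eq_add] at hq hq' h
    have hi : 0 ≤ i := by
      by_contra hi; exact hq.1 (coeff_toLaurent_neg _ (by omega))
    have hi' : 0 ≤ i' := by
      by_contra hi; exact hq'.1 (coeff_toLaurent_neg _ (by omega))
    have h : i = i' := by omega
    have h' : j = j' := by omega
    rw [h, h']
  · rintro ⟨i, j⟩ hq
    simp only [Finset.mem_coe, Finset.mem_vaddAntidiagonal, HahnSeries.mem_support,
      vadd_eq_add, Finset.mem_range] at hq ⊢
    have hi : 0 ≤ i := by
      by_contra hi; exact hq.1 (coeff_toLaurent_neg _ (by omega))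
    by_contra h
    refine hq.2.1 ?_
    have := hN i.toNat (by omega)
    rw [← this]
    change f.coeff j = _
    congr 1; omega
  · intro i hi hne
    by_contra h
    refine hne ⟨(i, n - i), ?_, by simp⟩
    simp only [Finset.mem_coe, Finset.mem_vaddAntidiagonal, HahnSeries.mem_support,
      vadd_eq_add, add_sub_cancel, and_true]
    refine ⟨fun h0 => h ?_, fun h0 => h ?_⟩
    · rw [coeff_toLaurent_natCast, PowerSeries.coeff_mk] at h0
      rw [h0]; rfl
    · have h0 : f.coeff (n - i) = 0 := h0
      rw [h0, map_zero]
  · rintro ⟨i, j⟩ hq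
    simp only [Finset.mem_vaddAntidiagonal, HahnSeries.mem_support, vadd_eq_add] at hq
    have hi : 0 ≤ i := by
      by_contra hi; exact hq.1 (coeff_toLaurent_neg _ (by omega))
    obtain ⟨i, rfl⟩ := Int.eq_ofNat_of_zero_le hi
    rw [coeff_toLaurent_natCast, PowerSeries.coeff_mk]
    have : j = n - i := by omega
    subst this
    rfl

theorem exists_coeff_bound (f : LaurentSeries A) (n : ℤ) :
    ∃ N : ℕ, ∀ i : ℕ, N ≤ i → f.coeff (n - i) = 0 := by
  obtain ⟨k, g, rfl⟩ := exists_eq_hbar_mul f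
  refine ⟨(n - k + 1).toNat, fun i hi => ?_⟩
  rw [coeff_hbar_mul, coeff_toLaurent_neg]
  omega

variable (Δ : ℕ → A →ₗ[K] A)

theorem deltaL_toLaurent (f : PowerSeries A) : deltaL Δ (toLaurent f) = toLaurent (deltaPS Δ f) := by
  ext n
  rw [coeff_deltaL Δ _ n (N := (n + 1).toNat) fun i hi => coeff_toLaurent_neg _ (by omega)]
  rcases lt_or_ge n 0 with hn | hn
  · rw [coeff_toLaurent_neg _ hn, Int.toNat_of_nonpos (by omega), Finset.sum_range_zero]
  · obtain ⟨n, rfl⟩ := Int.eq_ofNat_of_zero_le hn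
    rw [coeff_toLaurent_natCast, coeff_deltaPS,
      Finset.Nat.sum_antidiagonal_eq_sum_range_succ
        fun i j => Δ i (PowerSeries.coeff j f)]
    refine Finset.sum_congr (by congr 1) fun i hi => ?_
    have hi := Finset.mem_range.mp hi
    rw [← coeff_toLaurent_natCast]
    congr 2
    omega

theorem deltaL_hbar_mul (k : ℤ) (f : LaurentSeries A) :
    deltaL Δ (hbar A k * f) = hbar A k * deltaL Δ f := by
  ext n
  obtain ⟨N, hN⟩ := exists_coeff_bound f (n - k)
  rw [coeff_hbar_mul, coeff_deltaL Δ f _ hN, coeff_deltaL Δ _ n (N := N)]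
  · refine Finset.sum_congr rfl fun i _ => ?_
    rw [coeff_hbar_mul]; congr 2; ring
  · intro i hi
    rw [coeff_hbar_mul, ← hN i hi]; congr 1; ring

theorem deltaL_hbar_mul_toLaurent (k : ℤ) (f : PowerSeries A) :
    deltaL Δ (hbar A k * toLaurent f) = hbar A k * toLaurent (deltaPS Δ f) := by
  rw [deltaL_hbar_mul, deltaL_toLaurent]

theorem deltaL_add (f g : LaurentSeries A) : deltaL Δ (f + g) = deltaL Δ f + deltaL Δ g := by
  rw [deltaL, HahnModule.of_add, smul_add, HahnModule.of_symm_add]; rfl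

/-- `Δ` on `A((ħ))` as a homomorphism of groups. -/
def deltaHom : LaurentSeries A →+ LaurentSeries A where
  toFun := deltaL Δ
  map_zero' := by
    have := deltaL_add Δ 0 0
    rw [add_zero] at this
    exact left_eq_add.mp this
  map_add' := deltaL_add Δ

@[simp] theorem deltaL_zero : deltaL Δ 0 = 0 := map_zero (deltaHom Δ)

theorem deltaL_neg (f : LaurentSeries A) : deltaL Δ (-f) = -deltaL Δ f := map_neg (deltaHom Δ) f

theorem deltaL_sub (f g : LaurentSeries A) : deltaL Δ (f - g) = deltaL Δ f - deltaL Δ g :=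
  map_sub (deltaHom Δ) f g

theorem deltaL_zsmul (z : ℤ) (f : LaurentSeries A) : deltaL Δ (z • f) = z • deltaL Δ f :=
  map_zsmul (deltaHom Δ) z f

theorem deltaL_sum {ι : Type*} (s : Finset ι) (f : ι → LaurentSeries A) :
    deltaL Δ (∑ i ∈ s, f i) = ∑ i ∈ s, deltaL Δ (f i) := map_sum (deltaHom Δ) f s

theorem deltaL_scal_mul (c : LaurentSeries K) (f : LaurentSeries A) :
    deltaL Δ (scal A c * f) = scal A c * deltaL Δ f := by
  obtain ⟨k, c, rfl⟩ := exists_eq_hbar_mul c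
  obtain ⟨l, f, rfl⟩ := exists_eq_hbar_mul f
  rw [map_mul, scal_hbar, scal_toLaurent, hbar_mul_mul_hbar_mul, deltaL_hbar_mul_toLaurent,
    ← toLaurent_mul, deltaL_hbar_mul_toLaurent, deltaPS_scalar_mul, toLaurent_mul,
    hbar_mul_mul_hbar_mul]

theorem smul_eq_scal (c : K) (f : LaurentSeries A) : c • f = scal A (HahnSeries.C c) * f := by
  ext n
  have : scal A (HahnSeries.C c) = HahnSeries.C (algebraMap K A c) := by
    ext m
    simp only [coeff_scal, HahnSeries.C_apply, HahnSeries.coeff_single]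
    split_ifs <;> simp
  rw [this, HahnSeries.C_mul_eq_smul, HahnSeries.coeff_smul, HahnSeries.coeff_smul,
    Algebra.smul_def, smul_eq_mul]

theorem deltaL_smul (c : K) (f : LaurentSeries A) : deltaL Δ (c • f) = c • deltaL Δ f := by
  rw [smul_eq_scal, deltaL_scal_mul, smul_eq_scal]

variable {𝒜 : ℤ → Submodule K A} [GradedAlgebra 𝒜] {Δ}

theorem deltaL_deltaL (hΔ : IsCommBV 𝒜 Δ) (f : LaurentSeries A) : deltaL Δ (deltaL Δ f) = 0 := by
  obtain ⟨k, f, rfl⟩ := exists_eq_hbar_mul f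
  rw [deltaL_hbar_mul_toLaurent, deltaL_hbar_mul_toLaurent, deltaPS_deltaPS hΔ, toLaurent_zero,
    mul_zero]

theorem mapL_deltaL (hΔ : IsCommBV 𝒜 Δ) (f : LaurentSeries A) :
    mapL (parityHom 𝒜) (deltaL Δ f) = -deltaL Δ (mapL (parityHom 𝒜) f) := by
  ext n
  obtain ⟨N, hN⟩ := exists_coeff_bound f n
  rw [coeff_mapL, coeff_deltaL Δ f n hN, HahnSeries.coeff_neg, coeff_deltaL Δ _ n (N := N),
    map_sum, ← Finset.sum_neg_distrib]
  · refine Finset.sum_congr rfl fun k _ => ?_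
    have hk : ∀ i, ∀ a ∈ 𝒜 i, Δ k a ∈ 𝒜 (i + (1 - 2 * k)) := by
      intro i a ha
      have := hΔ.degree k i a ha
      rwa [show i + (1 - 2 * (k : ℤ)) = i + 1 - 2 * k by ring]
    rw [parityHom_apply, map_parity_of_degree hk, sgn_odd ⟨-k, by ring⟩, coeff_mapL,
      parityHom_apply, neg_one_smul]
  · intro i hi
    rw [coeff_mapL, hN i hi, map_zero]

end LaurentDelta

section Pairing

variable {K A : Type*} [Field K] [Ring A] [Algebra K A]

open Finset.HasAntidiagonal (antidiagonal mem_antidiagonal)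

/-- The `ħ`-linear extension of a linear form. -/
def trL (Tr : A →ₗ[K] K) : LaurentSeries A →+ LaurentSeries K where
  toFun f := f.map Tr
  map_zero' := by ext; simp
  map_add' _ _ := by ext; simp

theorem coeff_trL (Tr : A →ₗ[K] K) (f : LaurentSeries A) (n : ℤ) :
    (trL Tr f).coeff n = Tr (f.coeff n) := rfl

variable (Tr : A →ₗ[K] K)

theorem pairing_eq (f g : LaurentSeries A) : pairing Tr f g = trL Tr (f * bar g) := rfl

theorem trL_scal_mul (c : LaurentSeries K) (f : LaurentSeries A) :
    trL Tr (scal A c * f) = c * trL Tr f := by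
  obtain ⟨k, c, rfl⟩ := exists_eq_hbar_mul c
  obtain ⟨l, f, rfl⟩ := exists_eq_hbar_mul f
  have h1 : ∀ (k : ℤ) (g : LaurentSeries A), trL Tr (hbar A k * g) = hbar K k * trL Tr g := by
    intro k g
    ext n
    rw [coeff_trL, coeff_hbar_mul, coeff_hbar_mul, coeff_trL]
  have h2 : ∀ g : PowerSeries A, trL Tr (toLaurent g) =
      toLaurent (PowerSeries.mk fun n => Tr (PowerSeries.coeff n g)) := by
    intro g
    ext n
    rw [coeff_trL]
    rcases lt_or_ge n 0 with hn | hn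
    · rw [coeff_toLaurent_neg _ hn, coeff_toLaurent_neg _ hn, map_zero]
    · obtain ⟨n, rfl⟩ := Int.eq_ofNat_of_zero_le hn
      rw [coeff_toLaurent_natCast, coeff_toLaurent_natCast, PowerSeries.coeff_mk]
  rw [(scal A).map_mul, scal_hbar, scal_toLaurent, hbar_mul_mul_hbar_mul, h1, ← toLaurent_mul, h2,
    h1, h2,
    hbar_mul_mul_hbar_mul, ← toLaurent_mul]
  congr 2
  ext n
  simp only [PowerSeries.coeff_mk, PowerSeries.coeff_mul, map_sum, PowerSeries.coeff_map]
  refine Finset.sum_congr rfl fun q _ => ?_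
  rw [← Algebra.smul_def, map_smul, smul_eq_mul]

theorem pairing_add_left (f g u : LaurentSeries A) :
    pairing Tr (f + g) u = pairing Tr f u + pairing Tr g u := by
  rw [pairing_eq, add_mul, map_add]; rfl

theorem pairing_add_right (f g u : LaurentSeries A) :
    pairing Tr u (f + g) = pairing Tr u f + pairing Tr u g := by
  rw [pairing_eq, bar_add, mul_add, map_add]; rfl

/-- The pairing as a biadditive map. -/
def pairingHom : LaurentSeries A →+ LaurentSeries A →+ LaurentSeries K :=
  AddMonoidHom.mk' (fun f => AddMonoidHom.mk' (pairing Tr f) fun u v => pairing_add_right Tr u v f)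
    fun u v => by ext1 w; exact pairing_add_left Tr u v w

theorem pairing_zero_left (u : LaurentSeries A) : pairing Tr 0 u = 0 :=
  congrArg (fun φ => φ u) (map_zero (pairingHom Tr))

theorem pairing_zero_right (u : LaurentSeries A) : pairing Tr u 0 = 0 :=
  map_zero (pairingHom Tr u)

theorem pairing_sub_left (f g u : LaurentSeries A) :
    pairing Tr (f - g) u = pairing Tr f u - pairing Tr g u :=
  congrArg (fun φ => φ u) (map_sub (pairingHom Tr) f g)

theorem pairing_sub_right (f g u : LaurentSeries A) :
    pairing Tr u (f - g) = pairing Tr u f - pairing Tr u g :=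
  map_sub (pairingHom Tr u) f g

theorem pairing_zsmul_left (z : ℤ) (f u : LaurentSeries A) :
    pairing Tr (z • f) u = z • pairing Tr f u :=
  congrArg (fun φ => φ u) (map_zsmul (pairingHom Tr) z f)

theorem pairing_sum_left {ι : Type*} (s : Finset ι) (f : ι → LaurentSeries A)
    (u : LaurentSeries A) : pairing Tr (∑ i ∈ s, f i) u = ∑ i ∈ s, pairing Tr (f i) u :=
  map_sum ((pairingHom Tr).flip u) f s

theorem pairing_sum_right {ι : Type*} (s : Finset ι) (f : ι → LaurentSeries A)
    (u : LaurentSeries A) : pairing Tr u (∑ i ∈ s, f i) = ∑ i ∈ s, pairing Tr u (f i) :=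
  map_sum (pairingHom Tr u) f s

theorem pairing_scal_left (c : LaurentSeries K) (f g : LaurentSeries A) :
    pairing Tr (scal A c * f) g = c * pairing Tr f g := by
  rw [pairing_eq, mul_assoc, trL_scal_mul]; rfl

theorem pairing_scal_right (c : LaurentSeries K) (f g : LaurentSeries A) :
    pairing Tr f (scal A c * g) = bar c * pairing Tr f g := by
  rw [pairing_eq, bar_mul, bar_scal, ← mul_assoc, ← scal_comm, mul_assoc, trL_scal_mul]; rfl

theorem pairing_hbar_left (k : ℤ) (f g : LaurentSeries A) :
    pairing Tr (hbar A k * f) g = hbar K k * pairing Tr f g := by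
  rw [← scal_hbar (K := K), pairing_scal_left]

theorem bar_hbar (k : ℤ) : bar (hbar K k) = sgn k • hbar K k := by
  have h1 : bar (1 : LaurentSeries K) = 1 := map_one (barHom K)
  have := bar_hbar_mul k (1 : LaurentSeries K)
  rwa [mul_one, h1, mul_one] at this

theorem pairing_hbar_right (k : ℤ) (f g : LaurentSeries A) :
    pairing Tr f (hbar A k * g) = sgn k • (hbar K k * pairing Tr f g) := by
  rw [← scal_hbar (K := K), pairing_scal_right, bar_hbar, smul_mul_assoc]

/-- A Laurent series with values in a graded algebra is homogeneous of degree `i` if its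
coefficient at `ħ^k` has degree `i - 2k`. -/
def HomL (𝒜 : ℤ → Submodule K A) (i : ℤ) (f : LaurentSeries A) : Prop :=
  ∀ k, f.coeff k ∈ 𝒜 (i - 2 * k)

theorem homL_toLaurent {𝒜 : ℤ → Submodule K A} {i : ℤ} {f : PowerSeries A} :
    HomL 𝒜 i (toLaurent f) ↔ ∀ k : ℕ, PowerSeries.coeff k f ∈ 𝒜 (i - 2 * k) := by
  constructor
  · intro h k
    have := h k
    rwa [coeff_toLaurent_natCast] at this
  · intro h k
    rcases lt_or_ge k 0 with hk | hk
    · rw [coeff_toLaurent_neg _ hk]; exact zero_mem _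
    · obtain ⟨k, rfl⟩ := Int.eq_ofNat_of_zero_le hk
      rw [coeff_toLaurent_natCast]; exact h k

theorem HomL.add {𝒜 : ℤ → Submodule K A} {i : ℤ} {f g : LaurentSeries A} (hf : HomL 𝒜 i f)
    (hg : HomL 𝒜 i g) : HomL 𝒜 i (f + g) := fun k => by
  rw [HahnSeries.coeff_add]; exact add_mem (hf k) (hg k)

theorem HomL.neg {𝒜 : ℤ → Submodule K A} {i : ℤ} {f : LaurentSeries A} (hf : HomL 𝒜 i f) :
    HomL 𝒜 i (-f) := fun k => by
  rw [HahnSeries.coeff_neg]; exact neg_mem (hf k)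

theorem HomL.sub {𝒜 : ℤ → Submodule K A} {i : ℤ} {f g : LaurentSeries A} (hf : HomL 𝒜 i f)
    (hg : HomL 𝒜 i g) : HomL 𝒜 i (f - g) := by rw [sub_eq_add_neg]; exact hf.add hg.neg

theorem HomL.sum {𝒜 : ℤ → Submodule K A} {i : ℤ} {ι : Type*} {s : Finset ι}
    {f : ι → LaurentSeries A} (hf : ∀ j ∈ s, HomL 𝒜 i (f j)) : HomL 𝒜 i (∑ j ∈ s, f j) := fun k => by
  rw [HahnSeries.coeff_sum]; exact Submodule.sum_mem _ fun j hj => hf j hj k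

theorem HomL.zsmul {𝒜 : ℤ → Submodule K A} {i : ℤ} {f : LaurentSeries A} (hf : HomL 𝒜 i f)
    (z : ℤ) : HomL 𝒜 i (z • f) := fun k => by
  rw [HahnSeries.coeff_smul]; exact zsmul_mem (hf k) z

theorem HomL.smul {𝒜 : ℤ → Submodule K A} {i : ℤ} {f : LaurentSeries A} (hf : HomL 𝒜 i f)
    (z : K) : HomL 𝒜 i (z • f) := fun k => by
  rw [HahnSeries.coeff_smul]; exact Submodule.smul_mem _ z (hf k)

theorem HomL.bar {𝒜 : ℤ → Submodule K A} {i : ℤ} {f : LaurentSeries A} (hf : HomL 𝒜 i f) :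
    HomL 𝒜 i (bar f) := fun k => by
  rw [coeff_bar]; exact zsmul_mem (hf k) _

theorem HomL.hbar_mul {𝒜 : ℤ → Submodule K A} {i : ℤ} {f : LaurentSeries A} (hf : HomL 𝒜 i f)
    (k : ℤ) : HomL 𝒜 (i + 2 * k) (hbar A k * f) := fun j => by
  rw [coeff_hbar_mul, show i + 2 * k - 2 * j = i - 2 * (j - k) by ring]; exact hf _

theorem HomL.mul {𝒜 : ℤ → Submodule K A} [GradedAlgebra 𝒜] {i j : ℤ} {f g : LaurentSeries A}
    (hf : HomL 𝒜 i f) (hg : HomL 𝒜 j g) : HomL 𝒜 (i + j) (f * g) := fun k => by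
  rw [HahnSeries.coeff_mul]
  refine Submodule.sum_mem _ fun q hq => ?_
  have hq := (Finset.mem_antidiagonal.mp hq).2.2
  have := SetLike.mul_mem_graded (hf q.1) (hg q.2)
  rwa [← hq, show i + j - 2 * (q.1 + q.2) = i - 2 * q.1 + (j - 2 * q.2) by ring]

theorem HomL.scal_mul {𝒜 : ℤ → Submodule K A} {i j : ℤ} {c : LaurentSeries K}
    {f : LaurentSeries A} (hc : ∀ k, c.coeff k ≠ 0 → j + 2 * k = i) (hf : HomL 𝒜 j f) :
    HomL 𝒜 i (scal A c * f) := fun k => by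
  rw [HahnSeries.coeff_mul]
  refine Submodule.sum_mem _ fun q hq => ?_
  have hq := (Finset.mem_antidiagonal.mp hq).2.2
  rw [coeff_scal, ← Algebra.smul_def]
  by_cases h : c.coeff q.1 = 0
  · rw [h, zero_smul]; exact zero_mem _
  · rw [← hq, ← hc _ h, show j + 2 * q.1 - 2 * (q.1 + q.2) = j - 2 * q.2 by ring]
    exact Submodule.smul_mem _ _ (hf _)

theorem HomL.parity {𝒜 : ℤ → Submodule K A} [GradedAlgebra 𝒜] {i : ℤ} {f : LaurentSeries A}
    (hf : HomL 𝒜 i f) : mapL (parityHom 𝒜) f = sgn i • f := by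
  ext k
  rw [coeff_mapL, parityHom_apply, parity_of_mem 𝒜 (hf k), HahnSeries.coeff_smul, sgn_sub,
    sgn_two_mul, mul_one]

variable {Tr} {𝒜 : ℤ → Submodule K A} {n : ℤ} {Δ : ℕ → A →ₗ[K] A}

theorem pairing_degree [GradedAlgebra 𝒜] (hTr : IsCyclicBV 𝒜 n Δ Tr) {i j : ℤ} {f g : LaurentSeries A}
    (hf : HomL 𝒜 i f) (hg : HomL 𝒜 j g) {k : ℤ} (hk : (pairing Tr f g).coeff k ≠ 0) :
    i + j - 2 * k = n := by
  by_contra h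
  exact hk (hTr.degree _ h _ ((hf.mul hg.bar) k))

/-- The pairing is graded hermitian. -/
theorem pairing_swap [GradedAlgebra 𝒜] [CharZero K] (hΔ : IsCommBV 𝒜 Δ) {i j : ℤ} {f g : LaurentSeries A}
    (hf : HomL 𝒜 i f) (hg : HomL 𝒜 j g) :
    pairing Tr g f = sgn (i * j) • bar (pairing Tr f g) := by
  have hp := neg_one_pow_par (deg := fun _ : Fin 1 => i) 0
  have h := isSuperComm_mapL (isSuperComm_parityHom hΔ) (par (fun _ : Fin 1 => i) 0)
    (bar f) g (by rw [hf.bar.parity, ← hp])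
  have h2 : ((mapL (parityHom 𝒜)) ^ par (fun _ : Fin 1 => i) 0) g = sgn (i * j) • g := by
    rcases Int.even_or_odd i with h | h
    · rw [par, if_neg (by simpa using h), pow_zero, sgn_even (h.mul_right j), one_smul]; rfl
    · rw [par, if_pos h, pow_one, hg.parity]
      congr 1
      rw [sgn_eq_iff, show j - i * j = j * (1 - i) by ring]
      exact (by simpa [parity_simps] using h : Even (1 - i)).mul_left j
  rw [h2, smul_mul_assoc] at h
  have h3 : BVInfty.bar (pairing Tr f g) = trL Tr (BVInfty.bar f * g) := by
    rw [pairing_eq]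
    have : ∀ w : LaurentSeries A, BVInfty.bar (trL Tr w) = trL Tr (BVInfty.bar w) := by
      intro w; ext k; rw [coeff_bar, coeff_trL, coeff_trL, coeff_bar, map_zsmul]
    rw [this, bar_mul, bar_bar]
  rw [h3, h, map_zsmul, smul_smul, sgn_mul_self, one_smul]; rfl

theorem sum_antidiagonal_reassoc {M : Type*} [AddCommMonoid M] (f : ℕ → ℕ → ℕ → M) (n : ℕ) :
    ∑ q ∈ antidiagonal n, ∑ r ∈ antidiagonal q.1, f r.1 r.2 q.2 =
      ∑ q ∈ antidiagonal n, ∑ r ∈ antidiagonal q.2, f r.1 q.1 r.2 := by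
  rw [Finset.sum_sigma', Finset.sum_sigma']
  refine Finset.sum_nbij' (fun q => ⟨(q.2.2, q.2.1 + q.1.2), (q.2.1, q.1.2)⟩)
    (fun q => ⟨(q.1.1 + q.2.1, q.2.2), (q.2.1, q.1.1)⟩) ?_ ?_ ?_ ?_ ?_
  all_goals
    rintro ⟨⟨i, j⟩, ⟨k, l⟩⟩ h
    simp only [Finset.mem_sigma, mem_antidiagonal] at h
    obtain ⟨h1, h2⟩ := h
    subst h2 h1
  · simp [add_comm, add_left_comm]
  · simpa [add_assoc] using add_comm k i
  · simp [add_comm]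
  · simp
  · rfl

theorem trace_adjoint [GradedAlgebra 𝒜] (hTr : IsCyclicBV 𝒜 n Δ Tr) (k : ℕ) (a b : A) :
    Tr (Δ k a * b) = -((-1 : ℤ) ^ k • Tr (parity 𝒜 a * Δ k b)) := by
  induction a using DirectSum.Decomposition.inductionOn 𝒜 with
  | zero => simp
  | add x y hx hy => simp only [map_add, add_mul, hx, hy, smul_add, neg_add]
  | @homogeneous i x =>
    rw [hTr.adjoint k i x x.2, parity_of_mem 𝒜 x.2, smul_mul_assoc, map_zsmul, smul_smul,
      sgn_add, sgn_add, sgn_natCast, sgn_odd odd_one, mul_neg_one, neg_smul, mul_comm]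

/-- `Δ` is graded anti-selfadjoint for the pairing. -/
theorem pairing_deltaL [GradedAlgebra 𝒜] (hTr : IsCyclicBV 𝒜 n Δ Tr) (f g : LaurentSeries A) :
    pairing Tr (deltaL Δ f) g = -pairing Tr (mapL (parityHom 𝒜) f) (deltaL Δ g) := by
  obtain ⟨k, f, rfl⟩ := exists_eq_hbar_mul f
  obtain ⟨l, g, rfl⟩ := exists_eq_hbar_mul g
  rw [map_mul, mapL_hbar, mapL_toLaurent]
  simp only [deltaL_hbar_mul_toLaurent, pairing_hbar_left, pairing_hbar_right]
  rw [← smul_neg, ← mul_neg, ← mul_neg]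
  congr 3
  ext m
  rw [HahnSeries.coeff_neg, pairing_eq, pairing_eq, coeff_trL, coeff_trL, bar_toLaurent,
    bar_toLaurent, ← toLaurent_mul, ← toLaurent_mul]
  rcases lt_or_ge m 0 with hm | hm
  · rw [coeff_toLaurent_neg _ hm, coeff_toLaurent_neg _ hm, map_zero, neg_zero]
  obtain ⟨m, rfl⟩ := Int.eq_ofNat_of_zero_le hm
  rw [coeff_toLaurent_natCast, coeff_toLaurent_natCast, PowerSeries.coeff_mul,
    PowerSeries.coeff_mul, map_sum, map_sum, ← Finset.sum_neg_distrib]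
  simp only [coeff_deltaPS, barP, PowerSeries.coeff_mk, Finset.sum_mul, map_sum, Finset.smul_sum,
    Finset.mul_sum, ← Finset.sum_neg_distrib]
  rw [sum_antidiagonal_reassoc fun k i j => Tr (Δ k (PowerSeries.coeff i f) *
    ((-1 : ℤ) ^ j • PowerSeries.coeff j g))]
  refine Finset.sum_congr rfl fun q _ => Finset.sum_congr rfl fun r hr => ?_
  rw [trace_adjoint hTr, ← mem_antidiagonal.mp hr, map_zsmul, mul_smul_comm, map_zsmul, smul_smul, ← pow_add,
    mul_smul_comm, map_zsmul]
  rfl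

theorem pairing_deltaL_left [GradedAlgebra 𝒜] (hTr : IsCyclicBV 𝒜 n Δ Tr) {f g : LaurentSeries A}
    (hg : deltaL Δ g = 0) : pairing Tr (deltaL Δ f) g = 0 := by
  rw [pairing_deltaL hTr, hg, pairing_zero_right, neg_zero]

theorem pairing_deltaL_right [GradedAlgebra 𝒜] (hTr : IsCyclicBV 𝒜 n Δ Tr) {f g : LaurentSeries A}
    (hΔ : IsCommBV 𝒜 Δ) (hf : deltaL Δ f = 0) : pairing Tr f (deltaL Δ g) = 0 := by
  have hinv : ∀ u : LaurentSeries A, mapL (parityHom 𝒜) (mapL (parityHom 𝒜) u) = u := by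
    intro u; ext k; simp only [coeff_mapL, parityHom_apply, parity_parity]
  have h := pairing_deltaL hTr (mapL (parityHom 𝒜) f) g
  rw [hinv] at h
  have h0 : deltaL Δ (mapL (parityHom 𝒜) f) = 0 := by
    rw [← neg_eq_zero, ← mapL_deltaL hΔ, hf, map_zero]
  rw [h0, pairing_zero_left] at h
  exact neg_eq_zero.mp h.symm

end Pairing

/-! ### Frames of flat sections and their coordinates -/

section Frame

variable {K A : Type*} [Field K] [Ring A] [Algebra K A] {μ : ℕ}

open Finset.HasAntidiagonal (antidiagonal mem_antidiagonal)

/-- Homogeneous closed elements of `A[[ħ]]` with constant pairings `G i j`, which generate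
`H(A[[ħ]], Δ)`. -/
structure IsFrame (𝒜 : ℤ → Submodule K A) (n : ℤ) (Δ : ℕ → A →ₗ[K] A) (Tr : A →ₗ[K] K)
    (deg : Fin μ → ℤ) (G : Matrix (Fin μ) (Fin μ) K)
    (α : Fin μ → PowerSeries A) : Prop where
  closed : ∀ i, deltaPS Δ (α i) = 0
  mem : ∀ i, HomL 𝒜 (deg i) (toLaurent (α i))
  pair : ∀ i j, pairing Tr (toLaurent (α i)) (toLaurent (α j)) = HahnSeries.C (G i j)
  span : ∀ f, deltaPS Δ f = 0 → ∃ (c : Fin μ → PowerSeries K) (g : PowerSeries A),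
    f = ∑ i, PowerSeries.map (algebraMap K A) (c i) * α i + deltaPS Δ g
  det : IsUnit G.det
  symm : ∀ i j, G i j = sgn (deg i * deg j) • G j i
  degree : ∀ i j, G i j ≠ 0 → deg i + deg j = n

/-- The pairing on `A[[ħ]]`. -/
def pairP (Tr : A →ₗ[K] K) (f g : PowerSeries A) : PowerSeries K :=
  PowerSeries.mk fun n => Tr (PowerSeries.coeff n (f * barP g))

theorem pairing_toLaurent (Tr : A →ₗ[K] K) (f g : PowerSeries A) :
    pairing Tr (toLaurent f) (toLaurent g) = toLaurent (pairP Tr f g) := by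
  ext n
  rw [pairing_eq, coeff_trL, bar_toLaurent, ← toLaurent_mul]
  rcases lt_or_ge n 0 with hn | hn
  · rw [coeff_toLaurent_neg _ hn, coeff_toLaurent_neg _ hn, map_zero]
  · obtain ⟨n, rfl⟩ := Int.eq_ofNat_of_zero_le hn
    rw [coeff_toLaurent_natCast, coeff_toLaurent_natCast, pairP, PowerSeries.coeff_mk]

theorem coeff_pairP (Tr : A →ₗ[K] K) (f g : PowerSeries A) (n : ℕ) :
    PowerSeries.coeff n (pairP Tr f g) = ∑ q ∈ antidiagonal n,
      (-1 : ℤ) ^ q.2 • Tr (PowerSeries.coeff q.1 f * PowerSeries.coeff q.2 g) := by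
  simp only [pairP, PowerSeries.coeff_mk, PowerSeries.coeff_mul, map_sum, barP, mul_smul_comm,
    map_zsmul]

theorem coeff_zero_pairP (Tr : A →ₗ[K] K) (f g : PowerSeries A) :
    PowerSeries.coeff 0 (pairP Tr f g) =
      Tr (PowerSeries.coeff 0 f * PowerSeries.coeff 0 g) := by
  simp [coeff_pairP]

theorem C_eq_toLaurent (x : K) :
    (HahnSeries.C x : LaurentSeries K) = toLaurent (PowerSeries.C x) :=
  (HahnSeries.ofPowerSeries_C x).symm

theorem bar_C (x : K) : bar (HahnSeries.C x : LaurentSeries K) = HahnSeries.C x := by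
  ext n
  rw [coeff_bar, HahnSeries.C_apply, HahnSeries.coeff_single]
  split_ifs with h
  · rw [h, sgn_zero, one_smul]
  · rw [smul_zero]

theorem coeff_C_mul (x : K) (f : LaurentSeries K) (m : ℤ) :
    ((HahnSeries.C x : LaurentSeries K) * f).coeff m = x * f.coeff m := by
  rw [HahnSeries.C_mul_eq_smul, HahnSeries.coeff_smul, smul_eq_mul]

theorem hbar_mul_smul (k : ℤ) (x : K) (f : LaurentSeries A) :
    hbar A k * (x • f) = x • (hbar A k * f) := by
  ext m
  rw [coeff_hbar_mul, HahnSeries.coeff_smul, HahnSeries.coeff_smul, coeff_hbar_mul]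

/-- The coordinates of (the class of) a closed element with respect to a frame with pairing
matrix `G`. -/
def coord (Tr : A →ₗ[K] K) (G : Matrix (Fin μ) (Fin μ) K) (α : Fin μ → PowerSeries A)
    (k : Fin μ) : LaurentSeries A →+ LaurentSeries K where
  toFun f := ∑ j, pairing Tr f (toLaurent (α j)) * HahnSeries.C (G⁻¹ j k)
  map_zero' := by simp [pairing_zero_left]
  map_add' f g := by simp [pairing_add_left, add_mul, Finset.sum_add_distrib]

theorem coord_apply (Tr : A →ₗ[K] K) (G : Matrix (Fin μ) (Fin μ) K) (α : Fin μ → PowerSeries A)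
    (k : Fin μ) (f : LaurentSeries A) :
    coord Tr G α k f = ∑ j, pairing Tr f (toLaurent (α j)) * HahnSeries.C (G⁻¹ j k) := rfl

theorem coord_scal_mul (Tr : A →ₗ[K] K) (G : Matrix (Fin μ) (Fin μ) K)
    (α : Fin μ → PowerSeries A) (k : Fin μ) (c : LaurentSeries K) (f : LaurentSeries A) :
    coord Tr G α k (scal A c * f) = c * coord Tr G α k f := by
  simp only [coord_apply, pairing_scal_left, Finset.mul_sum, mul_assoc]

theorem coord_hbar_mul (Tr : A →ₗ[K] K) (G : Matrix (Fin μ) (Fin μ) K)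
    (α : Fin μ → PowerSeries A) (k : Fin μ) (l : ℤ) (f : LaurentSeries A) :
    coord Tr G α k (hbar A l * f) = hbar K l * coord Tr G α k f := by
  rw [← scal_hbar (K := K), coord_scal_mul]

theorem coord_smul (Tr : A →ₗ[K] K) (G : Matrix (Fin μ) (Fin μ) K)
    (α : Fin μ → PowerSeries A) (k : Fin μ) (c : K) (f : LaurentSeries A) :
    coord Tr G α k (c • f) = c • coord Tr G α k f := by
  rw [smul_eq_scal, coord_scal_mul, HahnSeries.C_mul_eq_smul]

/-- The coordinates of elements of `A[[ħ]]` lie in `K[[ħ]]`. -/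
theorem exists_coord_toLaurent (Tr : A →ₗ[K] K) (G : Matrix (Fin μ) (Fin μ) K)
    (α : Fin μ → PowerSeries A) (k : Fin μ) (f : PowerSeries A) :
    ∃ c, coord Tr G α k (toLaurent f) = toLaurent c := by
  refine ⟨∑ j, pairP Tr f (α j) * PowerSeries.C (G⁻¹ j k), ?_⟩
  rw [toLaurent_sum, coord_apply]
  exact Finset.sum_congr rfl fun j _ => by
    rw [pairing_toLaurent, toLaurent_mul, C_eq_toLaurent]

variable {𝒜 : ℤ → Submodule K A} {n : ℤ} {Δ : ℕ → A →ₗ[K] A} {Tr : A →ₗ[K] K}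
  {deg : Fin μ → ℤ} {G : Matrix (Fin μ) (Fin μ) K} {α : Fin μ → PowerSeries A}

/-- The inverse of a homogeneous matrix is homogeneous. -/
theorem inv_degree (hG : IsUnit G.det) (h : ∀ i j, G i j ≠ 0 → deg i + deg j = n) {j k : Fin μ}
    (hjk : G⁻¹ j k ≠ 0) : deg j + deg k = n := by
  classical
  let H : Matrix (Fin μ) (Fin μ) K :=
    Matrix.of fun j k => if deg j + deg k = n then G⁻¹ j k else 0
  have hGH : G * H = 1 := by
    ext i k
    rw [Matrix.mul_apply]
    by_cases hik : deg i = deg k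
    · rw [← Matrix.mul_nonsing_inv G hG, Matrix.mul_apply]
      refine Finset.sum_congr rfl fun j _ => ?_
      by_cases h0 : G i j = 0
      · rw [h0, zero_mul, zero_mul]
      · have := h i j h0
        simp only [H, Matrix.of_apply]
        rw [if_pos (by omega)]
    · rw [Matrix.one_apply_ne (by rintro rfl; exact hik rfl)]
      refine Finset.sum_eq_zero fun j _ => ?_
      by_cases h0 : G i j = 0
      · rw [h0, zero_mul]
      · have := h i j h0
        simp only [H, Matrix.of_apply]
        rw [if_neg (by omega), mul_zero]
  by_contra hne
  apply hjk
  rw [Matrix.inv_eq_right_inv hGH]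
  simp only [H, Matrix.of_apply]
  rw [if_neg hne]

variable (hF : IsFrame 𝒜 n Δ Tr deg G α)
include hF

theorem IsFrame.deltaL_eq_zero (i : Fin μ) : deltaL Δ (toLaurent (α i)) = 0 := by
  rw [deltaL_toLaurent, hF.closed, toLaurent_zero]

theorem IsFrame.coord_basis (i k : Fin μ) :
    coord Tr G α k (toLaurent (α i)) = if i = k then 1 else 0 := by
  have h : (G * G⁻¹) i k = (1 : Matrix (Fin μ) (Fin μ) K) i k := by
    rw [Matrix.mul_nonsing_inv G hF.det]
  rw [Matrix.mul_apply, Matrix.one_apply] at h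
  simp only [coord_apply, hF.pair, ← HahnSeries.C.map_mul]
  rw [← map_sum, h]
  split_ifs <;> simp

theorem IsFrame.coord_sum (c : Fin μ → LaurentSeries K) (k : Fin μ) :
    coord Tr G α k (∑ i, scal A (c i) * toLaurent (α i)) = c k := by
  simp only [map_sum, coord_scal_mul, hF.coord_basis, mul_ite, mul_one, mul_zero,
    Finset.sum_ite_eq', Finset.mem_univ, if_true]

variable [GradedAlgebra 𝒜]

theorem IsFrame.coord_deltaL (hTr : IsCyclicBV 𝒜 n Δ Tr) (k : Fin μ) (u : LaurentSeries A) :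
    coord Tr G α k (deltaL Δ u) = 0 := by
  rw [coord_apply]
  refine Finset.sum_eq_zero fun j _ => ?_
  rw [pairing_deltaL_left hTr (hF.deltaL_eq_zero j), zero_mul]

theorem IsFrame.coord_degree (hTr : IsCyclicBV 𝒜 n Δ Tr) {i : ℤ} {f : LaurentSeries A}
    (hf : HomL 𝒜 i f) (k : Fin μ) {m : ℤ} (hm : (coord Tr G α k f).coeff m ≠ 0) :
    deg k + 2 * m = i := by
  rw [coord_apply, HahnSeries.coeff_sum] at hm
  obtain ⟨j, -, hj⟩ := Finset.exists_ne_zero_of_sum_ne_zero hm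
  rw [mul_comm, HahnSeries.C_mul_eq_smul, HahnSeries.coeff_smul, smul_ne_zero_iff] at hj
  have h1 := pairing_degree hTr hf (hF.mem j) hj.2
  have h2 := inv_degree hF.det hF.degree hj.1
  omega

omit [GradedAlgebra 𝒜] in
theorem IsFrame.exists_expansion {f : LaurentSeries A} (hf : deltaL Δ f = 0) :
    ∃ (c : Fin μ → LaurentSeries K) (u : LaurentSeries A),
      f = ∑ i, scal A (c i) * toLaurent (α i) + deltaL Δ u := by
  obtain ⟨k, f, rfl⟩ := exists_eq_hbar_mul f
  rw [deltaL_hbar_mul_toLaurent] at hf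
  have hf : deltaPS Δ f = 0 := by
    apply toLaurent_injective
    have := congrArg (fun x => hbar A (-k) * x) hf
    simpa [hbar_mul_hbar_mul] using this
  obtain ⟨c, g, rfl⟩ := hF.span f hf
  refine ⟨fun i => hbar K k * toLaurent (c i), hbar A k * toLaurent g, ?_⟩
  rw [deltaL_hbar_mul_toLaurent, toLaurent_add, mul_add, toLaurent_sum, Finset.mul_sum]
  congr 1
  refine Finset.sum_congr rfl fun i _ => ?_
  rw [(scal A).map_mul, scal_hbar, scal_toLaurent, toLaurent_mul, mul_assoc]

theorem IsFrame.expansion (hTr : IsCyclicBV 𝒜 n Δ Tr) {f : LaurentSeries A}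
    (hf : deltaL Δ f = 0) :
    ∃ u, f = ∑ i, scal A (coord Tr G α i f) * toLaurent (α i) + deltaL Δ u := by
  obtain ⟨c, u, h⟩ := hF.exists_expansion hf
  refine ⟨u, ?_⟩
  have hc : ∀ i, coord Tr G α i f = c i := by
    intro i
    rw [h, map_add, hF.coord_deltaL hTr, add_zero, hF.coord_sum]
  simp only [hc]
  exact h

theorem IsFrame.exists_eq_deltaL (hTr : IsCyclicBV 𝒜 n Δ Tr) {f : LaurentSeries A}
    (hf : deltaL Δ f = 0) (h : ∀ k, coord Tr G α k f = 0) : ∃ u, f = deltaL Δ u := by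
  obtain ⟨u, hu⟩ := hF.expansion hTr hf
  refine ⟨u, ?_⟩
  simpa [h] using hu

/-- `H(A[[ħ]], Δ)` embeds into `H(A((ħ)), Δ)`. -/
theorem IsFrame.exists_eq_deltaPS (hTr : IsCyclicBV 𝒜 n Δ Tr) {f : PowerSeries A}
    (hf : deltaPS Δ f = 0) (h : ∀ k, coord Tr G α k (toLaurent f) = 0) :
    ∃ v, f = deltaPS Δ v := by
  obtain ⟨c, g, hg⟩ := hF.span f hf
  refine ⟨g, ?_⟩
  have hc : ∀ i, c i = 0 := by
    intro i
    apply toLaurent_injective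
    have h := h i
    rw [hg, toLaurent_add, toLaurent_sum, map_add, ← deltaL_toLaurent, hF.coord_deltaL hTr,
      add_zero] at h
    simp only [toLaurent_mul, ← scal_toLaurent] at h
    rw [hF.coord_sum fun i => toLaurent (c i)] at h
    rw [h, toLaurent_zero]
  simpa [hc] using hg

theorem IsFrame.isGoodBasis (hTr : IsCyclicBV 𝒜 n Δ Tr) : IsGoodBasis Δ Tr α where
  closed := hF.closed
  basis f hf := by
    obtain ⟨c, g, hg⟩ := hF.span f hf
    refine ⟨c, ⟨g, hg⟩, ?_⟩
    rintro c' ⟨g', hg'⟩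
    have key : ∀ (c : Fin μ → PowerSeries K) (g : PowerSeries A) (i : Fin μ),
        f = ∑ i, PowerSeries.map (algebraMap K A) (c i) * α i + deltaPS Δ g →
        toLaurent (c i) = coord Tr G α i (toLaurent f) := by
      intro c g i h
      rw [h, toLaurent_add, toLaurent_sum, map_add, ← deltaL_toLaurent, hF.coord_deltaL hTr,
        add_zero]
      simp only [toLaurent_mul, ← scal_toLaurent]
      rw [hF.coord_sum fun i => toLaurent (c i)]
    funext i
    exact toLaurent_injective ((key c' g' i hg').trans (key c g i hg).symm)
  good i j := by
    rw [hF.pair]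
    congr 1
    rw [← coeff_zero_pairP, ← coeff_toLaurent_natCast, ← pairing_toLaurent, hF.pair]
    simp [HahnSeries.C_apply]

omit [GradedAlgebra 𝒜] in
theorem IsFrame.coord_oppSpan {x : LaurentSeries A} (hx : x ∈ oppSpan K α) (k : Fin μ) {m : ℤ}
    (hm : 0 ≤ m) : (coord Tr G α k x).coeff m = 0 := by
  induction hx using Submodule.span_induction with
  | mem x hx =>
    obtain ⟨⟨i, j⟩, rfl⟩ := hx
    rw [coord_hbar_mul, hF.coord_basis, coeff_hbar_mul]
    split_ifs
    · rw [HahnSeries.coeff_one, if_neg (by simp; omega)]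
    · simp
  | zero => simp
  | add x y _ _ hx hy => rw [map_add, HahnSeries.coeff_add, hx, hy, add_zero]
  | smul c x _ hx => rw [coord_smul, HahnSeries.coeff_smul, hx, smul_zero]

omit [GradedAlgebra 𝒜] in
theorem IsFrame.deltaL_oppSpan {x : LaurentSeries A} (hx : x ∈ oppSpan K α) :
    deltaL Δ x = 0 := by
  induction hx using Submodule.span_induction with
  | mem x hx =>
    obtain ⟨⟨i, j⟩, rfl⟩ := hx
    rw [deltaL_hbar_mul, hF.deltaL_eq_zero, mul_zero]
  | zero => simp
  | add x y _ _ hx hy => rw [deltaL_add, hx, hy, add_zero]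
  | smul c x _ hx => rw [deltaL_smul, hx, smul_zero]

end Frame

section Split

variable {K A : Type*} [Field K] [Ring A] [Algebra K A] {μ : ℕ}

/-- The part of a Laurent series with nonnegative exponents. -/
def posPart (c : LaurentSeries K) : PowerSeries K := PowerSeries.mk fun n => c.coeff n

/-- Subtracting the part with nonnegative exponents leaves a polynomial in `ħ⁻¹`. -/
theorem scal_sub_posPart_mem (α : Fin μ → PowerSeries A) (i : Fin μ) (c : LaurentSeries K) :
    scal A (c - toLaurent (posPart c)) * toLaurent (α i) ∈ oppSpan K α := by
  obtain ⟨N, g, rfl⟩ := exists_shift c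
  have key : ∀ c : LaurentSeries K, (∀ n : ℤ, 0 ≤ n → c.coeff n = 0) →
      (∀ n : ℤ, n < -N → c.coeff n = 0) → c = ∑ j ∈ Finset.range N,
        c.coeff (-(j : ℤ) - 1) • hbar K (-(j : ℤ) - 1) := by
    intro c h0 h1
    ext n
    simp only [HahnSeries.coeff_sum, HahnSeries.coeff_smul, HahnSeries.coeff_single, smul_eq_mul,
      mul_ite, mul_one, mul_zero]
    by_cases hn : n < 0 ∧ -(N : ℤ) ≤ n
    · rw [Finset.sum_eq_single (-n - 1).toNat]
      · rw [if_pos (by omega)]; congr 1; omega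
      · intro j _ hj
        rw [if_neg (by omega)]
      · intro h; exact absurd (Finset.mem_range.mpr (by omega)) h
    · rw [Finset.sum_eq_zero]
      · by_cases h : 0 ≤ n
        · exact h0 n h
        · exact h1 n (by omega)
      · intro j hj
        have := Finset.mem_range.mp hj
        rw [if_neg (by omega)]
  rw [key (hbar K (-N) * toLaurent g - toLaurent (posPart (hbar K (-N) * toLaurent g)))]
  · rw [map_sum, Finset.sum_mul]
    refine Submodule.sum_mem _ fun j _ => ?_
    rw [← HahnSeries.C_mul_eq_smul, (scal A).map_mul, scal_hbar, mul_assoc, ← smul_eq_scal]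
    exact Submodule.smul_mem _ _ (Submodule.subset_span ⟨(i, j), rfl⟩)
  · intro n hn
    obtain ⟨n, rfl⟩ := Int.eq_ofNat_of_zero_le hn
    rw [HahnSeries.coeff_sub, coeff_toLaurent_natCast, posPart, PowerSeries.coeff_mk, sub_self]
  · intro n hn
    rw [HahnSeries.coeff_sub, coeff_hbar_mul, coeff_toLaurent_neg _ (by omega),
      coeff_toLaurent_neg _ (by omega), sub_self]

variable {𝒜 : ℤ → Submodule K A} {n : ℤ} {Δ : ℕ → A →ₗ[K] A} {Tr : A →ₗ[K] K}
  {deg : Fin μ → ℤ} {G : Matrix (Fin μ) (Fin μ) K} {α : Fin μ → PowerSeries A}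

/-- The span of the `ħ^{-k} α_i`, `k ≥ 1`, is isotropic for the residue pairing. -/
theorem IsFrame.isotropic (hF : IsFrame 𝒜 n Δ Tr deg G α) {x y : LaurentSeries A}
    (hx : x ∈ oppSpan K α) (hy : y ∈ oppSpan K α) : (pairing Tr x y).coeff (-1) = 0 := by
  induction hx using Submodule.span_induction with
  | zero => rw [pairing_zero_left, HahnSeries.coeff_zero]
  | add x x' _ _ hx hx' => rw [pairing_add_left, HahnSeries.coeff_add, hx, hx', add_zero]
  | smul c x _ hx => rw [smul_eq_scal, pairing_scal_left, coeff_C_mul, hx, mul_zero]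
  | mem x hx =>
    obtain ⟨⟨i, j⟩, rfl⟩ := hx
    induction hy using Submodule.span_induction with
    | zero => rw [pairing_zero_right, HahnSeries.coeff_zero]
    | add x x' _ _ hx hx' => rw [pairing_add_right, HahnSeries.coeff_add, hx, hx', add_zero]
    | smul c x _ hx => rw [smul_eq_scal, pairing_scal_right, bar_C, coeff_C_mul, hx, mul_zero]
    | mem y hy =>
      obtain ⟨⟨i', j'⟩, rfl⟩ := hy
      rw [pairing_hbar_left, pairing_hbar_right, coeff_hbar_mul, HahnSeries.coeff_smul,
        coeff_hbar_mul, hF.pair, HahnSeries.C_apply, HahnSeries.coeff_single_of_ne, smul_zero]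
      dsimp only
      omega

theorem IsFrame.isGoodOpposite [GradedAlgebra 𝒜] (hF : IsFrame 𝒜 n Δ Tr deg G α)
    (hTr : IsCyclicBV 𝒜 n Δ Tr) : IsGoodOpposite Δ Tr (oppSpan K α) where
  closed x hx := hF.deltaL_oppSpan hx
  hbar_inv x hx := by
    induction hx using Submodule.span_induction with
    | mem x hx =>
      obtain ⟨⟨i, j⟩, rfl⟩ := hx
      have hj : -1 + (-(j : ℤ) - 1) = -((j + 1 : ℕ) : ℤ) - 1 := by push_cast; ring
      rw [hbar_mul_hbar_mul, hj]
      exact Submodule.subset_span ⟨(i, j + 1), rfl⟩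
    | zero => rw [mul_zero]; exact zero_mem _
    | add x y _ _ hx hy => rw [mul_add]; exact add_mem hx hy
    | smul c x _ hx => rw [hbar_mul_smul]; exact Submodule.smul_mem _ _ hx
  sum f hf := by
    obtain ⟨u, hu⟩ := hF.expansion hTr hf
    refine ⟨∑ i, PowerSeries.map (algebraMap K A) (posPart (coord Tr G α i f)) * α i, ?_,
      ∑ i, scal A (coord Tr G α i f - toLaurent (posPart (coord Tr G α i f))) * toLaurent (α i),
      Submodule.sum_mem _ fun i _ => scal_sub_posPart_mem α i _, u, ?_⟩
    · rw [deltaPS_sum]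
      exact Finset.sum_eq_zero fun i _ => by rw [deltaPS_scalar_mul, hF.closed, mul_zero]
    · conv_lhs => rw [hu]
      congr 1
      rw [toLaurent_sum, ← Finset.sum_add_distrib]
      refine Finset.sum_congr rfl fun i _ => ?_
      rw [toLaurent_mul, ← scal_toLaurent, ← add_mul, ← map_add, add_sub_cancel]
  direct g hg x hx u h := by
    have key : ∀ k, coord Tr G α k (toLaurent g) = 0 := by
      intro k
      have h := congrArg (coord Tr G α k) h
      rw [map_add, hF.coord_deltaL hTr] at h
      obtain ⟨c, hc⟩ := exists_coord_toLaurent Tr G α k g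
      ext m
      rcases lt_or_ge m 0 with hm | hm
      · rw [hc, coeff_toLaurent_neg _ hm, HahnSeries.coeff_zero]
      · have h := congrArg (fun c => c.coeff m) h
        simpa only [HahnSeries.coeff_add, hF.coord_oppSpan hx k hm, add_zero] using h
    obtain ⟨v, hv⟩ := hF.exists_eq_deltaPS hTr hg key
    refine ⟨⟨v, hv⟩, u - toLaurent v, ?_⟩
    rw [deltaL_sub, deltaL_toLaurent, ← h, ← hv, add_sub_cancel_left]
  isotropic x hx y hy := hF.isotropic hx hy

end Split

/-! ### The frame given by the splitting -/

section Cohomology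

variable {K A : Type*} [Field K] [Ring A] [Algebra K A] {μ : ℕ}

open Finset.HasAntidiagonal (antidiagonal mem_antidiagonal)

/-- The projection of a graded algebra to its part of degree `i`. -/
def degPart (𝒜 : ℤ → Submodule K A) [GradedAlgebra 𝒜] (i : ℤ) : A →ₗ[K] A :=
  (𝒜 i).subtype ∘ₗ DirectSum.component K ℤ (fun i => 𝒜 i) i ∘ₗ
    (DirectSum.decomposeLinearEquiv 𝒜).toLinearMap

theorem degPart_mem (𝒜 : ℤ → Submodule K A) [GradedAlgebra 𝒜] (i : ℤ) (a : A) :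
    degPart 𝒜 i a ∈ 𝒜 i := SetLike.coe_mem _

theorem degPart_of_mem {𝒜 : ℤ → Submodule K A} [GradedAlgebra 𝒜] {i : ℤ} {a : A} (h : a ∈ 𝒜 i) :
    degPart 𝒜 i a = a := DirectSum.decompose_of_mem_same 𝒜 h

theorem degPart_of_mem_ne {𝒜 : ℤ → Submodule K A} [GradedAlgebra 𝒜] {i j : ℤ} {a : A}
    (h : a ∈ 𝒜 j) (hij : j ≠ i) : degPart 𝒜 i a = 0 := DirectSum.decompose_of_mem_ne 𝒜 h hij

/-- An operator of degree `e` shifts the projections by `e`. -/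
theorem map_degPart {𝒜 : ℤ → Submodule K A} [GradedAlgebra 𝒜] {T : A →ₗ[K] A} {e : ℤ}
    (h : ∀ i, ∀ a ∈ 𝒜 i, T a ∈ 𝒜 (i + e)) (i : ℤ) (a : A) :
    T (degPart 𝒜 i a) = degPart 𝒜 (i + e) (T a) := by
  induction a using DirectSum.Decomposition.inductionOn 𝒜 with
  | zero => simp
  | add x y hx hy => simp only [map_add, hx, hy]
  | @homogeneous j x =>
    by_cases hij : j = i
    · subst hij
      rw [degPart_of_mem x.2, degPart_of_mem (h _ _ x.2)]
    · rw [degPart_of_mem_ne x.2 hij, map_zero, degPart_of_mem_ne (h _ _ x.2) (by omega)]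

variable {𝒜 : ℤ → Submodule K A} [GradedAlgebra 𝒜] {n : ℤ} {Δ : ℕ → A →ₗ[K] A} {Tr : A →ₗ[K] K}
  {R : HomotopyRetract 𝒜 (Δ 0)} {a : Module.Basis (Fin μ) K (Coh (Δ 0))} {deg : Fin μ → ℤ}

omit [GradedAlgebra 𝒜] in
theorem retract_p_ι (R : HomotopyRetract 𝒜 (Δ 0)) (x : Coh (Δ 0)) : R.p (R.ι x) = x :=
  congrArg (fun f => f x) R.p_ι

omit [GradedAlgebra 𝒜] in
theorem retract_d_ι (R : HomotopyRetract 𝒜 (Δ 0)) (x : Coh (Δ 0)) : Δ 0 (R.ι x) = 0 :=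
  congrArg (fun f => f x) R.d_ι

omit [GradedAlgebra 𝒜] in
theorem retract_p_d (R : HomotopyRetract 𝒜 (Δ 0)) (x : A) : R.p (Δ 0 x) = 0 :=
  congrArg (fun f => f x) R.p_d

omit [GradedAlgebra 𝒜] in
theorem p_eq_cls (R : HomotopyRetract 𝒜 (Δ 0)) (z : LinearMap.ker (Δ 0)) :
    R.p z = cls (Δ 0) z := by
  obtain ⟨u, hu⟩ := R.ι_cls z
  have h := congrArg R.p hu
  rw [retract_p_d, map_sub, retract_p_ι] at h
  exact (sub_eq_zero.mp h.symm).symm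

omit [GradedAlgebra 𝒜] in
theorem exists_eq_ι_add (R : HomotopyRetract 𝒜 (Δ 0)) {z : A} (hz : Δ 0 z = 0) :
    ∃ u, z = R.ι (R.p z) + Δ 0 u := by
  obtain ⟨u, hu⟩ := R.ι_cls ⟨z, hz⟩
  rw [← p_eq_cls R] at hu
  exact ⟨-u, by rw [map_neg, hu]; simp⟩

theorem repr_degree (R : HomotopyRetract 𝒜 (Δ 0)) (ha : ∀ i, a i ∈ cohDeg 𝒜 (Δ 0) (deg i))
    {i : ℤ} {x : Coh (Δ 0)} (hx : x ∈ cohDeg 𝒜 (Δ 0) i) {k : Fin μ} (hk : a.repr x k ≠ 0) :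
    deg k = i := by
  by_contra hne
  have h1 := degPart_of_mem_ne (R.ι_degree i x hx) (Ne.symm hne)
  conv at h1 => lhs; rw [← a.sum_repr x, map_sum, map_sum]
  have h2 : ∀ j, degPart 𝒜 (deg k) (R.ι (a.repr x j • a j)) =
      R.ι ((if deg j = deg k then a.repr x j else 0) • a j) := by
    intro j
    rw [map_smul, map_smul, map_smul]
    split_ifs with h
    · rw [degPart_of_mem]
      rw [← h]; exact R.ι_degree _ _ (ha j)
    · rw [degPart_of_mem_ne (R.ι_degree _ _ (ha j)) h, smul_zero, zero_smul]
  simp only [h2] at h1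
  rw [← map_sum] at h1
  have h3 := congrArg R.p h1
  rw [retract_p_ι, map_zero] at h3
  have h4 := Fintype.linearIndependent_iff.mp a.linearIndependent _ h3 k
  rw [if_pos rfl] at h4
  exact hk h4

theorem trace_d_mul (hTr : IsCyclicBV 𝒜 n Δ Tr) (u : A) {w : A} (hw : Δ 0 w = 0) :
    Tr (Δ 0 u * w) = 0 := by
  rw [trace_adjoint hTr, hw, mul_zero, map_zero, smul_zero, neg_zero]

theorem parity_d (hΔ : IsCommBV 𝒜 Δ) (a : A) : parity 𝒜 (Δ 0 a) = -Δ 0 (parity 𝒜 a) := by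
  have h : ∀ i, ∀ a ∈ 𝒜 i, Δ 0 a ∈ 𝒜 (i + 1) := by
    intro i a ha
    simpa using hΔ.degree 0 i a ha
  rw [map_parity_of_degree h, sgn_odd odd_one, neg_one_smul]

theorem trace_mul_d (hΔ : IsCommBV 𝒜 Δ) (hTr : IsCyclicBV 𝒜 n Δ Tr) (u : A) {w : A}
    (hw : Δ 0 w = 0) : Tr (w * Δ 0 u) = 0 := by
  have h := trace_adjoint hTr 0 (parity 𝒜 w) u
  have h0 : Δ 0 (parity 𝒜 w) = 0 := by rw [← neg_eq_zero, ← parity_d hΔ, hw, map_zero]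
  rw [h0, zero_mul, map_zero, parity_parity, pow_zero, one_smul] at h
  exact neg_eq_zero.mp h.symm

/-- The pairing matrix of a basis of the cohomology. -/
def gram (Tr : A →ₗ[K] K) (R : HomotopyRetract 𝒜 (Δ 0))
    (a : Module.Basis (Fin μ) K (Coh (Δ 0))) : Matrix (Fin μ) (Fin μ) K :=
  Matrix.of fun i j => Tr (R.ι (a i) * R.ι (a j))

theorem trace_mul_eq_gram (hΔ : IsCommBV 𝒜 Δ) (hTr : IsCyclicBV 𝒜 n Δ Tr) (i j : Fin μ)
    (z w : LinearMap.ker (Δ 0)) (hz : cls (Δ 0) z = a i) (hw : cls (Δ 0) w = a j) :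
    gram Tr R a i j = Tr (z * w) := by
  obtain ⟨u, hu⟩ := R.ι_cls z
  obtain ⟨v, hv⟩ := R.ι_cls w
  rw [hz] at hu
  rw [hw] at hv
  rw [gram, Matrix.of_apply, ← sub_eq_zero, ← map_sub]
  have : R.ι (a i) * R.ι (a j) - z * w = Δ 0 u * R.ι (a j) + z * Δ 0 v := by
    rw [hu, hv]; simp only [sub_mul, mul_sub]; abel
  rw [this, map_add, trace_d_mul hTr _ (retract_d_ι R _), trace_mul_d hΔ hTr _ z.2, add_zero]

theorem gram_degree (hTr : IsCyclicBV 𝒜 n Δ Tr) (ha : ∀ i, a i ∈ cohDeg 𝒜 (Δ 0) (deg i))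
    (i j : Fin μ) (h : gram Tr R a i j ≠ 0) : deg i + deg j = n := by
  by_contra hne
  exact h (hTr.degree _ hne _ (SetLike.mul_mem_graded (R.ι_degree _ _ (ha i))
    (R.ι_degree _ _ (ha j))))

theorem gram_symm (hΔ : IsCommBV 𝒜 Δ) (ha : ∀ i, a i ∈ cohDeg 𝒜 (Δ 0) (deg i))
    (i j : Fin μ) : gram Tr R a i j = sgn (deg i * deg j) • gram Tr R a j i := by
  rw [gram, Matrix.of_apply, Matrix.of_apply, hΔ.graded_comm _ _ _ (R.ι_degree _ _ (ha i)) _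
    (R.ι_degree _ _ (ha j)), map_zsmul]

/-- Nondegeneracy of the pairing, which is given degree by degree. -/
theorem isUnit_det_gram (hΔ : IsCommBV 𝒜 Δ) (hTr : IsCyclicBV 𝒜 n Δ Tr)
    (ha : ∀ i, a i ∈ cohDeg 𝒜 (Δ 0) (deg i)) : IsUnit (gram Tr R a).det := by
  rw [isUnit_iff_ne_zero]
  intro h0
  obtain ⟨v, hv, hvG⟩ := Matrix.exists_vecMul_eq_zero_iff.mpr h0
  obtain ⟨k, hk⟩ := Function.ne_iff.mp hv
  -- the components of `v` in a single degree still give an element of the kernel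
  let w : Fin μ → K := fun i => if deg i = deg k then v i else 0
  have hw : ∀ j, ∑ i, w i * gram Tr R a i j = 0 := by
    intro j
    by_cases hj : deg k + deg j = n
    · have h1 := congrFun hvG j
      rw [Matrix.vecMul, dotProduct, Pi.zero_apply] at h1
      rw [← h1]
      refine Finset.sum_congr rfl fun i _ => ?_
      by_cases h : gram Tr R a i j = 0
      · rw [h, mul_zero, mul_zero]
      · have := gram_degree hTr ha i j h
        simp only [w]; rw [if_pos (by omega)]
    · refine Finset.sum_eq_zero fun i _ => ?_
      by_cases h : gram Tr R a i j = 0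
      · rw [h, mul_zero]
      · have := gram_degree hTr ha i j h
        simp only [w]; rw [if_neg (by omega), zero_mul]
  obtain ⟨x, hxw⟩ : ∃ x, x = ∑ i, w i • a i := ⟨_, rfl⟩
  have hx : R.ι x = ∑ i, w i • R.ι (a i) := by simp only [hxw, map_sum, map_smul]
  have hx1 : R.ι x ∈ 𝒜 (deg k) := by
    rw [hx]
    refine Submodule.sum_mem _ fun i _ => ?_
    by_cases h : deg i = deg k
    · rw [← h]; exact Submodule.smul_mem _ _ (R.ι_degree _ _ (ha i))
    · simp only [w]; rw [if_neg h, zero_smul]; exact zero_mem _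
  obtain ⟨u, hu⟩ := hTr.nondegenerate_left (deg k) (R.ι x) hx1 (retract_d_ι R x) (by
    intro b _ hb
    obtain ⟨u, hu⟩ := exists_eq_ι_add R hb
    rw [hu, mul_add, map_add, trace_mul_d hΔ hTr _ (retract_d_ι R x), add_zero,
      ← a.sum_repr (R.p b), map_sum R.ι, Finset.mul_sum, map_sum]
    refine Finset.sum_eq_zero fun j _ => ?_
    rw [map_smul, mul_smul_comm, map_smul, hx, Finset.sum_mul, map_sum]
    simp only [smul_mul_assoc, map_smul]
    have := hw j
    simp only [gram, Matrix.of_apply] at this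
    simp only [smul_eq_mul, this, mul_zero])
  have h3 := congrArg R.p hu
  rw [retract_p_d, retract_p_ι] at h3
  have h4 := Fintype.linearIndependent_iff.mp a.linearIndependent w (hxw.symm.trans h3.symm) k
  simp only [w, if_pos] at h4
  exact hk h4

theorem h_parity (R : HomotopyRetract 𝒜 (Δ 0)) (x : A) :
    R.h (parity 𝒜 x) = -parity 𝒜 (R.h x) := by
  have h : ∀ i, ∀ a ∈ 𝒜 i, R.h a ∈ 𝒜 (i + -1) := R.h_degree
  rw [map_parity_of_degree h, sgn_neg, sgn_odd odd_one, neg_one_smul, neg_neg]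

theorem trace_h_mul (hcompat : IsCompatible Tr R) (x y : A) :
    Tr (R.h x * y) = Tr (parity 𝒜 x * R.h y) := by
  induction x using DirectSum.Decomposition.inductionOn 𝒜 with
  | zero => simp
  | add x x' hx hx' => simp only [map_add, add_mul, hx, hx']
  | @homogeneous i x =>
    rw [hcompat i x x.2, parity_of_mem 𝒜 x.2, smul_mul_assoc, map_zsmul]

theorem trace_mul_h (hcompat : IsCompatible Tr R) {x : A} (hx : R.h x = 0) (y : A) :
    Tr (x * R.h y) = 0 := by
  have h := trace_h_mul hcompat (parity 𝒜 x) y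
  rw [h_parity, hx, map_zero, neg_zero, zero_mul, map_zero, parity_parity] at h
  exact h.symm

omit [GradedAlgebra 𝒜] in
theorem coeff_splitting_of_ne (x : Coh (Δ 0)) {k : ℕ} (hk : k ≠ 0) :
    PowerSeries.coeff k (splitting Δ R x) = R.h (wordSum Δ R.h k (R.ι x)) := by
  rw [splitting, PowerSeries.coeff_mk, if_neg hk]

omit [GradedAlgebra 𝒜] in
theorem h_coeff_splitting (x : Coh (Δ 0)) (k : ℕ) :
    R.h (PowerSeries.coeff k (splitting Δ R x)) = 0 := by
  rcases eq_or_ne k 0 with rfl | hk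
  · rw [coeff_zero_splitting]
    exact congrArg (fun f => f x) R.h_ι
  · rw [coeff_splitting_of_ne x hk]
    exact congrArg (fun f => f (wordSum Δ R.h k (R.ι x))) R.h_h

/-- The pairings of the sections `S x` are constant, since `h² = hι = 0` and `h` is selfadjoint. -/
theorem pairing_splitting (hcompat : IsCompatible Tr R) (x y : Coh (Δ 0)) :
    pairing Tr (toLaurent (splitting Δ R x)) (toLaurent (splitting Δ R y)) =
      HahnSeries.C (Tr (R.ι x * R.ι y)) := by
  rw [pairing_toLaurent, C_eq_toLaurent]
  congr 1
  ext k
  rw [coeff_pairP, PowerSeries.coeff_C]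
  split_ifs with hk
  · subst hk
    simp [coeff_zero_splitting]
  · refine Finset.sum_eq_zero fun q hq => ?_
    have hq := mem_antidiagonal.mp hq
    by_cases h2 : q.2 = 0
    · have h1 : q.1 ≠ 0 := by omega
      rw [coeff_splitting_of_ne x h1, trace_h_mul hcompat, h_coeff_splitting, mul_zero, map_zero,
        smul_zero]
    · rw [coeff_splitting_of_ne y h2, trace_mul_h hcompat (h_coeff_splitting x _), smul_zero]

theorem isFrame_splitting (hΔ : IsCommBV 𝒜 Δ) (hTr : IsCyclicBV 𝒜 n Δ Tr)
    (hR : IsHodgeDeRham Δ R) (hcompat : IsCompatible Tr R)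
    (ha : ∀ i, a i ∈ cohDeg 𝒜 (Δ 0) (deg i)) :
    IsFrame 𝒜 n Δ Tr deg (gram Tr R a) (fun i => splitting Δ R (a i)) where
  closed _ := deltaPS_splitting hΔ hR _
  mem i := homL_toLaurent.mpr fun k => splitting_mem hΔ (ha i) k
  pair _ _ := pairing_splitting hcompat _ _
  span _ hf := exists_splitting_expansion hΔ a hf
  det := isUnit_det_gram hΔ hTr ha
  symm := gram_symm hΔ ha
  degree := gram_degree hTr ha

/-- Closed elements with the same pairings as a frame form a frame: their coefficient matrix `U(ħ)`
satisfies `U(ħ) G U(-ħ)ᵀ = G`, so that it is invertible at `ħ = 0`. -/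
theorem IsFrame.of_pairing {G : Matrix (Fin μ) (Fin μ) K} {β α : Fin μ → PowerSeries A}
    (hΔ : IsCommBV 𝒜 Δ) (hTr : IsCyclicBV 𝒜 n Δ Tr) (hF : IsFrame 𝒜 n Δ Tr deg G β)
    (closed : ∀ i, deltaPS Δ (α i) = 0) (mem : ∀ i, HomL 𝒜 (deg i) (toLaurent (α i)))
    (pair : ∀ i j, pairing Tr (toLaurent (α i)) (toLaurent (α j)) = HahnSeries.C (G i j)) :
    IsFrame 𝒜 n Δ Tr deg G α where
  closed := closed
  mem := mem
  pair := pair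
  det := hF.det
  symm := hF.symm
  degree := hF.degree
  span := by
    choose U g hU using fun i => hF.span (α i) (closed i)
    let M : Matrix (Fin μ) (Fin μ) (PowerSeries K) := Matrix.of U
    have hL : ∀ i, toLaurent (α i) =
        ∑ k, scal A (toLaurent (U i k)) * toLaurent (β k) + deltaL Δ (toLaurent (g i)) := by
      intro i
      conv_lhs => rw [hU i, toLaurent_add, toLaurent_sum, ← deltaL_toLaurent]
      simp only [toLaurent_mul, ← scal_toLaurent]
    have hcl : ∀ i, deltaL Δ (∑ k, scal A (toLaurent (U i k)) * toLaurent (β k)) = 0 := by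
      intro i
      rw [deltaL_sum]
      exact Finset.sum_eq_zero fun k _ => by
        rw [deltaL_scal_mul, hF.deltaL_eq_zero, mul_zero]
    have hcl' : ∀ i, deltaL Δ (toLaurent (α i)) = 0 := fun i => by
      rw [deltaL_toLaurent, closed, toLaurent_zero]
    have hG : ∀ i j, PowerSeries.C (G i j) =
        ∑ k, ∑ l, U i k * (barP (U j l) * PowerSeries.C (G k l)) := by
      intro i j
      apply toLaurent_injective
      rw [← C_eq_toLaurent, ← pair i j]
      conv_lhs => rw [hL i]
      rw [pairing_add_left, pairing_deltaL_left hTr (hcl' j), add_zero, hL j, pairing_add_right,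
        pairing_deltaL_right hTr hΔ (hcl i), add_zero, pairing_sum_left, toLaurent_sum]
      refine Finset.sum_congr rfl fun k _ => ?_
      rw [pairing_sum_right, toLaurent_sum]
      refine Finset.sum_congr rfl fun l _ => ?_
      rw [pairing_scal_left, pairing_scal_right, hF.pair, bar_toLaurent, toLaurent_mul,
        toLaurent_mul, C_eq_toLaurent]
    let M0 : Matrix (Fin μ) (Fin μ) K := M.map PowerSeries.constantCoeff
    have hM0 : M0 * G * M0.transpose = G := by
      ext i j
      have h := congrArg PowerSeries.constantCoeff (hG i j)
      rw [PowerSeries.constantCoeff_C] at h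
      rw [h, Matrix.mul_apply]
      simp only [Matrix.mul_apply, map_sum, map_mul, PowerSeries.constantCoeff_C,
        Matrix.transpose_apply, Finset.sum_mul]
      rw [Finset.sum_comm]
      refine Finset.sum_congr rfl fun k _ => Finset.sum_congr rfl fun l _ => ?_
      have : PowerSeries.constantCoeff (barP (U j l)) = PowerSeries.constantCoeff (U j l) := by
        rw [← PowerSeries.coeff_zero_eq_constantCoeff_apply, barP, PowerSeries.coeff_mk,
          PowerSeries.coeff_zero_eq_constantCoeff_apply, pow_zero, one_smul]
      rw [this]
      simp only [M0, M, Matrix.map_apply, Matrix.of_apply]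
      ring
    have hdet : IsUnit M.det := by
      rw [PowerSeries.isUnit_iff_constantCoeff, RingHom.map_det, isUnit_iff_ne_zero]
      intro h0
      have h1 : M0.det = 0 := h0
      have h2 := congrArg Matrix.det hM0
      rw [Matrix.det_mul, Matrix.det_mul, h1, zero_mul, zero_mul] at h2
      exact hF.det.ne_zero h2.symm
    have hinv : ∀ i, ∃ v, β i = ∑ j, PowerSeries.map (algebraMap K A) (M⁻¹ i j) * α j +
        deltaPS Δ v := by
      intro i
      refine ⟨-∑ j, PowerSeries.map (algebraMap K A) (M⁻¹ i j) * g j, ?_⟩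
      rw [deltaPS_neg, deltaPS_sum]
      simp only [deltaPS_scalar_mul]
      rw [← sub_eq_add_neg, ← Finset.sum_sub_distrib]
      simp only [← mul_sub]
      have h1 : ∀ j, α j - deltaPS Δ (g j) =
          ∑ k, PowerSeries.map (algebraMap K A) (U j k) * β k := fun j => by
        conv_lhs => rw [hU j]
        rw [add_sub_cancel_right]
      simp only [h1, Finset.mul_sum, ← mul_assoc, ← map_mul]
      rw [Finset.sum_comm]
      simp only [← Finset.sum_mul, ← map_sum]
      have h2 : ∀ k, ∑ j, M⁻¹ i j * U j k = (1 : Matrix (Fin μ) (Fin μ) (PowerSeries K)) i k := by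
        intro k
        rw [← Matrix.nonsing_inv_mul M hdet, Matrix.mul_apply]
        rfl
      simp [h2, Matrix.one_apply]
    choose v hv using hinv
    intro f hf
    obtain ⟨c, w, hw⟩ := hF.span f hf
    refine ⟨fun j => ∑ i, c i * M⁻¹ i j,
      w + ∑ i, PowerSeries.map (algebraMap K A) (c i) * v i, ?_⟩
    rw [deltaPS_add, deltaPS_sum, hw]
    simp only [deltaPS_scalar_mul, map_sum, Finset.sum_mul]
    rw [Finset.sum_comm, add_comm (deltaPS Δ w), ← add_assoc, ← Finset.sum_add_distrib]
    congr 1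
    refine Finset.sum_congr rfl fun i _ => ?_
    conv_lhs => rw [hv i, mul_add, Finset.mul_sum]
    congr 1
    exact Finset.sum_congr rfl fun j _ => by rw [map_mul, mul_assoc]

end Cohomology

/-! ### A frame containing the unit -/

section UnitFrame

variable {K A : Type*} [Field K] [Ring A] [Algebra K A] {μ : ℕ}

open Finset.HasAntidiagonal (antidiagonal mem_antidiagonal)

theorem map_C_mul (c : K) (f : PowerSeries A) :
    PowerSeries.map (algebraMap K A) (PowerSeries.C c) * f = c • f := by
  ext k
  rw [PowerSeries.map_C, PowerSeries.coeff_C_mul, PowerSeries.coeff_smul, Algebra.smul_def]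

theorem homL_map_mul {𝒜 : ℤ → Submodule K A} {i j : ℤ} {c : PowerSeries K} {f : PowerSeries A}
    (hc : ∀ k : ℕ, PowerSeries.coeff k c ≠ 0 → j + 2 * k = i) (hf : HomL 𝒜 j (toLaurent f)) :
    HomL 𝒜 i (toLaurent (PowerSeries.map (algebraMap K A) c * f)) := by
  rw [toLaurent_mul, ← scal_toLaurent]
  refine HomL.scal_mul (fun k hk => ?_) hf
  rcases lt_or_ge k 0 with h | h
  · exact absurd (coeff_toLaurent_neg _ h) hk
  · obtain ⟨k, rfl⟩ := Int.eq_ofNat_of_zero_le h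
    rw [coeff_toLaurent_natCast] at hk
    exact hc k hk

variable {𝒜 : ℤ → Submodule K A} [GradedAlgebra 𝒜] {n : ℤ} {Δ : ℕ → A →ₗ[K] A} {Tr : A →ₗ[K] K}
  {R : HomotopyRetract 𝒜 (Δ 0)} {a : Module.Basis (Fin μ) K (Coh (Δ 0))} {deg : Fin μ → ℤ}

theorem d_mul_of_closed (hΔ : IsCommBV 𝒜 Δ) (u : A) {z : A} (hz : Δ 0 z = 0) :
    Δ 0 (u * z) = Δ 0 u * z := by
  induction u using DirectSum.Decomposition.inductionOn 𝒜 with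
  | zero => simp
  | add x x' hx hx' => simp only [map_add, add_mul, hx, hx']
  | @homogeneous i x => rw [hΔ.leibniz i x x.2, hz, mul_zero, smul_zero, add_zero]

/-- If the unit is exact, the cohomology vanishes. -/
theorem eq_zero_of_p_one (hΔ : IsCommBV 𝒜 Δ) (h : R.p 1 = 0) (x : Coh (Δ 0)) : x = 0 := by
  obtain ⟨u, hu⟩ := exists_eq_ι_add R (hΔ.map_one 0)
  rw [h, map_zero, zero_add] at hu
  rw [← retract_p_ι R x, ← one_mul (R.ι x), hu, ← d_mul_of_closed hΔ u (retract_d_ι R x),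
    retract_p_d]

omit [GradedAlgebra 𝒜] in
theorem sum_smul_splitting (a : Module.Basis (Fin μ) K (Coh (Δ 0))) (x : Coh (Δ 0)) :
    ∑ i, a.repr x i • splitting Δ R (a i) = splitting Δ R x := by
  rw [← splitting_smul_sum, a.sum_repr]

theorem coeff_pairP_ne (hTr : IsCyclicBV 𝒜 n Δ Tr) {i j : ℤ} {f g : PowerSeries A}
    (hf : HomL 𝒜 i (toLaurent f)) (hg : HomL 𝒜 j (toLaurent g)) {k : ℕ}
    (hk : PowerSeries.coeff k (pairP Tr f g) ≠ 0) : i + j - 2 * k = n := by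
  rw [← coeff_toLaurent_natCast, ← pairing_toLaurent] at hk
  exact pairing_degree hTr hf hg hk

theorem homL_one : HomL 𝒜 0 (toLaurent (1 : PowerSeries A)) :=
  homL_toLaurent.mpr fun k => by
    rw [PowerSeries.coeff_one]
    split_ifs with h
    · subst h; exact (SetLike.GradedOne.one_mem : (1 : A) ∈ 𝒜 0)
    · exact zero_mem _

/-- There is a frame lifting the given basis of the cohomology which expresses the class of the unit
of `A` with constant coefficients. If the splitting does not send `[1]` to the class of `1`, it is
composed with an isometry moving `S [1]` to `1`, namely an Eichler transformation: let `F = S f`,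
where `f` has degree `n` and `(1, f) = 1`, and `V = 1 - S [1]`. These are orthogonal, and one of them
is isotropic for degree reasons. With `g = K(F, F)` and `c = K(S [1], V)`, the isometry is
`x ↦ x + K(x, F) V - K(x, V) F - (g / 2) K(x, V) V + c K(x, F) F`. -/
theorem exists_frame [CharZero K] (hΔ : IsCommBV 𝒜 Δ) (hTr : IsCyclicBV 𝒜 n Δ Tr)
    (hR : IsHodgeDeRham Δ R) (hcompat : IsCompatible Tr R)
    (ha : ∀ i, a i ∈ cohDeg 𝒜 (Δ 0) (deg i)) :
    ∃ α : Fin μ → PowerSeries A, IsFrame 𝒜 n Δ Tr deg (gram Tr R a) α ∧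
      (∃ g, ∑ i, a.repr (R.p 1) i • α i = 1 + deltaPS Δ g) ∧
      (∀ i, ∃ u, PowerSeries.coeff 0 (α i) = R.ι (a i) + Δ 0 u) ∧
      ((∃ g, splitting Δ R (R.p 1) = 1 + deltaPS Δ g) → ∀ i, α i = splitting Δ R (a i)) := by
  have hF := isFrame_splitting hΔ hTr hR hcompat ha
  by_cases h1 : ∃ g, splitting Δ R (R.p 1) = 1 + deltaPS Δ g
  · exact ⟨_, hF, by rwa [sum_smul_splitting],
      fun i => ⟨0, by rw [coeff_zero_splitting, map_zero, add_zero]⟩, fun _ _ => rfl⟩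
  have hfun : ∀ α : Fin μ → PowerSeries A, (∃ g, splitting Δ R (R.p 1) = 1 + deltaPS Δ g) →
      ∀ i, α i = splitting Δ R (a i) := fun α h => absurd h h1
  set e := a.repr (R.p 1) with he
  have hunit : R.p 1 ∈ cohDeg 𝒜 (Δ 0) 0 := R.p_degree 0 1 SetLike.GradedOne.one_mem
  have hedeg : ∀ i, e i ≠ 0 → deg i = 0 := fun i hi => repr_degree R ha hunit hi
  by_cases hj : ∃ j, ∑ i, e i * gram Tr R a i j ≠ 0
  swap
  · -- then `[1] = 0`, so that the cohomology vanishes and the frame is empty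
    push Not at hj
    have he0 : (e : Fin μ → K) = 0 := by
      by_contra hne
      exact hF.det.ne_zero (Matrix.exists_vecMul_eq_zero_iff.mp
        ⟨e, hne, funext fun j => hj j⟩)
    have hp : R.p 1 = 0 := by
      rw [← a.sum_repr (R.p 1)]
      exact Finset.sum_eq_zero fun i _ => by rw [← he, congrFun he0 i, Pi.zero_apply, zero_smul]
    obtain ⟨c, g, hg⟩ := hF.span 1 (deltaPS_one hΔ)
    have hμ : IsEmpty (Fin μ) := ⟨fun i => a.ne_zero i (eq_zero_of_p_one hΔ hp _)⟩
    rw [Finset.univ_eq_empty, Finset.sum_empty, zero_add] at hg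
    refine ⟨_, hF, ⟨-g, ?_⟩, fun i => (hμ.false i).elim, hfun _⟩
    rw [Finset.univ_eq_empty, Finset.sum_empty, deltaPS_neg, ← hg, add_neg_cancel]
  obtain ⟨j₀, hj₀⟩ := hj
  obtain ⟨i₀, -, hi₀⟩ := Finset.exists_ne_zero_of_sum_ne_zero hj₀
  have hj₀n : deg j₀ = n := by
    have h1 := hedeg i₀ (left_ne_zero_of_mul hi₀)
    have h2 := hF.degree i₀ j₀ (right_ne_zero_of_mul hi₀)
    omega
  set l := (∑ i, e i * gram Tr R a i j₀)⁻¹ with hl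
  let p : Fin μ → K := fun i => l * gram Tr R a i j₀
  let g : K := l * l * gram Tr R a j₀ j₀
  let E : PowerSeries A := splitting Δ R (R.p 1)
  let V : PowerSeries A := 1 - E
  let F : PowerSeries A := splitting Δ R (l • a j₀)
  let q : Fin μ → PowerSeries K := fun i => pairP Tr (splitting Δ R (a i)) V
  let c : PowerSeries K := pairP Tr E V
  -- the image of `S (a i)` is `S (a i) + x i * V + y i * F`
  let x : Fin μ → PowerSeries K := fun i => PowerSeries.C (p i) - PowerSeries.C (g / 2) * q i
  let y : Fin μ → PowerSeries K := fun i => c * PowerSeries.C (p i) - q i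
  have hp : ∀ i, p i ≠ 0 → deg i = 0 := fun i hi => by
    have := hF.degree i j₀ (right_ne_zero_of_mul hi)
    omega
  have hg : g ≠ 0 → n = 0 := fun h => by
    have := hF.degree j₀ j₀ (right_ne_zero_of_mul h)
    omega
  -- closedness and degrees of `E`, `V` and `F`
  have hEc : deltaPS Δ E = 0 := deltaPS_splitting hΔ hR _
  have hVc : deltaPS Δ V = 0 := by rw [deltaPS_sub, hEc, deltaPS_one hΔ, sub_zero]
  have hFc : deltaPS Δ F = 0 := deltaPS_splitting hΔ hR _
  have hEd : HomL 𝒜 0 (toLaurent E) := homL_toLaurent.mpr fun k => splitting_mem hΔ hunit k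
  have hVd : HomL 𝒜 0 (toLaurent V) := by
    rw [toLaurent_sub]; exact homL_one.sub hEd
  have hFd : HomL 𝒜 n (toLaurent F) := homL_toLaurent.mpr fun k =>
    splitting_mem hΔ (Submodule.smul_mem _ l (hj₀n ▸ ha j₀)) k
  obtain ⟨v, hv⟩ := exists_eq_ι_add R (hΔ.map_one 0)
  have hV0 : PowerSeries.coeff 0 V = Δ 0 v := by
    rw [map_sub, coeff_zero_splitting, PowerSeries.coeff_zero_one, sub_eq_iff_eq_add', ← hv]
  have hq0 : ∀ i, PowerSeries.coeff 0 (q i) = 0 := fun i => by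
    rw [coeff_zero_pairP, hV0, coeff_zero_splitting, trace_mul_d hΔ hTr _ (retract_d_ι R _)]
  have hc0 : PowerSeries.coeff 0 c = 0 := by
    rw [coeff_zero_pairP, hV0, coeff_zero_splitting, trace_mul_d hΔ hTr _ (retract_d_ι R _)]
  have hq : ∀ i k, PowerSeries.coeff k (q i) ≠ 0 → n + 2 * k = deg i := fun i k hk => by
    have := coeff_pairP_ne hTr (hF.mem i) hVd hk
    omega
  have hc : ∀ k, PowerSeries.coeff k c ≠ 0 → n + 2 * k = 0 := fun k hk => by
    have := coeff_pairP_ne hTr hEd hVd hk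
    omega
  -- if `g ≠ 0` then `n = 0`, and `c` is a constant, hence zero
  have hgc : PowerSeries.C g * c = 0 := by
    ext k
    rw [PowerSeries.coeff_C_mul, map_zero]
    by_contra h
    have h1 := hc k (right_ne_zero_of_mul h)
    have h2 := hg (left_ne_zero_of_mul h)
    have h3 : k = 0 := by omega
    exact right_ne_zero_of_mul h (h3 ▸ hc0)
  -- the values of the pairing
  have hSV : ∀ i, pairing Tr (toLaurent (splitting Δ R (a i))) (toLaurent V) =
      toLaurent (q i) := fun i => pairing_toLaurent _ _ _
  have hSF : ∀ i, pairing Tr (toLaurent (splitting Δ R (a i))) (toLaurent F) =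
      HahnSeries.C (p i) := fun i => by
    rw [pairing_splitting hcompat, map_smul, mul_smul_comm, map_smul]; rfl
  have hVS : ∀ j, pairing Tr (toLaurent V) (toLaurent (splitting Δ R (a j))) =
      bar (toLaurent (q j)) := fun j => by
    rw [pairing_swap hΔ (hF.mem j) hVd, mul_zero, sgn_zero, one_smul, hSV]
  have hFS : ∀ j, pairing Tr (toLaurent F) (toLaurent (splitting Δ R (a j))) =
      HahnSeries.C (p j) := fun j => by
    rw [pairing_swap hΔ (hF.mem j) hFd, hSF, bar_C]
    by_cases hpj : p j = 0
    · rw [hpj, map_zero, smul_zero]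
    · rw [hp j hpj, zero_mul, sgn_zero, one_smul]
  have hFF : pairing Tr (toLaurent F) (toLaurent F) = HahnSeries.C g := by
    rw [pairing_splitting hcompat, map_smul, mul_smul_comm, Tr.map_smul, smul_mul_assoc,
      Tr.map_smul, smul_smul]; rfl
  have hFV : pairing Tr (toLaurent F) (toLaurent V) = 0 := by
    rw [pairing_toLaurent, ← toLaurent_zero]
    congr 1
    ext k
    rw [map_zero]
    by_contra h
    have h1 := coeff_pairP_ne hTr hFd hVd h
    have h2 : k = 0 := by omega
    apply h
    rw [h2, coeff_zero_pairP, hV0, coeff_zero_splitting, trace_mul_d hΔ hTr _ (retract_d_ι R _)]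
  have hVF : pairing Tr (toLaurent V) (toLaurent F) = 0 := by
    rw [pairing_swap hΔ hFd hVd, hFV, ← barHom_apply, map_zero, smul_zero]
  -- from `K(1, 1) = K(S [1], S [1])`
  have hVV : pairing Tr (toLaurent V) (toLaurent V) =
      -(toLaurent c + bar (toLaurent c)) := by
    have h1 : toLaurent c = pairing Tr (toLaurent E) (toLaurent V) := (pairing_toLaurent _ _ _).symm
    have h2 : bar (toLaurent c) = pairing Tr (toLaurent V) (toLaurent E) := by
      rw [h1, pairing_swap hΔ hEd hVd, mul_zero, sgn_zero, one_smul]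
    have h3 : pairing Tr (toLaurent E) (toLaurent E) =
        pairing Tr (toLaurent 1) (toLaurent 1) := by
      have hone : pairing Tr (toLaurent (1 : PowerSeries A)) (toLaurent (1 : PowerSeries A)) =
          HahnSeries.C (Tr (1 * 1)) := by
        rw [pairing_eq, bar_toLaurent, ← toLaurent_mul, C_eq_toLaurent]
        ext m
        have hbar : barP (1 : PowerSeries A) = 1 := by
          ext k; rw [barP, PowerSeries.coeff_mk, PowerSeries.coeff_one]
          split_ifs with h
          · rw [h, pow_zero, one_smul]
          · rw [smul_zero]
        rw [coeff_trL, hbar, mul_one, toLaurent_one, ← C_eq_toLaurent, HahnSeries.coeff_one,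
          HahnSeries.C_apply, HahnSeries.coeff_single, mul_one]
        split_ifs with h
        · rfl
        · rw [map_zero]
      rw [hone, pairing_splitting hcompat]
      congr 1
      conv_rhs => rw [hv]
      rw [mul_add, map_add, trace_mul_d hΔ hTr _ (by rw [← hv, hΔ.map_one]), add_mul, map_add,
        trace_d_mul hTr _ (retract_d_ι R _), add_zero, add_zero]
    rw [h2, h1, toLaurent_sub]
    simp only [pairing_sub_left, pairing_sub_right, h3]
    ring
  have hgcL : (HahnSeries.C g : LaurentSeries K) * toLaurent c = 0 := by
    rw [C_eq_toLaurent, ← toLaurent_mul, hgc, toLaurent_zero]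
  have hgcB : (HahnSeries.C g : LaurentSeries K) * bar (toLaurent c) = 0 := by
    rw [← bar_C, ← bar_mul, hgcL, ← barHom_apply, map_zero]
  let α : Fin μ → PowerSeries A := fun i => splitting Δ R (a i) +
    PowerSeries.map (algebraMap K A) (x i) * V + PowerSeries.map (algebraMap K A) (y i) * F
  have hα : ∀ i, toLaurent (α i) = toLaurent (splitting Δ R (a i)) +
      scal A (toLaurent (x i)) * toLaurent V + scal A (toLaurent (y i)) * toLaurent F := fun i => by
    rw [toLaurent_add, toLaurent_add, toLaurent_mul, toLaurent_mul, scal_toLaurent, scal_toLaurent]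
  refine ⟨α, hF.of_pairing hΔ hTr (fun i => ?_) (fun i => ?_) (fun i j => ?_), ⟨0, ?_⟩,
    fun i => ⟨PowerSeries.coeff 0 (x i) • v, ?_⟩, hfun _⟩
  · rw [deltaPS_add, deltaPS_add, deltaPS_scalar_mul, deltaPS_scalar_mul, hVc, hFc,
      deltaPS_splitting hΔ hR, mul_zero, mul_zero, add_zero, add_zero]
  · rw [toLaurent_add, toLaurent_add]
    refine ((hF.mem i).add (homL_map_mul (fun k hk => ?_) hVd)).add
      (homL_map_mul (fun k hk => ?_) hFd)
    · simp only [x, map_sub, PowerSeries.coeff_C, PowerSeries.coeff_C_mul] at hk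
      by_cases h : g / 2 * PowerSeries.coeff k (q i) = 0
      · rw [h, sub_zero] at hk
        split_ifs at hk with hk0
        · rw [hp i hk, hk0]; simp
        · exact absurd rfl hk
      · have h1 := hq i k (right_ne_zero_of_mul h)
        have h2 := hg (fun h0 => left_ne_zero_of_mul h (by rw [h0, zero_div]))
        omega
    · simp only [y, map_sub, PowerSeries.coeff_mul_C] at hk
      by_cases h : PowerSeries.coeff k (q i) = 0
      · rw [h, sub_zero] at hk
        have h1 := hc k (left_ne_zero_of_mul hk)
        have h2 := hp i (right_ne_zero_of_mul hk)
        omega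
      · exact hq i k h
  · rw [hα, hα]
    simp only [pairing_add_left, pairing_add_right, pairing_scal_left, pairing_scal_right, hSV,
      hSF, hVS, hFS, hFF, hFV, hVF, hVV, hF.pair]
    have hx : ∀ i, toLaurent (x i) =
        HahnSeries.C (p i) - HahnSeries.C (g / 2) * toLaurent (q i) := fun i => by
      rw [toLaurent_sub, toLaurent_mul, ← C_eq_toLaurent, ← C_eq_toLaurent]
    have hy : ∀ i, toLaurent (y i) = toLaurent c * HahnSeries.C (p i) - toLaurent (q i) :=
      fun i => by rw [toLaurent_sub, toLaurent_mul, ← C_eq_toLaurent]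
    have hg2 : (HahnSeries.C g : LaurentSeries K) = 2 * HahnSeries.C (g / 2) := by
      rw [two_mul, ← map_add, add_halves]
    have hgcL' : (HahnSeries.C (g / 2) : LaurentSeries K) * toLaurent c = 0 := by
      rw [div_eq_inv_mul, map_mul, mul_assoc, hgcL, mul_zero]
    have hgcB' : (HahnSeries.C (g / 2) : LaurentSeries K) * bar (toLaurent c) = 0 := by
      rw [div_eq_inv_mul, map_mul, mul_assoc, hgcB, mul_zero]
    simp only [hx, hy, ← barHom_apply, map_sub, map_mul]
    simp only [barHom_apply, bar_C, hg2]
    generalize bar (toLaurent c) = cb at *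
    generalize toLaurent c = cc at *
    generalize toLaurent (q i) = qi at *
    generalize bar (toLaurent (q j)) = qj at *
    generalize (HahnSeries.C (g / 2) : LaurentSeries K) = gg at *
    generalize (HahnSeries.C (p i) : LaurentSeries K) = pi at *
    generalize (HahnSeries.C (p j) : LaurentSeries K) = pj at *
    linear_combination (qi * pj - gg * qi * qj + pi * qj + 2 * pi * pj * cb - 2 * pi * qj) * hgcL' + (qi * pj - gg * qi * qj + pi * qj - 2 * qi * pj) * hgcB'
  · have hep : ∑ i, e i * p i = 1 := by
      rw [← inv_mul_cancel₀ hj₀, Finset.mul_sum]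
      exact Finset.sum_congr rfl fun i _ => mul_left_comm _ _ _
    have heq : ∑ i, e i • q i = c := by
      apply toLaurent_injective
      rw [← pairing_toLaurent, toLaurent_sum]
      simp only [E]
      rw [← sum_smul_splitting a (R.p 1), toLaurent_sum, pairing_sum_left]
      refine Finset.sum_congr rfl fun i _ => ?_
      rw [← map_C_mul (A := A), toLaurent_mul, ← scal_toLaurent, pairing_scal_left, hSV,
        ← toLaurent_mul, PowerSeries.smul_eq_C_mul]
    have hsx : ∑ i, e i • x i = 1 := by
      simp only [x, smul_sub, Finset.sum_sub_distrib]
      have h1 : ∑ i, e i • PowerSeries.C (p i) = (1 : PowerSeries K) := by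
        simp only [PowerSeries.smul_eq_C_mul, ← map_mul, ← map_sum, hep, map_one]
      have h2 : ∑ i, e i • (PowerSeries.C (g / 2) * q i) = 0 := by
        simp only [← mul_smul_comm, ← Finset.mul_sum, heq]
        rw [div_eq_inv_mul, map_mul, mul_assoc, hgc, mul_zero]
      rw [h1, h2, sub_zero]
    have hsy : ∑ i, e i • y i = 0 := by
      simp only [y, smul_sub, Finset.sum_sub_distrib, heq]
      have h1 : ∑ i, e i • (c * PowerSeries.C (p i)) = c := by
        simp only [← mul_smul_comm, ← Finset.mul_sum]
        simp only [PowerSeries.smul_eq_C_mul, ← map_mul, ← map_sum, hep, map_one, mul_one]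
      rw [h1, sub_self]
    have hmap : ∀ (i : Fin μ) (z : PowerSeries K) (W : PowerSeries A),
        e i • (PowerSeries.map (algebraMap K A) z * W) =
        PowerSeries.map (algebraMap K A) (e i • z) * W := fun i z W => by
      rw [← map_C_mul, ← mul_assoc, ← map_mul, PowerSeries.smul_eq_C_mul]
    simp only [α, smul_add, Finset.sum_add_distrib, hmap, ← Finset.sum_mul, ← map_sum, hsx, hsy]
    rw [sum_smul_splitting, (PowerSeries.map (algebraMap K A)).map_one, one_mul, map_zero, zero_mul,
      deltaPS_zero]
    simp only [V, E]
    abel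
  · have hy0 : PowerSeries.coeff 0 (y i) = 0 := by
      simp only [y, map_sub, PowerSeries.coeff_mul_C, hq0, hc0, zero_mul, sub_zero]
    have h0 : ∀ (z : PowerSeries K) (W : PowerSeries A),
        PowerSeries.coeff 0 (PowerSeries.map (algebraMap K A) z * W) =
        PowerSeries.coeff 0 z • PowerSeries.coeff 0 W := fun z W => by
      rw [PowerSeries.coeff_mul]; simp [Algebra.smul_def]
    simp only [α, map_add, h0, hy0, hV0, coeff_zero_splitting, zero_smul, add_zero, map_smul]

end UnitFrame

/-! ### Differential operators and the conjugation of `Δ` by an exponential -/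

section Order

variable {K A : Type*} [Field K] [Ring A] [Algebra K A]

open Finset.HasAntidiagonal (antidiagonal mem_antidiagonal)

/-- Conjugation of operators by the parity operator. -/
def conjEnd (𝒜 : ℤ → Submodule K A) [GradedAlgebra 𝒜] : Module.End K A →ₐ[K] Module.End K A where
  toFun D := parity 𝒜 ∘ₗ D ∘ₗ parity 𝒜
  map_one' := LinearMap.ext fun a => parity_parity 𝒜 a
  map_mul' D D' := LinearMap.ext fun a => by simp [parity_parity]
  map_zero' := by ext; simp
  map_add' _ _ := by ext; simp
  commutes' c := LinearMap.ext fun a => by simp [Module.algebraMap_end_apply, parity_parity]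

variable {𝒜 : ℤ → Submodule K A} [GradedAlgebra 𝒜]

theorem conjEnd_apply (D : Module.End K A) (a : A) :
    conjEnd 𝒜 D a = parity 𝒜 (D (parity 𝒜 a)) := rfl

theorem conjEnd_lmul (a : A) :
    conjEnd 𝒜 (Algebra.lmul K A a) = Algebra.lmul K A (parity 𝒜 a) :=
  LinearMap.ext fun b => by
    change parity 𝒜 (a * parity 𝒜 b) = parity 𝒜 a * b
    rw [← parityHom_apply, map_mul, parityHom_apply, parityHom_apply, parity_parity]

theorem conjEnd_pow_of_degree {D : Module.End K A} {e : ℤ} (h : ∀ i, ∀ a ∈ 𝒜 i, D a ∈ 𝒜 (i + e))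
    (p : ℕ) : (conjEnd 𝒜 ^ p) D = sgn (e * p) • D := by
  have h1 : conjEnd 𝒜 D = sgn e • D := LinearMap.ext fun a => by
    rw [conjEnd_apply, map_parity_of_degree h, parity_parity]; rfl
  induction p with
  | zero => simp
  | succ p ih =>
    rw [pow_succ', AlgHom.mul_apply, ih, map_zsmul, h1, smul_smul, ← sgn_add]
    congr 2; push_cast; ring

/-- `D` is a differential operator of order less than `k`. This is a version of the recursive
definition for operators which need not be homogeneous: the graded commutators are taken with
elements of definite parity, and only `0` has negative order. -/
def OrdLT (𝒜 : ℤ → Submodule K A) [GradedAlgebra 𝒜] : ℕ → Module.End K A → Prop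
  | 0, D => D = 0
  | k + 1, D => ∀ (p : ℕ) (a : A), parity 𝒜 a = (-1 : ℤ) ^ p • a →
      OrdLT 𝒜 k ((conjEnd 𝒜 ^ p) D * Algebra.lmul K A a - Algebra.lmul K A a * D)

theorem ordLT_zero (k : ℕ) : OrdLT 𝒜 k 0 := by
  induction k with
  | zero => rfl
  | succ k ih => intro p a _; simpa using ih

theorem OrdLT.add {k : ℕ} {D D' : Module.End K A} (h : OrdLT 𝒜 k D) (h' : OrdLT 𝒜 k D') :
    OrdLT 𝒜 k (D + D') := by
  induction k generalizing D D' with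
  | zero => rw [show D = 0 from h, show D' = 0 from h', add_zero]; rfl
  | succ k ih =>
    intro p a ha
    have := ih (h p a ha) (h' p a ha)
    rwa [show (conjEnd 𝒜 ^ p) (D + D') * Algebra.lmul K A a - Algebra.lmul K A a * (D + D') =
      (conjEnd 𝒜 ^ p) D * Algebra.lmul K A a - Algebra.lmul K A a * D +
      ((conjEnd 𝒜 ^ p) D' * Algebra.lmul K A a - Algebra.lmul K A a * D') by
        rw [map_add, add_mul, mul_add]; abel]

theorem OrdLT.zsmul {k : ℕ} {D : Module.End K A} (h : OrdLT 𝒜 k D) (z : ℤ) :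
    OrdLT 𝒜 k (z • D) := by
  induction k generalizing D with
  | zero => rw [show D = 0 from h, smul_zero]; rfl
  | succ k ih =>
    intro p a ha
    have := ih (h p a ha)
    rwa [map_zsmul, smul_mul_assoc, mul_smul_comm, ← zsmul_sub]

theorem OrdLT.sum {ι : Type*} {s : Finset ι} {k : ℕ} {D : ι → Module.End K A}
    (h : ∀ i ∈ s, OrdLT 𝒜 k (D i)) : OrdLT 𝒜 k (∑ i ∈ s, D i) :=
  Finset.sum_induction D (OrdLT 𝒜 k) (fun _ _ => OrdLT.add) (ordLT_zero k) h

theorem OrdLT.succ {k : ℕ} {D : Module.End K A} (h : OrdLT 𝒜 k D) : OrdLT 𝒜 (k + 1) D := by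
  induction k generalizing D with
  | zero => rw [show D = 0 from h]; exact ordLT_zero 1
  | succ k ih => exact fun p a ha => ih (h p a ha)

theorem OrdLT.mono {k l : ℕ} {D : Module.End K A} (h : OrdLT 𝒜 k D) (hkl : k ≤ l) :
    OrdLT 𝒜 l D := by
  induction l, hkl using Nat.le_induction with
  | base => exact h
  | succ l _ ih => exact ih.succ

/-- Commutators with even or odd elements lower the order. -/
theorem OrdLT.commutator {k : ℕ} {D : Module.End K A} (h : OrdLT 𝒜 k D) {p : ℕ} {a : A}
    (ha : parity 𝒜 a = (-1 : ℤ) ^ p • a) :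
    OrdLT 𝒜 (k - 1) ((conjEnd 𝒜 ^ p) D * Algebra.lmul K A a - Algebra.lmul K A a * D) := by
  cases k with
  | zero => rw [show D = 0 from h]; simpa using ordLT_zero 0
  | succ k => exact h p a ha

/-- Homogeneous differential operators of order at most `k` have order less than `k + 1`. An element
of definite parity is a sum of homogeneous elements whose degrees have this parity. -/
theorem IsDiffOp.ordLT [CharZero K] {k : ℕ} {e : ℤ} {D : Module.End K A} (h : IsDiffOp 𝒜 k e D)
    (he : ∀ i, ∀ a ∈ 𝒜 i, D a ∈ 𝒜 (i + e)) : OrdLT 𝒜 (k + 1) D := by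
  classical
  -- the commutator with a homogeneous element, in terms of the one with a sign convention by parity
  have key : ∀ (k : ℕ) (e : ℤ) (D : Module.End K A), (∀ i, ∀ a ∈ 𝒜 i, D a ∈ 𝒜 (i + e)) →
      (∀ i, ∀ a ∈ 𝒜 i, OrdLT 𝒜 k
        (D * Algebra.lmul K A a - sgn (e * i) • (Algebra.lmul K A a * D))) →
      OrdLT 𝒜 (k + 1) D := by
    intro k e D he h p a ha
    rw [← DirectSum.sum_support_decompose 𝒜 a, map_sum, Finset.mul_sum, Finset.sum_mul,
      ← Finset.sum_sub_distrib]
    refine OrdLT.sum fun i hi => ?_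
    have hi : (DirectSum.decompose 𝒜 a i : A) ≠ 0 := by simpa using hi
    have hs : sgn (e * p) = sgn (e * i) := by
      have := sgn_eq_of_parity ha hi
      rw [← sgn_natCast, sgn_eq_iff] at this
      obtain ⟨r, hr⟩ := this
      rw [sgn_eq_iff]
      exact ⟨-(e * r), by linear_combination -e * hr⟩
    have := (h i _ (SetLike.coe_mem (DirectSum.decompose 𝒜 a i))).zsmul (sgn (e * i))
    rwa [smul_sub, smul_smul, sgn_mul_self, one_smul, ← smul_mul_assoc, ← hs,
      ← conjEnd_pow_of_degree he] at this
  induction k generalizing e D with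
  | zero => exact key 0 e D he h
  | succ k ih =>
    refine key (k + 1) e D he fun i a ha => ih (h i a ha) fun j b hb => ?_
    have h1 := he _ _ (SetLike.mul_mem_graded ha hb)
    have h2 := SetLike.mul_mem_graded ha (he _ _ hb)
    rw [show i + (j + e) = j + (e + i) by ring] at h2
    rw [show i + j + e = j + (e + i) by ring] at h1
    exact Submodule.sub_mem _ h1 (zsmul_mem h2 _)

end Order

section Conjugation

variable {K A : Type*} [Field K] [Ring A] [Algebra K A] {μ : ℕ}

open Finset.HasAntidiagonal (antidiagonal mem_antidiagonal)

/-- The parity operator on `A[[ħ]]`. -/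
def parityP (𝒜 : ℤ → Submodule K A) [GradedAlgebra 𝒜] : PowerSeries A →ₐ[K] PowerSeries A :=
  PowerSeries.mapAlgHom (parityHom 𝒜)

/-- Conjugation by the parity operator on `End(A)[[ħ]]`. -/
def conjP (𝒜 : ℤ → Submodule K A) [GradedAlgebra 𝒜] :
    PowerSeries (Module.End K A) →ₐ[K] PowerSeries (Module.End K A) :=
  PowerSeries.mapAlgHom (conjEnd 𝒜)

variable {𝒜 : ℤ → Submodule K A} [GradedAlgebra 𝒜]

@[simp] theorem coeff_parityP (f : PowerSeries A) (l : ℕ) :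
    PowerSeries.coeff l (parityP 𝒜 f) = parity 𝒜 (PowerSeries.coeff l f) := by
  rw [parityP, PowerSeries.mapAlgHom_apply, PowerSeries.coeff_map]; rfl

@[simp] theorem coeff_conjP (U : PowerSeries (Module.End K A)) (l : ℕ) :
    PowerSeries.coeff l (conjP 𝒜 U) = conjEnd 𝒜 (PowerSeries.coeff l U) := by
  rw [conjP, PowerSeries.mapAlgHom_apply, PowerSeries.coeff_map]; rfl

theorem coeff_conjP_pow (p : ℕ) (U : PowerSeries (Module.End K A)) (l : ℕ) :
    PowerSeries.coeff l ((conjP 𝒜 ^ p) U) = (conjEnd 𝒜 ^ p) (PowerSeries.coeff l U) := by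
  induction p generalizing U with
  | zero => rfl
  | succ p ih => rw [pow_succ, pow_succ, AlgHom.mul_apply, AlgHom.mul_apply, ih, coeff_conjP]

theorem lm_parityP (f : PowerSeries A) : lm K (parityP 𝒜 f) = conjP 𝒜 (lm K f) := by
  ext l : 1
  rw [coeff_conjP, lm, PowerSeries.coeff_map, PowerSeries.coeff_map, coeff_parityP]
  exact (conjEnd_lmul _).symm

theorem lm_parityP_pow (p : ℕ) (f : PowerSeries A) :
    lm K ((parityP 𝒜 ^ p) f) = (conjP 𝒜 ^ p) (lm K f) := by
  induction p generalizing f with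
  | zero => rfl
  | succ p ih =>
    rw [pow_succ, pow_succ, AlgHom.mul_apply, AlgHom.mul_apply, ih, lm_parityP]

namespace SS

variable {deg : Fin μ → ℤ}

/-- Multiplication operators, for series in the variables `τ`. -/
def lmS : SS deg (parityP 𝒜) →+* SS deg (conjP 𝒜) := SS.map (lm K) lm_parityP

theorem lmS_apply (f : SS deg (parityP 𝒜)) (m) : lmS f m = lm K (f m) := rfl

/-- The value at `1` of a series of operators. -/
def evS : SS deg (conjP 𝒜) →+ SS deg (parityP 𝒜) where
  toFun W := ⟨fun m => ev (W m), fun m hm => by simp [W.reduced m hm]⟩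
  map_zero' := SS.ext fun m => map_zero ev
  map_add' W W' := SS.ext fun m => map_add ev _ _

@[simp] theorem evS_apply (W : SS deg (conjP 𝒜)) (m) : evS W m = ev (W m) := rfl

theorem evS_lmS_mul (f : SS deg (parityP 𝒜)) (W : SS deg (conjP 𝒜)) :
    evS (lmS f * W) = f * evS W := by
  refine SS.ext fun m => ?_
  rw [evS_apply, mul_apply, mul_apply, map_sum]
  refine Finset.sum_congr rfl fun q _ => ?_
  rw [map_zsmul, lmS_apply, ← lm_parityP_pow, ev_lm_mul, evS_apply]

/-- The operator `[·, x]` on a ring. -/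
def adL {R : Type*} [Ring R] (x : R) : Module.End ℤ R :=
  LinearMap.mulRight ℤ x - LinearMap.mulLeft ℤ x

theorem adL_apply {R : Type*} [Ring R] (x y : R) : adL x y = y * x - x * y := rfl

/-- Moving `T` to the right of `x ^ N`: `T x^N = ∑ C(N, j) x^(N - j) [⋯[T, x], ⋯, x]`, since right
multiplication by `x` is the sum of the commuting operators `x ·` and `[·, x]`. -/
theorem mul_pow_eq {R : Type*} [Ring R] (x T : R) (N : ℕ) :
    T * x ^ N = ∑ q ∈ antidiagonal N, N.choose q.1 • (x ^ q.1 * (adL x ^ q.2) T) := by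
  have hc : Commute (LinearMap.mulLeft ℤ x) (adL x) := by
    refine Commute.sub_right (LinearMap.ext fun y => ?_) (Commute.refl _)
    exact (mul_assoc x y x).symm
  have hsum : LinearMap.mulRight ℤ x = LinearMap.mulLeft ℤ x + adL x := by
    rw [adL, add_sub_cancel]
  have h := congrArg (fun f => f T) (LinearMap.pow_mulRight ℤ R x N)
  rw [LinearMap.mulRight_apply] at h
  rw [← h, hsum, hc.add_pow', LinearMap.sum_apply]
  refine Finset.sum_congr rfl fun q _ => ?_
  rw [LinearMap.smul_apply, Module.End.mul_apply, LinearMap.pow_mulLeft, LinearMap.mulLeft_apply]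

end SS

end Conjugation

/-! ### Integrality of the master equation -/

section Integrality

variable {K A : Type*} [Field K] [Ring A] [Algebra K A] {μ : ℕ} {𝒜 : ℤ → Submodule K A}
  [GradedAlgebra 𝒜] {Δ : ℕ → A →ₗ[K] A} {deg : Fin μ → ℤ}

open Finset.HasAntidiagonal (antidiagonal mem_antidiagonal)

open SS

theorem conjP_deltaOp (hΔ : IsCommBV 𝒜 Δ) : conjP 𝒜 (deltaOp Δ) = -deltaOp Δ := by
  ext l : 1
  have hl : ∀ i, ∀ a ∈ 𝒜 i, Δ l a ∈ 𝒜 (i + (1 - 2 * l)) := by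
    intro i a ha
    have := hΔ.degree l i a ha
    rwa [show i + (1 - 2 * (l : ℤ)) = i + 1 - 2 * l by ring]
  have := conjEnd_pow_of_degree hl 1
  rw [pow_one, Nat.cast_one, mul_one, sgn_odd ⟨-l, by ring⟩, neg_one_zsmul] at this
  rw [coeff_conjP, map_neg, deltaOp, PowerSeries.coeff_mk]
  exact this

theorem conjP_pow_deltaOp (hΔ : IsCommBV 𝒜 Δ) (p : ℕ) :
    (conjP 𝒜 ^ p) (deltaOp Δ) = (-1 : ℤ) ^ p • deltaOp Δ := by
  induction p with
  | zero => simp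
  | succ p ih =>
    rw [pow_succ', AlgHom.mul_apply, ih, map_zsmul, conjP_deltaOp hΔ, pow_succ, mul_neg_one,
      neg_smul, zsmul_neg]

/-- The iterated commutators of `Δ` with `Γ`. -/
def comm (Δ : ℕ → A →ₗ[K] A) (Γ : SS deg (parityP 𝒜)) (j : ℕ) : SS deg (conjP 𝒜) :=
  (adL (lmS Γ) ^ j) (const (conjP 𝒜) (deltaOp Δ))

theorem comm_succ (Γ : SS deg (parityP 𝒜)) (j : ℕ) :
    comm Δ Γ (j + 1) = comm Δ Γ j * lmS Γ - lmS Γ * comm Δ Γ j := by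
  rw [comm, pow_succ', Module.End.mul_apply, adL_apply]; rfl

theorem comm_ordGE {Γ : SS deg (parityP 𝒜)} (h0 : Γ.OrdGE 1) (j : ℕ) : (comm Δ Γ j).OrdGE j := by
  have h1 : (lmS Γ).OrdGE 1 := fun m hm => by rw [lmS_apply, h0 m hm, map_zero]
  induction j with
  | zero => exact ordGE_zero _
  | succ j ih =>
    intro m hm
    rw [comm_succ, SS.sub_apply, (ih.mul h1) m hm, (h1.mul ih) m (by omega), sub_zero]

/-- The `j`-fold commutators of `Δ_l` with the even series `Γ` have order less than
`l + 2 - j`. -/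
theorem comm_ordLT [CharZero K] (hΔ : IsCommBV 𝒜 Δ) {Γ : SS deg (parityP 𝒜)} (hΓ : Γ.IsEven)
    (j : ℕ) (m : Fin μ →₀ ℕ) (l : ℕ) :
    OrdLT 𝒜 (l + 2 - j) (PowerSeries.coeff l (comm Δ Γ j m)) := by
  induction j generalizing m l with
  | zero =>
    change OrdLT 𝒜 (l + 2) (PowerSeries.coeff l (const (conjP 𝒜) (deltaOp Δ) m))
    rw [const_apply]
    split_ifs
    · rw [deltaOp, PowerSeries.coeff_mk]
      refine (hΔ.order l).ordLT fun i a ha => ?_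
      have := hΔ.degree l i a ha
      rwa [show i + (1 - 2 * (l : ℤ)) = i + 1 - 2 * l by ring]
    · rw [map_zero]; exact ordLT_zero _
  | succ j ih =>
    have hpar : ∀ b r, parity 𝒜 (PowerSeries.coeff r (Γ b)) =
        (-1 : ℤ) ^ oddPart deg b • PowerSeries.coeff r (Γ b) := by
      intro b r
      rw [← coeff_parityP, hΓ b, map_zsmul]
    have hpow : ∀ (p : ℕ) b, (conjP 𝒜 ^ p) (lmS Γ b) =
        (-1 : ℤ) ^ (p * oddPart deg b) • lmS Γ b := by
      intro p b
      rw [lmS_apply, ← lm_parityP_pow, hΓ.pow_apply, map_zsmul]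
    have hswap : ∑ q ∈ antidiagonal m, koszul deg q.1 q.2 •
        ((conjP 𝒜 ^ oddPart deg q.2) (lmS Γ q.1) * comm Δ Γ j q.2) =
        ∑ q ∈ antidiagonal m, koszul deg q.2 q.1 •
        ((conjP 𝒜 ^ oddPart deg q.1) (lmS Γ q.2) * comm Δ Γ j q.1) :=
      Finset.sum_equiv (Equiv.prodComm _ _) (fun q => by simp [add_comm]) (fun q _ => rfl)
    rw [comm_succ, SS.sub_apply, mul_apply, mul_apply, hswap, ← Finset.sum_sub_distrib, map_sum]
    refine OrdLT.sum fun q _ => ?_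
    rw [koszul_comm q.2 q.1, hpow, smul_mul_assoc, smul_smul, mul_right_comm, ← pow_add,
      mul_comm (oddPart deg q.2), ← two_mul, pow_mul, neg_one_sq, one_pow, one_mul, ← zsmul_sub,
      map_zsmul]
    refine OrdLT.zsmul ?_ _
    rw [map_sub, PowerSeries.coeff_mul, PowerSeries.coeff_mul, ← Finset.Nat.sum_antidiagonal_swap,
      ← Finset.sum_sub_distrib]
    refine OrdLT.sum fun r hr => ?_
    have hr := mem_antidiagonal.mp hr
    rw [Prod.fst_swap, Prod.snd_swap, coeff_conjP_pow, lmS_apply]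
    have := (ih q.1 r.2).commutator (hpar q.2 r.1)
    refine OrdLT.mono ?_ (show r.2 + 2 - j - 1 ≤ l + 2 - (j + 1) by omega)
    rwa [lm, PowerSeries.coeff_map]

/-- The values at `1` of the iterated commutators. -/
def commVal (Δ : ℕ → A →ₗ[K] A) (Γ : SS deg (parityP 𝒜)) (j : ℕ) : SS deg (parityP 𝒜) :=
  evS (comm Δ Γ j)

theorem coeff_commVal [CharZero K] (hΔ : IsCommBV 𝒜 Δ) {Γ : SS deg (parityP 𝒜)} (hΓ : Γ.IsEven)
    {j : ℕ} (m : Fin μ →₀ ℕ) {l : ℕ} (hl : l + 2 ≤ j) :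
    PowerSeries.coeff l (commVal Δ Γ j m) = 0 := by
  have h := comm_ordLT hΔ hΓ j m l
  rw [Nat.sub_eq_zero_of_le hl] at h
  have h : PowerSeries.coeff l (comm Δ Γ j m) = 0 := h
  rw [commVal, evS_apply, coeff_ev, h]; rfl

theorem commVal_ordGE {Γ : SS deg (parityP 𝒜)} (h0 : Γ.OrdGE 1) (j : ℕ) :
    (commVal Δ Γ j).OrdGE j := fun m hm => by
  rw [commVal, evS_apply, comm_ordGE h0 j m hm, map_zero]

/-- `Δ` applied to powers of an even series, in terms of iterated commutators. -/
theorem deltaPS_pow (hΔ : IsCommBV 𝒜 Δ) (Γ : SS deg (parityP 𝒜)) (N : ℕ) (m : Fin μ →₀ ℕ) :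
    (-1 : ℤ) ^ oddPart deg m • deltaPS Δ ((Γ ^ N) m) =
      (∑ q ∈ antidiagonal N, N.choose q.1 • (Γ ^ q.1 * commVal Δ Γ q.2)) m := by
  have h := congrArg (fun W => evS W m) (mul_pow_eq (lmS Γ) (const (conjP 𝒜) (deltaOp Δ)) N)
  simp only [map_sum, map_nsmul, ← map_pow, evS_lmS_mul] at h
  rw [evS_apply, const_mul_apply, conjP_pow_deltaOp hΔ, smul_mul_assoc, map_zsmul, lmS_apply,
    ← act_apply, ← deltaPS_eq] at h
  exact h

/-- The parity operator on `A((ħ))`. -/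
abbrev parityL (𝒜 : ℤ → Submodule K A) [GradedAlgebra 𝒜] : LaurentSeries A →ₐ[K] LaurentSeries A :=
  mapL (parityHom 𝒜)

/-- The inclusion of series over `A[[ħ]]` into those over `A((ħ))`. -/
def laurS : SS deg (parityP 𝒜) →+* SS deg (parityL 𝒜) :=
  SS.map (HahnSeries.ofPowerSeries ℤ A) fun x => by
    rw [parityL, mapL_toLaurent]; rfl

theorem laurS_apply (f : SS deg (parityP 𝒜)) (m) : laurS f m = toLaurent (f m) := rfl

/-- The constant series `ħ^k`. -/
def hbarS (deg : Fin μ → ℤ) (𝒜 : ℤ → Submodule K A) [GradedAlgebra 𝒜] (k : ℤ) :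
    SS deg (parityL 𝒜) := const (parityL 𝒜) (hbar A k)

theorem parityL_pow_hbar (p : ℕ) (k : ℤ) : (parityL 𝒜 ^ p) (hbar A k) = hbar A k := by
  rw [mapL_pow, mapL_hbar]

theorem hbarS_mul_apply (k : ℤ) (f : SS deg (parityL 𝒜)) (m) :
    (hbarS deg 𝒜 k * f) m = hbar A k * f m := by
  rw [hbarS, const_mul_apply, parityL_pow_hbar]

theorem hbarS_comm (k : ℤ) (f : SS deg (parityL 𝒜)) : Commute (hbarS deg 𝒜 k) f :=
  SS.ext fun m => by rw [hbarS_mul_apply, hbarS, mul_const_apply, hbar_comm]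

theorem hbarS_pow (k : ℤ) (N : ℕ) : hbarS deg 𝒜 k ^ N = hbarS deg 𝒜 (N * k) := by
  induction N with
  | zero => simp [hbarS, one_eq]
  | succ N ih =>
    rw [pow_succ, ih]
    refine SS.ext fun m => ?_
    rw [hbarS_mul_apply, hbarS, hbarS, const_apply, const_apply]
    split_ifs
    · rw [hbar_mul_hbar]; congr 1; push_cast; ring
    · rw [mul_zero]

/-- `F = Γ/ħ`. -/
def overH (Γ : SS deg (parityP 𝒜)) : SS deg (parityL 𝒜) := hbarS deg 𝒜 (-1) * laurS Γ

theorem overH_apply (Γ : SS deg (parityP 𝒜)) (m) :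
    overH Γ m = hbar A (-1) * toLaurent (Γ m) := by rw [overH, hbarS_mul_apply, laurS_apply]

theorem overH_pow (Γ : SS deg (parityP 𝒜)) (N : ℕ) :
    overH Γ ^ N = hbarS deg 𝒜 (-N) * laurS (Γ ^ N) := by
  rw [overH, (hbarS_comm _ _).mul_pow, hbarS_pow, map_pow, mul_neg_one]

theorem overH_ordGE {Γ : SS deg (parityP 𝒜)} (h0 : Γ.OrdGE 1) : (overH Γ).OrdGE 1 :=
  fun m hm => by rw [overH_apply, h0 m hm, toLaurent_zero, mul_zero]

theorem overH_isEven {Γ : SS deg (parityP 𝒜)} (hΓ : Γ.IsEven) : (overH Γ).IsEven := fun m => by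
  rw [overH_apply, map_mul, mapL_hbar, ← mul_smul_comm]
  congr 1
  have h := congrArg toLaurent (hΓ m)
  rw [parityL, mapL_toLaurent]
  refine Eq.trans ?_ (h.trans (map_zsmul _ _ _))
  rfl

/-- The `j`-th term of `e^{-Γ/ħ} Δ e^{Γ/ħ}`. -/
def conjTerm (Δ : ℕ → A →ₗ[K] A) (Γ : SS deg (parityP 𝒜)) (j : ℕ) : SS deg (parityL 𝒜) :=
  hbarS deg 𝒜 (-j) * laurS (commVal Δ Γ j)

/-- The conjugation formula `Δ e^{Γ/ħ} = e^{Γ/ħ} ∑_j ħ^{-j} [⋯[Δ, Γ], ⋯, Γ](1) / j!`. At `τ^m` only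
the terms with `j` at most the degree of `m` contribute. -/
theorem deltaL_exp [CharZero K] (hΔ : IsCommBV 𝒜 Δ) {Γ : SS deg (parityP 𝒜)} (h0 : Γ.OrdGE 1)
    {M : ℕ} {m : Fin μ →₀ ℕ} (hm : m.degree < M) :
    (-1 : ℤ) ^ oddPart deg m • deltaL Δ (SS.exp (overH Γ) m) =
      (SS.exp (overH Γ) * ∑ j ∈ Finset.range M, ((j.factorial : K)⁻¹) • conjTerm Δ Γ j) m := by
  have hZ : ∀ j, (conjTerm Δ Γ j).OrdGE j := fun j m hm => by
    rw [conjTerm, hbarS_mul_apply, laurS_apply, commVal_ordGE h0 j m hm, toLaurent_zero, mul_zero]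
  rw [exp_mul_sum_apply (overH_ordGE h0) hZ hm, exp_apply_of_lt (overH_ordGE h0) hm, expTrunc_apply,
    deltaL_sum, Finset.smul_sum]
  refine Finset.sum_congr rfl fun k _ => ?_
  rw [deltaL_smul, smul_comm]
  congr 1
  rw [overH_pow, hbarS_mul_apply, laurS_apply, deltaL_hbar_mul_toLaurent, ← mul_smul_comm]
  have h := congrArg toLaurent (deltaPS_pow hΔ Γ k m)
  have h' : toLaurent ((-1 : ℤ) ^ oddPart deg m • deltaPS Δ ((Γ ^ k) m)) =
    (-1 : ℤ) ^ oddPart deg m • toLaurent (deltaPS Δ ((Γ ^ k) m)) := map_zsmul _ _ _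
  rw [← h', h, ← laurS_apply, ← hbarS_mul_apply, map_sum, Finset.mul_sum]
  congr 1
  refine Finset.sum_congr rfl fun q hq => ?_
  rw [map_nsmul, mul_smul_comm, map_mul, overH_pow, conjTerm, (hbarS_comm _ _).symm.mul_mul_mul_comm]
  congr 2
  refine SS.ext fun m => ?_
  have hq : q.1 + q.2 = k := mem_antidiagonal.mp hq
  rw [hbarS_mul_apply, hbarS, hbarS, const_apply, const_apply]
  split_ifs
  · rw [hbar_mul_hbar, ← hq]; congr 1; push_cast; ring
  · rw [mul_zero]

theorem exists_hbar_mul_conjTerm [CharZero K] (hΔ : IsCommBV 𝒜 Δ) {Γ : SS deg (parityP 𝒜)}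
    (hΓ : Γ.IsEven) (j : ℕ) (m : Fin μ →₀ ℕ) :
    ∃ f : PowerSeries A, hbar A 1 * conjTerm Δ Γ j m = toLaurent f := by
  rw [conjTerm, hbarS_mul_apply, laurS_apply, hbar_mul_hbar_mul]
  refine ⟨_, eq_toLaurent fun l hl => ?_⟩
  rw [coeff_hbar_mul]
  rcases lt_or_ge (l - (1 + -(j : ℤ))) 0 with h | h
  · exact coeff_toLaurent_neg _ h
  · obtain ⟨r, hr⟩ := Int.eq_ofNat_of_zero_le h
    rw [hr, coeff_toLaurent_natCast]
    exact coeff_commVal hΔ hΓ m (by omega)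

/-- If the master equation holds below `τ^m`, its failure at `τ^m` is in `ħ⁻¹ A[[ħ]]`. Indeed, it is
then the coefficient of `e^{-Γ/ħ} Δ e^{Γ/ħ} = ∑_j ħ^{-j} [⋯[Δ, Γ], ⋯, Γ](1) / j!`, and the `j`-fold
commutators of `Δ_l` vanish for `j > l + 1`. -/
theorem exists_hbar_mul_deltaL_exp [CharZero K] (hΔ : IsCommBV 𝒜 Δ) {Γ : SS deg (parityP 𝒜)}
    (h0 : Γ.OrdGE 1) (hΓ : Γ.IsEven) {m : Fin μ →₀ ℕ}
    (h : ∀ a : Fin μ →₀ ℕ, a.degree < m.degree → deltaL Δ (SS.exp (overH Γ) a) = 0) :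
    ∃ f : PowerSeries A, hbar A 1 * deltaL Δ (SS.exp (overH Γ) m) = toLaurent f := by
  set Z := ∑ j ∈ Finset.range (m.degree + 1), ((j.factorial : K)⁻¹) • conjTerm Δ Γ j with hZdef
  have hexp : ∀ a : Fin μ →₀ ℕ, a.degree ≤ m.degree →
      (∀ b : Fin μ →₀ ℕ, b.degree < a.degree → Z b = 0) →
      (-1 : ℤ) ^ oddPart deg a • deltaL Δ (SS.exp (overH Γ) a) = Z a := by
    intro a ha hb
    rw [deltaL_exp hΔ h0 (Nat.lt_succ_of_le ha), ← hZdef, mul_apply,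
      Finset.sum_eq_single (0, a)]
    · rw [exp_apply_zero, map_one, one_mul]
      by_cases hbad : IsBad deg a
      · rw [Z.reduced.of_isBad hbad, smul_zero]
      · rw [koszul_zero_left hbad, one_smul]
    · rintro ⟨b, c⟩ hq hne
      have hq : b + c = a := mem_antidiagonal.mp hq
      rw [hb c, mul_zero, smul_zero]
      rw [← hq, map_add]
      have : b.degree ≠ 0 := fun hb0 => hne (by
        rw [Finsupp.degree_eq_zero_iff] at hb0
        rw [← hq, hb0, zero_add])
      omega
    · intro hq; simp at hq
  have hZ : ∀ N, ∀ a : Fin μ →₀ ℕ, a.degree = N → a.degree < m.degree → Z a = 0 := by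
    intro N
    induction N using Nat.strong_induction_on with
    | _ N ih =>
      intro a haN ha
      rw [← hexp a ha.le fun b hb => ih b.degree (by omega) b rfl (by omega), h a ha, smul_zero]
  have hm := hexp m le_rfl fun b hb => hZ _ b rfl hb
  have hZm : ∃ f : PowerSeries A, hbar A 1 * Z m = toLaurent f := by
    choose f hf using fun j => exists_hbar_mul_conjTerm hΔ hΓ j m
    refine ⟨∑ j ∈ Finset.range (m.degree + 1), ((j.factorial : K)⁻¹) • f j, ?_⟩
    rw [hZdef, SS.sum_apply, Finset.mul_sum, toLaurent_sum]
    refine Finset.sum_congr rfl fun j _ => ?_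
    rw [SS.smul_apply, hbar_mul_smul, hf, smul_eq_scal, C_eq_toLaurent, scal_toLaurent,
      ← toLaurent_mul, map_C_mul]
  obtain ⟨f, hf⟩ := hZm
  refine ⟨(-1 : ℤ) ^ oddPart deg m • f, ?_⟩
  have h' : toLaurent ((-1 : ℤ) ^ oddPart deg m • f) = (-1 : ℤ) ^ oddPart deg m • toLaurent f :=
    map_zsmul _ _ _
  rw [h', ← hf, ← hm, mul_smul_comm, smul_smul, ← mul_pow]
  simp

end Integrality

/-! ### The flat solution of the master equation -/

theorem exists_eq_single {μ : ℕ} {m : Fin μ →₀ ℕ} (h : m.degree = 1) :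
    ∃ i, m = Finsupp.single i 1 := by
  have hm : m ≠ 0 := by rintro rfl; simp at h
  obtain ⟨i, hi⟩ := Finsupp.ne_iff.mp hm
  obtain ⟨a, rfl⟩ := SS.eq_add_single hi
  rw [map_add, Finsupp.degree_single] at h
  exact ⟨i, by rw [(Finsupp.degree_eq_zero_iff a).mp (by omega), zero_add]⟩

theorem linS_zero {μ : ℕ} {B : Type*} [AddCommMonoid B] (x : Fin μ → B) : linS x 0 = 0 := by
  rw [linS]
  refine Finset.sum_eq_zero fun i _ => if_neg fun h => ?_
  have := DFunLike.congr_fun h i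
  simp at this

theorem linS_single {μ : ℕ} {B : Type*} [AddCommMonoid B] (x : Fin μ → B) (i : Fin μ) :
    linS x (Finsupp.single i 1) = x i := by
  rw [linS, Finset.sum_eq_single i]
  · rw [if_pos rfl]
  · intro j _ hj
    rw [if_neg]
    intro h
    exact hj ((Finsupp.single_left_injective one_ne_zero) h).symm
  · intro h; exact absurd (Finset.mem_univ i) h

section Solution

variable {K A : Type*} [Field K] [Ring A] [Algebra K A] {μ : ℕ} {𝒜 : ℤ → Submodule K A}
  [GradedAlgebra 𝒜] {Δ : ℕ → A →ₗ[K] A} {deg : Fin μ → ℤ}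

open Finset.HasAntidiagonal (antidiagonal mem_antidiagonal)

open SS

omit [GradedAlgebra 𝒜] in
theorem HomL.zero {i : ℤ} : HomL 𝒜 i 0 := fun k => by
  rw [HahnSeries.coeff_zero]; exact zero_mem _

theorem HomL.deltaL (hΔ : IsCommBV 𝒜 Δ) {i : ℤ} {f : LaurentSeries A} (hf : HomL 𝒜 i f) :
    HomL 𝒜 (i + 1) (deltaL Δ f) := fun k => by
  obtain ⟨N, hN⟩ := exists_coeff_bound f k
  rw [coeff_deltaL Δ f k hN]
  refine Submodule.sum_mem _ fun j _ => ?_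
  have := hΔ.degree j _ _ (hf (k - j))
  rwa [show i - 2 * (k - j) + 1 - 2 * j = i + 1 - 2 * k by ring] at this

/-- A series in `τ` with values in `A((ħ))` is homogeneous of degree `i`. -/
def HomS (deg : Fin μ → ℤ) (i : ℤ) (f : SS deg (parityL 𝒜)) : Prop :=
  ∀ m, HomL 𝒜 (i - monDeg deg m) (f m)

theorem HomS.mul {i j : ℤ} {f g : SS deg (parityL 𝒜)} (hf : HomS deg i f) (hg : HomS deg j g) :
    HomS deg (i + j) (f * g) := fun m => by
  rw [mul_apply]
  refine HomL.sum fun q hq => HomL.zsmul ?_ _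
  rw [← mem_antidiagonal.mp hq, monDeg_add,
    show i + j - (monDeg deg q.1 + monDeg deg q.2) =
      i - monDeg deg q.1 + (j - monDeg deg q.2) by ring]
  refine HomL.mul ?_ (hg q.2)
  have h : ∀ (p : ℕ) (i : ℤ) (x : LaurentSeries A), HomL 𝒜 i x →
      HomL 𝒜 i ((parityL 𝒜 ^ p) x) := by
    intro p
    induction p with
    | zero => intro i x hx; exact hx
    | succ p ih =>
      intro i x hx
      have h1 : parityL 𝒜 x = sgn i • x := hx.parity
      rw [pow_succ, AlgHom.mul_apply, h1]
      exact ih _ _ (hx.zsmul _)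
  exact h _ _ _ (hf q.1)

theorem HomS.exp {f : SS deg (parityL 𝒜)} (hf : HomS deg 0 f) : HomS deg 0 (SS.exp f) := fun m => by
  have h : ∀ k, HomS deg 0 (f ^ k) := by
    intro k
    induction k with
    | zero =>
      intro m
      rw [pow_zero, one_apply]
      split_ifs with h
      · subst h
        rw [monDeg_zero, sub_zero, ← toLaurent_one]; exact homL_one
      · exact HomL.zero
    | succ k ih => rw [pow_succ]; exact ih.mul hf
  rw [exp_apply]
  exact HomL.sum fun k _ => (h k m).smul _

/-- The projection of `A[[ħ]]` to homogeneous elements of degree `i`. -/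
def projP (𝒜 : ℤ → Submodule K A) [GradedAlgebra 𝒜] (i : ℤ) (f : PowerSeries A) : PowerSeries A :=
  PowerSeries.mk fun k => degPart 𝒜 (i - 2 * k) (PowerSeries.coeff k f)

theorem homL_projP (i : ℤ) (f : PowerSeries A) : HomL 𝒜 i (toLaurent (projP 𝒜 i f)) :=
  homL_toLaurent.mpr fun k => by
    rw [projP, PowerSeries.coeff_mk]; exact degPart_mem _ _ _

theorem projP_of_homL {i : ℤ} {f : PowerSeries A} (hf : HomL 𝒜 i (toLaurent f)) :
    projP 𝒜 i f = f := by
  ext k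
  rw [projP, PowerSeries.coeff_mk, degPart_of_mem (homL_toLaurent.mp hf k)]

theorem deltaPS_projP (hΔ : IsCommBV 𝒜 Δ) (i : ℤ) (f : PowerSeries A) :
    deltaPS Δ (projP 𝒜 i f) = projP 𝒜 (i + 1) (deltaPS Δ f) := by
  ext k
  rw [coeff_deltaPS, projP, projP, PowerSeries.coeff_mk, coeff_deltaPS, map_sum]
  refine Finset.sum_congr rfl fun q hq => ?_
  have hk : ∀ i, ∀ a ∈ 𝒜 i, Δ q.1 a ∈ 𝒜 (i + (1 - 2 * q.1)) := by
    intro i a ha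
    have := hΔ.degree q.1 i a ha
    rwa [show i + (1 - 2 * (q.1 : ℤ)) = i + 1 - 2 * q.1 by ring]
  rw [PowerSeries.coeff_mk, map_degPart hk, ← mem_antidiagonal.mp hq]
  congr 1
  push_cast; ring_nf

/-- `Γ = ∑ τ_i α_i + O(τ²)` is a solution of the master equation in flat coordinates up to terms
of order larger than `N`. -/
structure IsPartial (𝒜 : ℤ → Submodule K A) [GradedAlgebra 𝒜] (Δ : ℕ → A →ₗ[K] A)
    (α : Fin μ → PowerSeries A) (N : ℕ) (Γ : SS deg (parityP 𝒜)) : Prop where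
  constant : Γ 0 = 0
  linear : ∀ i, Γ (Finsupp.single i 1) = α i
  degree : ∀ m, HomL 𝒜 (2 - monDeg deg m) (toLaurent (Γ m))
  master : ∀ m : Fin μ →₀ ℕ, m.degree ≤ N → deltaL Δ (SS.exp (overH Γ) m) = 0
  flat : ∀ m : Fin μ →₀ ℕ, 2 ≤ m.degree → m.degree ≤ N → ∃ x ∈ oppSpan K α, ∃ u,
    hbar A 1 * SS.exp (overH Γ) m = x + deltaL Δ u

variable {α : Fin μ → PowerSeries A} {N : ℕ} {Γ : SS deg (parityP 𝒜)}

theorem IsPartial.homS (h : IsPartial 𝒜 Δ α N Γ) : HomS deg 0 (overH Γ) := fun m => by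
  rw [overH_apply, show 0 - monDeg deg m = 2 - monDeg deg m + 2 * (-1) by ring]
  exact (h.degree m).hbar_mul _

theorem IsPartial.isEven (h : IsPartial 𝒜 Δ α N Γ) : Γ.IsEven := fun m => by
  apply toLaurent_injective
  have h1 := (h.degree m).parity
  rw [sgn_sub, sgn_even even_two, one_mul, sgn_monDeg, mapL_toLaurent] at h1
  exact h1.trans (map_zsmul (HahnSeries.ofPowerSeries ℤ A) _ _).symm

theorem IsPartial.ordGE (h : IsPartial 𝒜 Δ α N Γ) : Γ.OrdGE 1 := ordGE_one h.constant

theorem exp_apply_single (f : SS deg (parityL 𝒜)) (i : Fin μ) :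
    SS.exp f (Finsupp.single i 1) = f (Finsupp.single i 1) := by
  rw [exp_apply, Finsupp.degree_single, Finset.sum_range_succ, Finset.sum_range_succ]
  simp [one_apply]

variable {n : ℤ} {Tr : A →ₗ[K] K} {G : Matrix (Fin μ) (Fin μ) K}

theorem exists_isPartial_one (hΔ : IsCommBV 𝒜 Δ) (hF : IsFrame 𝒜 n Δ Tr deg G α) :
    ∃ Γ : SS deg (parityP 𝒜), IsPartial 𝒜 Δ α 1 Γ := by
  let Γ : SS deg (parityP 𝒜) := ⟨linS α, fun m hm => by
    refine Finset.sum_eq_zero fun i _ => if_neg ?_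
    rintro rfl
    obtain ⟨j, _, hj⟩ := hm
    rw [Finsupp.single_apply] at hj
    split_ifs at hj <;> omega⟩
  have h0 : Γ 0 = 0 := linS_zero α
  have hone : ∀ m : Fin μ →₀ ℕ, m.degree ≤ 1 → m = 0 ∨ ∃ i, m = Finsupp.single i 1 := by
    intro m hm
    rcases Nat.le_one_iff_eq_zero_or_eq_one.mp hm with h | h
    · exact Or.inl ((Finsupp.degree_eq_zero_iff m).mp h)
    · exact Or.inr (exists_eq_single h)
  refine ⟨Γ, h0, linS_single α, fun m => ?_, fun m hm => ?_, fun m h1 h2 => by omega⟩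
  · change HomL 𝒜 _ (toLaurent (∑ i, if m = Finsupp.single i 1 then α i else 0))
    rw [toLaurent_sum]
    refine HomL.sum fun i _ => ?_
    split_ifs with h
    · rw [h, monDeg_single, sub_sub_cancel]; exact hF.mem i
    · rw [toLaurent_zero]; exact HomL.zero
  · rcases hone m hm with rfl | ⟨i, rfl⟩
    · rw [exp_apply_zero, ← toLaurent_one, deltaL_toLaurent, deltaPS_one hΔ, toLaurent_zero]
    · rw [exp_apply_single, overH_apply]
      change deltaL Δ (hbar A (-1) * toLaurent (linS α _)) = 0
      rw [linS_single, deltaL_hbar_mul, hF.deltaL_eq_zero, mul_zero]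

/-- The correction of a partial solution at `τ^m`. The obstruction is closed in `A[[ħ]]` and exact in
`A((ħ))`, so it is exact in `A[[ħ]]`, since the coordinates of its class vanish. -/
theorem IsPartial.exists_correction [CharZero K] (hΔ : IsCommBV 𝒜 Δ) (hTr : IsCyclicBV 𝒜 n Δ Tr)
    (hF : IsFrame 𝒜 n Δ Tr deg G α) (h : IsPartial 𝒜 Δ α N Γ) (m : Fin μ →₀ ℕ)
    (hm : m.degree = N + 1) :
    ∃ γ : PowerSeries A, (IsBad deg m → γ = 0) ∧ HomL 𝒜 (2 - monDeg deg m) (toLaurent γ) ∧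
      deltaL Δ (SS.exp (overH Γ) m) + hbar A (-1) * toLaurent (deltaPS Δ γ) = 0 ∧
      ∃ x ∈ oppSpan K α, ∃ u, hbar A 1 * SS.exp (overH Γ) m + toLaurent γ = x + deltaL Δ u := by
  by_cases hbad : IsBad deg m
  · have h0 := (SS.exp (overH Γ)).reduced.of_isBad hbad
    refine ⟨0, fun _ => rfl, by rw [toLaurent_zero]; exact HomL.zero, ?_, 0, zero_mem _, 0, ?_⟩
    · rw [h0, deltaL_zero, deltaPS_zero, toLaurent_zero, mul_zero, add_zero]
    · rw [h0, mul_zero, toLaurent_zero, deltaL_zero]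
  obtain ⟨O, hO⟩ := exists_hbar_mul_deltaL_exp hΔ h.ordGE h.isEven (m := m)
    fun a ha => h.master a (by omega)
  set E := SS.exp (overH Γ) m with hE
  have hEd : HomL 𝒜 (2 - monDeg deg m) (hbar A 1 * E) := by
    have := (h.homS.exp m).hbar_mul 1
    rwa [show 0 - monDeg deg m + 2 * 1 = 2 - monDeg deg m by ring] at this
  have hOE : toLaurent O = deltaL Δ (hbar A 1 * E) := by rw [← hO, deltaL_hbar_mul]
  have hOd : HomL 𝒜 (2 - monDeg deg m + 1) (toLaurent O) := by
    rw [hOE]; exact hEd.deltaL hΔ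
  have hOc : deltaPS Δ O = 0 := by
    apply toLaurent_injective
    rw [← deltaL_toLaurent, hOE, deltaL_deltaL hΔ, toLaurent_zero]
  obtain ⟨v, hv⟩ := hF.exists_eq_deltaPS hTr hOc fun k => by rw [hOE, hF.coord_deltaL hTr]
  -- a primitive of `-O` can be taken homogeneous
  let γ₀ : PowerSeries A := -projP 𝒜 (2 - monDeg deg m) v
  have hγ₀ : deltaPS Δ γ₀ = -O := by
    rw [deltaPS_neg, deltaPS_projP hΔ, ← hv, projP_of_homL hOd]
  have hγ₀d : HomL 𝒜 (2 - monDeg deg m) (toLaurent γ₀) := by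
    rw [toLaurent_neg]; exact (homL_projP _ _).neg
  set w := hbar A 1 * E + toLaurent γ₀ with hw
  have hwd : HomL 𝒜 (2 - monDeg deg m) w := hEd.add hγ₀d
  have hwc : deltaL Δ w = 0 := by
    rw [hw, deltaL_add, ← hOE, deltaL_toLaurent, hγ₀, toLaurent_neg, add_neg_cancel]
  obtain ⟨u, hu⟩ := hF.expansion hTr hwc
  -- subtracting the part of the coordinates in `K[[ħ]]` makes the solution flat
  let c : Fin μ → LaurentSeries K := fun i => coord Tr G α i w
  let β : PowerSeries A := ∑ i, PowerSeries.map (algebraMap K A) (posPart (c i)) * α i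
  have hβ : deltaPS Δ β = 0 := by
    rw [deltaPS_sum]
    exact Finset.sum_eq_zero fun i _ => by rw [deltaPS_scalar_mul, hF.closed, mul_zero]
  have hγ : deltaPS Δ (γ₀ - β) = -O := by rw [deltaPS_sub, hβ, sub_zero, hγ₀]
  refine ⟨γ₀ - β, fun hb => absurd hb hbad, ?_, ?_,
    ∑ i, scal A (c i - toLaurent (posPart (c i))) * toLaurent (α i),
    Submodule.sum_mem _ fun i _ => scal_sub_posPart_mem α i _, u, ?_⟩
  · rw [toLaurent_sub, toLaurent_sum]
    refine hγ₀d.sub (HomL.sum fun i _ => homL_map_mul (fun k hk => ?_) (hF.mem i))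
    rw [posPart, PowerSeries.coeff_mk] at hk
    exact hF.coord_degree hTr hwd i hk
  · rw [hγ, toLaurent_neg, ← hO, mul_neg, hbar_mul_hbar_mul, neg_add_cancel, hbar_zero, one_mul,
      add_neg_cancel]
  · rw [toLaurent_sub, ← add_sub_assoc, ← hw]
    conv_lhs => rw [hu]
    rw [add_sub_right_comm]
    congr 1
    rw [toLaurent_sum, ← Finset.sum_sub_distrib]
    refine Finset.sum_congr rfl fun i _ => ?_
    rw [toLaurent_mul, ← scal_toLaurent, ← sub_mul, ← map_sub]

theorem exp_overH_congr {Γ' : SS deg (parityP 𝒜)} (h : Γ.OrdGE 1) (h' : Γ'.OrdGE 1)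
    {m : Fin μ →₀ ℕ} (hm : ∀ a : Fin μ →₀ ℕ, a.degree ≤ m.degree → Γ a = Γ' a) :
    SS.exp (overH Γ) m = SS.exp (overH Γ') m := by
  have := exp_sub_exp (m := m) (overH_ordGE h) (overH_ordGE h') fun a ha => by
    rw [overH_apply, overH_apply, hm a ha.le]
  rw [overH_apply, overH_apply, hm m le_rfl, sub_self] at this
  exact sub_eq_zero.mp this

theorem IsPartial.exists_succ [CharZero K] (hΔ : IsCommBV 𝒜 Δ) (hTr : IsCyclicBV 𝒜 n Δ Tr)
    (hF : IsFrame 𝒜 n Δ Tr deg G α) (hN : 1 ≤ N) (h : IsPartial 𝒜 Δ α N Γ) :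
    ∃ Γ' : SS deg (parityP 𝒜), IsPartial 𝒜 Δ α (N + 1) Γ' ∧
      ∀ m : Fin μ →₀ ℕ, m.degree ≤ N → Γ' m = Γ m := by
  choose γ hbad hd hmaster hflat using h.exists_correction hΔ hTr hF
  let f : Series μ (PowerSeries A) := fun m =>
    if hm : m.degree = N + 1 then Γ m + γ m hm else Γ m
  have hf : ∀ m : Fin μ →₀ ℕ, m.degree ≠ N + 1 → f m = Γ m := fun m hm => dif_neg hm
  have hf' : ∀ (m : Fin μ →₀ ℕ) (hm : m.degree = N + 1), f m = Γ m + γ m hm :=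
    fun m hm => dif_pos hm
  let Γ' : SS deg (parityP 𝒜) := ⟨f, fun m hm => by
    by_cases h : m.degree = N + 1
    · rw [hf' m h, hbad m h hm, Γ.reduced m hm, add_zero]
    · rw [hf m h, Γ.reduced m hm]⟩
  have hlow : ∀ m : Fin μ →₀ ℕ, m.degree ≤ N → Γ' m = Γ m := fun m hm => hf m (by omega)
  have h0 : Γ' 0 = 0 := (hlow 0 (by simp)).trans h.constant
  have hexp : ∀ m : Fin μ →₀ ℕ, m.degree ≤ N →
      SS.exp (overH Γ') m = SS.exp (overH Γ) m := fun m hm =>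
    exp_overH_congr (ordGE_one h0) h.ordGE fun a ha => hlow a (by omega)
  have hexp' : ∀ (m : Fin μ →₀ ℕ) (hm : m.degree = N + 1), SS.exp (overH Γ') m =
      SS.exp (overH Γ) m + hbar A (-1) * toLaurent (γ m hm) := fun m hm => by
    have h1 := exp_sub_exp (m := m) (overH_ordGE (ordGE_one h0)) (overH_ordGE h.ordGE)
      fun a ha => by rw [overH_apply, overH_apply, hlow a (by omega)]
    rw [sub_eq_iff_eq_add'.mp h1, overH_apply, overH_apply, ← mul_sub, ← toLaurent_sub]
    congr 3
    rw [show Γ' m = Γ m + γ m hm from hf' m hm, add_sub_cancel_left]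
  refine ⟨Γ', ⟨h0, fun i => ?_, fun m => ?_, fun m hm => ?_, fun m h2 hm => ?_⟩, hlow⟩
  · rw [hlow _ (by rw [Finsupp.degree_single]; exact hN), h.linear]
  · by_cases hm : m.degree = N + 1
    · change HomL 𝒜 _ (toLaurent (f m))
      rw [hf' m hm, toLaurent_add]
      exact (h.degree m).add (hd m hm)
    · change HomL 𝒜 _ (toLaurent (f m))
      rw [hf m hm]; exact h.degree m
  · rcases Nat.le_or_eq_of_le_succ hm with hm | hm
    · rw [hexp m hm, h.master m hm]
    · rw [hexp' m hm, deltaL_add, deltaL_hbar_mul_toLaurent, hmaster m hm]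
  · rcases Nat.le_or_eq_of_le_succ hm with hm | hm
    · rw [hexp m hm]; exact h.flat m h2 hm
    · rw [hexp' m hm, mul_add, hbar_mul_hbar_mul, add_neg_cancel, hbar_zero, one_mul]
      exact hflat m hm

/-- There is a solution of the master equation in flat coordinates. -/
theorem exists_isPartial [CharZero K] (hΔ : IsCommBV 𝒜 Δ) (hTr : IsCyclicBV 𝒜 n Δ Tr)
    (hF : IsFrame 𝒜 n Δ Tr deg G α) :
    ∃ Γ : SS deg (parityP 𝒜), ∀ N, IsPartial 𝒜 Δ α N Γ := by
  obtain ⟨Γ₁, hΓ₁⟩ := exists_isPartial_one hΔ hF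
  have hstep : ∀ (N : ℕ) (Γ : {Γ : SS deg (parityP 𝒜) // IsPartial 𝒜 Δ α (N + 1) Γ}),
      ∃ Γ' : {Γ : SS deg (parityP 𝒜) // IsPartial 𝒜 Δ α (N + 1 + 1) Γ},
        ∀ m : Fin μ →₀ ℕ, m.degree ≤ N + 1 → Γ'.1 m = Γ.1 m := fun N Γ => by
    obtain ⟨Γ', h1, h2⟩ := Γ.2.exists_succ hΔ hTr hF (by omega)
    exact ⟨⟨Γ', h1⟩, h2⟩
  choose next hnext using hstep
  let g : ∀ N : ℕ, {Γ : SS deg (parityP 𝒜) // IsPartial 𝒜 Δ α (N + 1) Γ} :=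
    fun N => Nat.rec ⟨Γ₁, hΓ₁⟩ next N
  have hg : ∀ (N k : ℕ) (m : Fin μ →₀ ℕ), m.degree ≤ N + 1 → (g (N + k)).1 m = (g N).1 m := by
    intro N k m hm
    induction k with
    | zero => rfl
    | succ k ih => exact (hnext (N + k) (g (N + k)) m (by omega)).trans ih
  let Γ : SS deg (parityP 𝒜) := ⟨fun m => (g m.degree).1 m, fun m hm =>
    (g m.degree).1.reduced m hm⟩
  have hΓ : ∀ (N : ℕ) (m : Fin μ →₀ ℕ), m.degree ≤ N + 1 → Γ m = (g N).1 m := by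
    intro N m hm
    change (g m.degree).1 m = (g N).1 m
    rcases le_total m.degree N with h | h
    · obtain ⟨k, rfl⟩ := Nat.exists_eq_add_of_le h
      exact (hg _ _ m (by omega)).symm
    · obtain ⟨k, hk⟩ := Nat.exists_eq_add_of_le h
      rw [hk]; exact hg _ _ m hm
  have h0 : Γ 0 = 0 := (g 0).2.constant
  have hexp : ∀ (N : ℕ) (m : Fin μ →₀ ℕ), m.degree ≤ N + 1 →
      SS.exp (overH Γ) m = SS.exp (overH (g N).1) m := fun N m hm =>
    exp_overH_congr (ordGE_one h0) (g N).2.ordGE fun a ha => hΓ N a (by omega)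
  refine ⟨Γ, fun N => ⟨h0, fun i => (g _).2.linear i, fun m => (g _).2.degree m, fun m hm => ?_,
    fun m h2 hm => ?_⟩⟩
  · rw [hexp N m (by omega)]; exact (g N).2.master m (by omega)
  · rw [hexp N m (by omega)]; exact (g N).2.flat m h2 (by omega)

theorem expGamma_eq (Γ : SS deg (parityP 𝒜)) :
    expGamma 𝒜 deg Γ.val = (SS.exp (overH Γ)).val := by
  rw [exp_val, expGamma]
  congr 1
  exact funext fun m => (overH_apply Γ m).symm

theorem isFlatSolution (h : ∀ N, IsPartial 𝒜 Δ α N Γ) :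
    IsFlatSolution 𝒜 Δ deg α Γ.val where
  reduced := Γ.reduced
  constant := (h 0).constant
  linear := (h 0).linear
  degree m k := by
    have := homL_toLaurent.mp ((h 0).degree m) k
    rwa [show 2 - 2 * (k : ℤ) - monDeg deg m = 2 - monDeg deg m - 2 * k by ring]
  master m := by rw [expGamma_eq]; exact (h _).master m le_rfl
  flat m := by
    rw [expGamma_eq]
    by_cases h2 : 2 ≤ m.degree
    · obtain ⟨x, hx, u, hu⟩ := (h m.degree).flat m h2 le_rfl
      have hm0 : m ≠ 0 := by rintro rfl; simp at h2
      refine ⟨x, hx, u, ?_⟩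
      rw [constS, if_neg hm0, sub_zero, hu, linS, Finset.sum_eq_zero, zero_add]
      intro i _
      rw [if_neg]
      rintro rfl
      rw [Finsupp.degree_single] at h2
      omega
    · refine ⟨0, zero_mem _, 0, ?_⟩
      rw [deltaL_zero, add_zero, add_zero]
      rcases Nat.le_one_iff_eq_zero_or_eq_one.mp (by omega : m.degree ≤ 1) with h1 | h1
      · obtain rfl := (Finsupp.degree_eq_zero_iff m).mp h1
        rw [exp_apply_zero, mul_one, constS, if_pos rfl, sub_self, linS_zero]
      · obtain ⟨i, rfl⟩ := exists_eq_single h1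
        rw [exp_apply_single, overH_apply, (h 0).linear, hbar_mul_hbar_mul, add_neg_cancel,
          hbar_zero, one_mul, constS, if_neg (by simp), sub_zero, linS_single]

end Solution

/-! ### Scalar series and the Poincaré lemma -/

section Scalar

variable {μ : ℕ} {K B B' : Type*} [Field K] [Ring B] [Algebra K B] [Ring B'] [Algebra K B']
  {deg : Fin μ → ℤ} {σ : B →ₐ[K] B} {σ' : B' →ₐ[K] B'}

open Finset.HasAntidiagonal (antidiagonal mem_antidiagonal)

theorem neg_one_pow_par_mul (i j : Fin μ) :
    (-1 : ℤ) ^ (par deg i * par deg j) = sgn (deg i * deg j) := by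
  rw [pow_mul, neg_one_pow_par]
  rcases Int.even_or_odd (deg j) with h | h
  · rw [sgn_even (h.mul_left _), par, if_neg (Int.not_odd_iff_even.mpr h), pow_zero]
  · rw [par_eq_one h, pow_one]
    rcases Int.even_or_odd (deg i) with h' | h'
    · rw [sgn_even h', sgn_even (h'.mul_right _)]
    · rw [sgn_odd h', sgn_odd (h'.mul h)]

namespace SS

theorem d_comm_sgn (i j : Fin μ) (f : SS deg σ) :
    d i (d j f) = sgn (deg i * deg j) • d j (d i f) := by
  rw [d_comm, neg_one_pow_par_mul]

theorem d_const (i : Fin μ) (x : B) : d i (const σ x : SS deg σ) = 0 := by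
  refine ext fun m => ?_
  rw [d_apply, const_apply, if_neg, smul_zero, zero_apply]
  intro h
  have := DFunLike.congr_fun h i
  simp at this

/-- An additive map, applied to the coefficients of a series. -/
def mapAdd (φ : B →+ B') : SS deg σ →+ SS deg σ' where
  toFun f := ⟨fun m => φ (f m), fun m hm => by simp [f.reduced m hm]⟩
  map_zero' := ext fun _ => map_zero φ
  map_add' _ _ := ext fun _ => map_add φ _ _

theorem mapAdd_apply (φ : B →+ B') (f : SS deg σ) (m) :
    (mapAdd φ f : SS deg σ') m = φ (f m) := rfl

theorem mapAdd_d (φ : B →+ B') (i : Fin μ) (f : SS deg σ) :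
    (mapAdd φ (d i f) : SS deg σ') = d i (mapAdd φ f) :=
  ext fun m => by rw [mapAdd_apply, d_apply, d_apply, map_zsmul, mapAdd_apply]

/-- The inclusion of scalar series. -/
def liftS (σ : B →ₐ[K] B) : SS deg (AlgHom.id K K) →+* SS deg σ :=
  map (algebraMap K B) fun x => by rw [AlgHom.id_apply, σ.commutes]

theorem algHom_pow_commutes (σ : B →ₐ[K] B) (n : ℕ) (c : K) :
    (σ ^ n) (algebraMap K B c) = algebraMap K B c := (σ ^ n).commutes c

theorem id_pow_apply (n : ℕ) (c : K) : (AlgHom.id K K ^ n) c = c :=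
  algHom_pow_commutes (AlgHom.id K K) n c

theorem liftS_apply (c : SS deg (AlgHom.id K K)) (m) : liftS σ c m = algebraMap K B (c m) := rfl

theorem liftS_mul_apply (c : SS deg (AlgHom.id K K)) (f : SS deg σ) (m) :
    (liftS σ c * f) m = ∑ q ∈ antidiagonal m, koszul deg q.1 q.2 • (c q.1 • f q.2) := by
  rw [mul_apply]
  refine Finset.sum_congr rfl fun q _ => ?_
  rw [liftS_apply, algHom_pow_commutes, ← Algebra.smul_def]

theorem scalar_mul_apply (c f : SS deg (AlgHom.id K K)) (m) :
    (c * f) m = ∑ q ∈ antidiagonal m, koszul deg q.1 q.2 • (c q.1 * f q.2) := by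
  rw [mul_apply]
  refine Finset.sum_congr rfl fun q _ => by rw [id_pow_apply]

theorem mapAdd_liftS_mul {φ : B →+ K} (hφ : ∀ (c : K) x, φ (c • x) = c * φ x)
    (c : SS deg (AlgHom.id K K)) (f : SS deg σ) :
    (mapAdd φ (liftS σ c * f) : SS deg (AlgHom.id K K)) = c * mapAdd φ f :=
  ext fun m => by
    rw [mapAdd_apply, liftS_mul_apply, scalar_mul_apply, map_sum]
    exact Finset.sum_congr rfl fun q _ => by rw [map_zsmul, hφ, mapAdd_apply]

theorem twist_eq_of_parity {f : SS deg (AlgHom.id K K)} {s : ℤ}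
    (h : ∀ m, f m ≠ 0 → sgn (monDeg deg m) = sgn s) (i : Fin μ) :
    twist i f = sgn (deg i * s) • f := by
  refine ext fun m => ?_
  rw [twist_apply, id_pow_apply, zsmul_apply]
  by_cases h0 : f m = 0
  · rw [h0, smul_zero, smul_zero]
  · congr 1
    rw [mul_comm, pow_mul, ← sgn_monDeg, h m h0, par]
    split_ifs with hi
    · rw [pow_one]
      rcases Int.even_or_odd s with h | h
      · rw [sgn_even h, sgn_even (h.mul_left _)]
      · rw [sgn_odd h, sgn_odd (hi.mul h)]
    · rw [pow_zero, sgn_even ((Int.not_odd_iff_even.mp hi).mul_right _)]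

/-- The variable `τ_i`. -/
def tau (K : Type*) [Field K] (deg : Fin μ → ℤ) (i : Fin μ) : SS deg (AlgHom.id K K) where
  val m := if m = Finsupp.single i 1 then 1 else 0
  reduced m hm := by
    obtain ⟨j, -, hj⟩ := hm
    refine if_neg ?_
    rintro rfl
    rw [Finsupp.single_apply] at hj
    split_ifs at hj <;> omega

theorem tau_apply (i : Fin μ) (m) : tau K deg i m = if m = Finsupp.single i 1 then 1 else 0 := rfl

theorem d_tau (i j : Fin μ) : d j (tau K deg i) = if i = j then 1 else 0 := by
  refine ext fun m => ?_
  rw [d_apply, tau_apply]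
  by_cases hm : m = 0
  · subst hm
    rw [zero_add]
    by_cases hij : i = j
    · subst hij; simp [one_apply]
    · rw [if_neg (fun h => hij (Finsupp.single_left_injective one_ne_zero h).symm), if_neg hij,
        smul_zero, zero_apply]
  · rw [if_neg, smul_zero]
    · split_ifs
      · rw [one_apply, if_neg hm]
      · rfl
    · intro h
      have h := congrArg Finsupp.degree h
      rw [map_add, Finsupp.degree_single, Finsupp.degree_single] at h
      exact hm ((Finsupp.degree_eq_zero_iff m).mp (by omega))

theorem twist_tau (i j : Fin μ) : twist j (tau K deg i) = sgn (deg j * deg i) • tau K deg i := by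
  refine twist_eq_of_parity (fun m hm => ?_) j
  rw [tau_apply] at hm
  obtain rfl : m = Finsupp.single i 1 := by by_contra h; exact hm (if_neg h)
  rw [monDeg_single, sgn_sub, sgn_even even_two, one_mul]

/-- `τ_i ∂_i` multiplies the monomials by their exponents. -/
theorem tau_mul_d (i : Fin μ) (f : SS deg (AlgHom.id K K)) (m) :
    (tau K deg i * d i f) m = m i • f m := by
  rw [scalar_mul_apply]
  by_cases hm : m i = 0
  · rw [hm, zero_smul]
    refine Finset.sum_eq_zero fun q hq => ?_
    rw [tau_apply, if_neg, zero_mul, smul_zero]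
    intro h
    have := DFunLike.congr_fun (mem_antidiagonal.mp hq) i
    rw [Finsupp.add_apply, h, Finsupp.single_eq_same] at this
    omega
  obtain ⟨a, rfl⟩ := eq_add_single hm
  rw [Finset.sum_eq_single (Finsupp.single i 1, a)]
  · by_cases hbad : IsBad deg (a + Finsupp.single i 1)
    · rw [koszul_of_isBad (by rwa [add_comm]), f.reduced.of_isBad hbad, zero_smul, smul_zero]
    · rw [tau_apply, if_pos rfl, one_mul, koszul_of_not_isBad (by rwa [add_comm]),
        swapCount_single_left, d_apply, smul_smul, ← mul_assoc, ← mul_pow, neg_one_mul, neg_neg,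
        one_pow, one_mul, Finsupp.add_apply, Finsupp.single_eq_same]
      exact_mod_cast natCast_zsmul (f _) (a i + 1)
  · rintro ⟨b, c⟩ hq hne
    rw [tau_apply, if_neg, zero_mul, smul_zero]
    rintro rfl
    have : Finsupp.single i 1 + c = a + Finsupp.single i 1 := mem_antidiagonal.mp hq
    rw [add_comm] at this
    exact hne (by rw [add_right_cancel this])
  · intro h
    exact absurd (mem_antidiagonal.mpr (add_comm _ _)) h

/-- The Poincaré lemma: closed one-forms `∑ dτ_i θ_i` are exact. The contraction of the one-form
with the vector field `∑ τ_i ∂_i` has to be divided by the number of factors of each monomial. -/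
theorem exists_potential [CharZero K] {θ : Fin μ → SS deg (AlgHom.id K K)}
    (h : ∀ i j, d i (θ j) = sgn (deg i * deg j) • d j (θ i)) :
    ∃ Φ : SS deg (AlgHom.id K K), ∀ i, d i Φ = θ i := by
  let Ψ : SS deg (AlgHom.id K K) := ∑ i, tau K deg i * θ i
  have hΨ : ∀ j m, d j Ψ m = ((m.degree : K) + 1) * θ j m := by
    intro j m
    have h1 : d j Ψ = θ j + ∑ i, tau K deg i * d i (θ j) := by
      rw [map_sum]
      simp only [d_mul, Finset.sum_add_distrib, d_tau]
      congr 1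
      · simp
      · refine Finset.sum_congr rfl fun i _ => ?_
        rw [twist_tau, h j i, smul_mul_assoc, mul_smul_comm, smul_smul, sgn_mul_self, one_smul]
    rw [h1, add_apply, sum_apply]
    simp only [tau_mul_d]
    rw [← Finset.sum_smul, ← Finsupp.degree_eq_sum, nsmul_eq_mul]
    ring
  refine ⟨⟨fun m => (m.degree : K)⁻¹ * Ψ m, fun m hm => by
    simp [Ψ.reduced m hm]⟩,
    fun i => ext fun m => ?_⟩
  have hne : ((m.degree : K) + 1) ≠ 0 := Nat.cast_add_one_ne_zero m.degree
  rw [d_apply]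
  change _ • (((m + Finsupp.single i 1).degree : K)⁻¹ * Ψ (m + Finsupp.single i 1)) = _
  rw [← mul_smul_comm, ← d_apply, hΨ, map_add, Finsupp.degree_single, Nat.cast_add, Nat.cast_one,
    inv_mul_cancel_left₀ hne]

end SS

end Scalar

/-! ### Integrality of the pairing of sections -/

section Sections

variable {K A : Type*} [Field K] [Ring A] [Algebra K A] {μ : ℕ} {𝒜 : ℤ → Submodule K A}
  [GradedAlgebra 𝒜] {Δ : ℕ → A →ₗ[K] A} {deg : Fin μ → ℤ}

open Finset.HasAntidiagonal (antidiagonal mem_antidiagonal)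

open SS

theorem exists_eq_laurS {X : SS deg (parityL 𝒜)} (h : ∀ m, ∀ k < 0, (X m).coeff k = 0) :
    ∃ x : SS deg (parityP 𝒜), X = laurS x := by
  refine ⟨⟨fun m => PowerSeries.mk fun k => (X m).coeff k, fun m hm => ?_⟩,
    SS.ext fun m => eq_toLaurent (h m)⟩
  ext k
  rw [PowerSeries.coeff_mk, X.reduced m hm, HahnSeries.coeff_zero, map_zero]

theorem laurS_coeff_of_neg (x : SS deg (parityP 𝒜)) (m) {k : ℤ} (hk : k < 0) :
    (laurS x m).coeff k = 0 := coeff_toLaurent_neg _ hk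

theorem d_hbarS_mul (k : ℤ) (i : Fin μ) (f : SS deg (parityL 𝒜)) :
    d i (hbarS deg 𝒜 k * f) = hbarS deg 𝒜 k * d i f :=
  SS.ext fun m => by
    rw [d_apply, hbarS_mul_apply, hbarS_mul_apply, d_apply, mul_smul_comm]

theorem d_laurS (i : Fin μ) (f : SS deg (parityP 𝒜)) : d i (laurS f) = laurS (d i f) :=
  (SS.map_d _ _ i f).symm

theorem hbarS_mul_hbarS_mul (k l : ℤ) (f : SS deg (parityL 𝒜)) :
    hbarS deg 𝒜 k * (hbarS deg 𝒜 l * f) = hbarS deg 𝒜 (k + l) * f :=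
  SS.ext fun m => by simp only [hbarS_mul_apply, hbar_mul_hbar_mul]

theorem hbarS_zero_mul (f : SS deg (parityL 𝒜)) : hbarS deg 𝒜 0 * f = f :=
  SS.ext fun m => by rw [hbarS_mul_apply, hbar_zero, one_mul]

/-- The section `ħ ∂_i e^{Γ/ħ}`. -/
def secS (Γ : SS deg (parityP 𝒜)) (i : Fin μ) : SS deg (parityL 𝒜) :=
  hbarS deg 𝒜 1 * d i (SS.exp (overH Γ))

theorem secS_val (Γ : SS deg (parityP 𝒜)) (i : Fin μ) : (secS Γ i).val = sec 𝒜 deg Γ.val i := by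
  funext m
  rw [secS, hbarS_mul_apply, d_val, sec, expGamma_eq]

variable {Γ : SS deg (parityP 𝒜)}

theorem secS_eq [CharZero K] (hΔ : IsCommBV 𝒜 Δ) (hΓ : Γ.IsEven) (h0 : Γ.OrdGE 1) (i : Fin μ) :
    secS Γ i = laurS (d i Γ) * SS.exp (overH Γ) := by
  rw [secS, d_exp (isSuperComm_mapL (isSuperComm_parityHom hΔ)) i (overH_isEven hΓ)
    (overH_ordGE h0), overH, d_hbarS_mul, ← mul_assoc, hbarS_mul_hbarS_mul, add_neg_cancel,
    hbarS_zero_mul, d_laurS]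

/-- The series in `A[[ħ]][[τ]] e^{Γ/ħ}`. -/
def IsExpInt (Γ : SS deg (parityP 𝒜)) (X : SS deg (parityL 𝒜)) : Prop :=
  ∃ x : SS deg (parityP 𝒜), X = laurS x * SS.exp (overH Γ)

theorem IsExpInt.sub {X Y : SS deg (parityL 𝒜)} (hX : IsExpInt Γ X) (hY : IsExpInt Γ Y) :
    IsExpInt Γ (X - Y) := by
  obtain ⟨x, rfl⟩ := hX
  obtain ⟨y, rfl⟩ := hY
  exact ⟨x - y, by rw [map_sub, sub_mul]⟩

theorem IsExpInt.sum {X : Fin μ → SS deg (parityL 𝒜)} (hX : ∀ i, IsExpInt Γ (X i)) :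
    IsExpInt Γ (∑ i, X i) := by
  choose x hx using hX
  exact ⟨∑ i, x i, by rw [map_sum, Finset.sum_mul]; exact Finset.sum_congr rfl fun i _ => hx i⟩

theorem isExpInt_exp (Γ : SS deg (parityP 𝒜)) : IsExpInt Γ (SS.exp (overH Γ)) :=
  ⟨1, by rw [map_one, one_mul]⟩

theorem isExpInt_secS [CharZero K] (hΔ : IsCommBV 𝒜 Δ) (hΓ : Γ.IsEven) (h0 : Γ.OrdGE 1)
    (i : Fin μ) : IsExpInt Γ (secS Γ i) := ⟨_, secS_eq hΔ hΓ h0 i⟩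

theorem IsExpInt.liftS_mul {X : SS deg (parityL 𝒜)} (hX : IsExpInt Γ X)
    (c : SS deg (AlgHom.id K K)) : IsExpInt Γ (liftS (parityL 𝒜) c * X) := by
  obtain ⟨x, rfl⟩ := hX
  obtain ⟨y, hy⟩ := exists_eq_laurS (X := liftS (parityL 𝒜) c * laurS x) fun m k hk => by
    rw [liftS_mul_apply, HahnSeries.coeff_sum]
    refine Finset.sum_eq_zero fun q _ => ?_
    rw [HahnSeries.coeff_smul, HahnSeries.coeff_smul, laurS_coeff_of_neg _ _ hk, smul_zero,
      smul_zero]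
  exact ⟨y, by rw [← mul_assoc, hy]⟩

theorem IsExpInt.hbar_d [CharZero K] (hΔ : IsCommBV 𝒜 Δ) (hΓ : Γ.IsEven) (h0 : Γ.OrdGE 1)
    {X : SS deg (parityL 𝒜)} (hX : IsExpInt Γ X) (i : Fin μ) :
    IsExpInt Γ (hbarS deg 𝒜 1 * d i X) := by
  obtain ⟨x, rfl⟩ := hX
  obtain ⟨y, hy⟩ := exists_eq_laurS (X := hbarS deg 𝒜 1 * laurS (d i x)) fun m k hk => by
    rw [hbarS_mul_apply, coeff_hbar_mul, laurS_coeff_of_neg _ _ (by omega)]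
  obtain ⟨z, hz⟩ := exists_eq_laurS (X := twist i (laurS x)) fun m k hk => by
    rw [twist_apply, HahnSeries.coeff_smul, mapL_pow, coeff_mapL, laurS_coeff_of_neg _ _ hk,
      map_zero, smul_zero]
  refine ⟨y + z * d i Γ, ?_⟩
  have h := secS_eq hΔ hΓ h0 i
  rw [secS] at h
  rw [d_mul, mul_add, ← mul_assoc, d_laurS, hy, hz, ← mul_assoc, (hbarS_comm 1 (laurS z)).eq,
    mul_assoc (laurS z), h, map_add, map_mul, add_mul, mul_assoc]

/-- The substitution `ħ ↦ -ħ`. -/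
def barS : SS deg (parityL 𝒜) →+* SS deg (parityL 𝒜) :=
  SS.map (barHom A) fun f => by
    ext k
    rw [barHom_apply, barHom_apply, coeff_bar, coeff_mapL, coeff_mapL, coeff_bar, map_zsmul]

theorem barS_apply (f : SS deg (parityL 𝒜)) (m) : barS f m = bar (f m) := rfl

/-- `e^{Γ(ħ)/ħ} e^{-Γ(-ħ)/ħ}` has no pole. -/
theorem exists_exp_mul_barS [CharZero K] (hΔ : IsCommBV 𝒜 Δ) (hΓ : Γ.IsEven) (h0 : Γ.OrdGE 1) :
    ∃ z : SS deg (parityP 𝒜), SS.exp (overH Γ) * barS (SS.exp (overH Γ)) = laurS z := by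
  obtain ⟨z, hz⟩ := exists_eq_laurS (X := overH Γ + barS (overH Γ)) fun m k hk => by
    rw [SS.add_apply, barS_apply, HahnSeries.coeff_add, coeff_bar, overH_apply, coeff_hbar_mul]
    -- The terms `ħ⁻¹ Γ₀` and `-ħ⁻¹ Γ₀` cancel.
    rcases eq_or_ne k (-1) with rfl | hk'
    · rw [sgn_odd (by decide), neg_one_zsmul, add_neg_cancel]
    · rw [coeff_toLaurent_neg _ (by omega), smul_zero, add_zero]
  have hcomm : Commute (overH Γ) (barS (overH Γ)) :=
    (overH_isEven hΓ).commute (isSuperComm_mapL (isSuperComm_parityHom hΔ)) _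
  refine ⟨SS.exp z, ?_⟩
  rw [barS, SS.map_exp _ _ (fun c x => bar_smul c x), laurS, SS.map_exp]
  · change SS.exp (overH Γ) * SS.exp (barS (overH Γ)) = SS.exp (laurS z)
    rw [← exp_add hcomm (overH_ordGE h0), hz]
    intro m hm
    rw [barS_apply, overH_ordGE h0 m hm, ← barHom_apply, map_zero]
  · intro c x
    ext k
    rw [HahnSeries.coeff_smul]
    rcases lt_or_ge k 0 with hk | hk
    · rw [coeff_toLaurent_neg _ hk, coeff_toLaurent_neg _ hk, smul_zero]
    · obtain ⟨k, rfl⟩ := Int.eq_ofNat_of_zero_le hk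
      rw [coeff_toLaurent_natCast, coeff_toLaurent_natCast, PowerSeries.coeff_smul]

/-- The pairing of series in `A[[ħ]][[τ]] e^{Γ/ħ}` has no poles, since it contains `e^{Γ/ħ}`
only in the factor `e^{Γ(ħ)/ħ - Γ(-ħ)/ħ}`, whose exponent has no pole. -/
theorem coeff_pairing_of_isExpInt [CharZero K] (hΔ : IsCommBV 𝒜 Δ) (hΓ : Γ.IsEven)
    (h0 : Γ.OrdGE 1) (Tr : A →ₗ[K] K) {X Y : SS deg (parityL 𝒜)} (hX : IsExpInt Γ X)
    (hY : IsExpInt Γ Y) (m) {k : ℤ} (hk : k < 0) : (trL Tr ((X * barS Y) m)).coeff k = 0 := by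
  obtain ⟨x, rfl⟩ := hX
  obtain ⟨y, rfl⟩ := hY
  obtain ⟨z, hz⟩ := exists_exp_mul_barS hΔ hΓ h0
  obtain ⟨w, hw⟩ := exists_eq_laurS (X := barS (laurS y)) fun m k hk => by
    rw [barS_apply, coeff_bar, laurS_coeff_of_neg _ _ hk, smul_zero]
  have hE : SS.exp (overH Γ) * barS (laurS y) = barS (laurS y) * SS.exp (overH Γ) :=
    (overH_isEven hΓ).exp.commute (isSuperComm_mapL (isSuperComm_parityHom hΔ)) _
  rw [map_mul, mul_assoc, ← mul_assoc (SS.exp _), hE, mul_assoc, hz, hw, ← map_mul, ← map_mul,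
    coeff_trL, laurS_coeff_of_neg _ _ hk, map_zero]

theorem pairing_series_apply (Tr : A →ₗ[K] K) (X Y : SS deg (parityL 𝒜)) (m) :
    trL Tr ((X * barS Y) m) = ∑ q ∈ antidiagonal m,
      koszul deg q.1 q.2 • pairing Tr ((parityL 𝒜 ^ oddPart deg q.2) (X q.1)) (Y q.2) := by
  rw [mul_apply, map_sum]
  exact Finset.sum_congr rfl fun q _ => by rw [map_zsmul, pairing_eq, barS_apply]

end Sections

/-! ### The Frobenius manifold structure -/

section Coordinates

variable {K A : Type*} [Field K] [Ring A] [Algebra K A] {μ : ℕ} {𝒜 : ℤ → Submodule K A}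
  [GradedAlgebra 𝒜] {Δ : ℕ → A →ₗ[K] A} {deg : Fin μ → ℤ} {n : ℤ} {Tr : A →ₗ[K] K}
  {G : Matrix (Fin μ) (Fin μ) K} {α : Fin μ → PowerSeries A} {Γ : SS deg (parityP 𝒜)}

open Finset.HasAntidiagonal (antidiagonal mem_antidiagonal)

open SS

/-- The coefficient of `ħ^p` in the `l`-th coordinate of a series of closed elements. -/
def coordS (Tr : A →ₗ[K] K) (G : Matrix (Fin μ) (Fin μ) K) (α : Fin μ → PowerSeries A)
    (l : Fin μ) (p : ℤ) : SS deg (parityL 𝒜) →+ SS deg (AlgHom.id K K) :=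
  mapAdd ((HahnSeries.coeff.addMonoidHom p).comp (coord Tr G α l))

theorem coordS_apply (l : Fin μ) (p : ℤ) (X : SS deg (parityL 𝒜)) (m) :
    coordS Tr G α l p X m = (coord Tr G α l (X m)).coeff p := rfl

theorem coordS_d (l : Fin μ) (p : ℤ) (i : Fin μ) (X : SS deg (parityL 𝒜)) :
    coordS Tr G α l p (d i X) = d i (coordS Tr G α l p X) := mapAdd_d _ i X

theorem coordS_hbarS_mul (l : Fin μ) (p k : ℤ) (X : SS deg (parityL 𝒜)) :
    coordS Tr G α l p (hbarS deg 𝒜 k * X) = coordS Tr G α l (p - k) X :=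
  SS.ext fun m => by
    rw [coordS_apply, hbarS_mul_apply, coord_hbar_mul, coeff_hbar_mul, coordS_apply]

theorem coordS_liftS_mul (l : Fin μ) (p : ℤ) (c : SS deg (AlgHom.id K K))
    (X : SS deg (parityL 𝒜)) :
    coordS Tr G α l p (liftS (parityL 𝒜) c * X) = c * coordS Tr G α l p X :=
  mapAdd_liftS_mul (fun c x => by
    change (coord Tr G α l (c • x)).coeff p = c * (coord Tr G α l x).coeff p
    rw [coord_smul, HahnSeries.coeff_smul, smul_eq_mul]) c X

theorem coordS_smul (l : Fin μ) (p : ℤ) (c : K) (X : SS deg (parityL 𝒜)) :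
    coordS Tr G α l p (c • X) = c • coordS Tr G α l p X :=
  SS.ext fun m => by
    rw [coordS_apply, SS.smul_apply, SS.smul_apply, coord_smul, HahnSeries.coeff_smul, coordS_apply]

theorem coordS_secS (l : Fin μ) (p : ℤ) (j : Fin μ) :
    coordS Tr G α l p (secS Γ j) = d j (coordS Tr G α l (p - 1) (SS.exp (overH Γ))) := by
  rw [secS, coordS_hbarS_mul, coordS_d]

theorem coordS_hbar_d (l : Fin μ) (p : ℤ) (j : Fin μ) (X : SS deg (parityL 𝒜)) :
    coordS Tr G α l p (hbarS deg 𝒜 1 * d j X) = d j (coordS Tr G α l (p - 1) X) := by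
  rw [coordS_hbarS_mul, coordS_d]

/-- The components of the derivative of the potential: the coefficient of `ħ⁻¹` in the coordinates
of `ħ e^{Γ/ħ}`. -/
def firstOrder (Tr : A →ₗ[K] K) (G : Matrix (Fin μ) (Fin μ) K) (α : Fin μ → PowerSeries A)
    (Γ : SS deg (parityP 𝒜)) (l : Fin μ) : SS deg (AlgHom.id K K) :=
  coordS Tr G α l (-2) (SS.exp (overH Γ))

/-- The structure constants of the product. -/
def structConst (Tr : A →ₗ[K] K) (G : Matrix (Fin μ) (Fin μ) K) (α : Fin μ → PowerSeries A)
    (Γ : SS deg (parityP 𝒜)) (i j k : Fin μ) : SS deg (AlgHom.id K K) :=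
  d i (d j (firstOrder Tr G α Γ k))

theorem structConst_comm (i j k : Fin μ) :
    structConst Tr G α Γ i j k = sgn (deg i * deg j) • structConst Tr G α Γ j i k :=
  d_comm_sgn _ _ _

theorem deltaL_exp_eq_zero (hΓ : ∀ N, IsPartial 𝒜 Δ α N Γ) (m : Fin μ →₀ ℕ) :
    deltaL Δ (SS.exp (overH Γ) m) = 0 := (hΓ _).master m le_rfl

theorem deltaL_d {X : SS deg (parityL 𝒜)} (hX : ∀ m, deltaL Δ (X m) = 0) (i : Fin μ) (m) :
    deltaL Δ (d i X m) = 0 := by rw [d_apply, deltaL_zsmul, hX, smul_zero]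

theorem deltaL_hbarS_mul {X : SS deg (parityL 𝒜)} (hX : ∀ m, deltaL Δ (X m) = 0) (k : ℤ) (m) :
    deltaL Δ ((hbarS deg 𝒜 k * X) m) = 0 := by
  rw [hbarS_mul_apply, deltaL_hbar_mul, hX, mul_zero]

theorem deltaL_liftS_mul {X : SS deg (parityL 𝒜)} (hX : ∀ m, deltaL Δ (X m) = 0)
    (c : SS deg (AlgHom.id K K)) (m) : deltaL Δ ((liftS (parityL 𝒜) c * X) m) = 0 := by
  rw [liftS_mul_apply, deltaL_sum]
  exact Finset.sum_eq_zero fun q _ => by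
    rw [deltaL_zsmul, deltaL_smul, hX, smul_zero, smul_zero]

theorem deltaL_secS (hΓ : ∀ N, IsPartial 𝒜 Δ α N Γ) (i : Fin μ) (m) :
    deltaL Δ (secS Γ i m) = 0 := deltaL_hbarS_mul (deltaL_d (deltaL_exp_eq_zero hΓ) i) 1 m

theorem secS_zero (hΓ : ∀ N, IsPartial 𝒜 Δ α N Γ) (i : Fin μ) :
    secS Γ i 0 = toLaurent (α i) := by
  rw [secS, hbarS_mul_apply, d_apply, zero_add, exp_apply_single, overH_apply, (hΓ 0).linear]
  simp [hbar_mul_hbar_mul]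

theorem deltaL_parityL_pow (hΔ : IsCommBV 𝒜 Δ) (k : ℕ) (u : LaurentSeries A) :
    ∃ v, (parityL 𝒜 ^ k) (deltaL Δ u) = deltaL Δ v := by
  induction k generalizing u with
  | zero => exact ⟨u, rfl⟩
  | succ k ih =>
    obtain ⟨v, hv⟩ := ih (-mapL (parityHom 𝒜) u)
    exact ⟨v, by rw [pow_succ, AlgHom.mul_apply, mapL_deltaL hΔ, ← deltaL_neg, hv]⟩

/-- A series of closed elements in `A[[ħ]][[τ]] e^{Γ/ħ}` whose coordinates are all in
`ħ⁻¹ K[ħ⁻¹]` is exact: by induction, its leading coefficients pair without poles with the `α_j`, so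
that the coordinates of these are also in `K[[ħ]]`. -/
theorem IsExpInt.coord_eq_zero [CharZero K] (hΔ : IsCommBV 𝒜 Δ) (hTr : IsCyclicBV 𝒜 n Δ Tr)
    (hF : IsFrame 𝒜 n Δ Tr deg G α) (hΓ : ∀ N, IsPartial 𝒜 Δ α N Γ) {X : SS deg (parityL 𝒜)}
    (hX : IsExpInt Γ X) (hc : ∀ m, deltaL Δ (X m) = 0)
    (hp : ∀ l p, 0 ≤ p → coordS Tr G α l p X = 0) (m) (l : Fin μ) :
    coord Tr G α l (X m) = 0 := by
  induction hN : m.degree using Nat.strong_induction_on generalizing m l with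
  | _ N ih =>
  subst hN
  have hpair : ∀ j, pairing Tr (X m) (toLaurent (α j)) =
      trL Tr ((X * barS (secS Γ j)) m) := fun j => by
    rw [pairing_series_apply, Finset.sum_eq_single (m, 0)]
    · by_cases hbad : IsBad deg m
      · rw [koszul_of_isBad (by simpa using hbad), X.reduced.of_isBad hbad, pairing_zero_left,
          zero_smul]
      · rw [koszul_zero_right hbad, one_smul, secS_zero hΓ, oddPart_zero]; rfl
    · rintro ⟨a, b⟩ hq hne
      have hq : a + b = m := mem_antidiagonal.mp hq
      have hb : b.degree ≠ 0 := fun h0 => hne (by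
        rw [Finsupp.degree_eq_zero_iff] at h0
        rw [← hq, h0, add_zero])
      have hab : a.degree + b.degree = m.degree := by rw [← hq, map_add]
      obtain ⟨u, hu⟩ := hF.exists_eq_deltaL hTr (hc a) fun k => ih a.degree (by omega) a k rfl
      obtain ⟨v, hv⟩ := deltaL_parityL_pow (𝒜 := 𝒜) hΔ (oddPart deg b) u
      rw [hu, hv, pairing_deltaL_left hTr (deltaL_secS hΓ j b), smul_zero]
    · intro h; exact absurd (mem_antidiagonal.mpr (add_zero m)) h
  ext p
  rw [HahnSeries.coeff_zero]
  rcases lt_or_ge p 0 with hp0 | hp0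
  · rw [coord_apply, HahnSeries.coeff_sum]
    refine Finset.sum_eq_zero fun j _ => ?_
    rw [mul_comm, coeff_C_mul, hpair, coeff_pairing_of_isExpInt hΔ (hΓ 0).isEven (hΓ 0).ordGE Tr hX
      (isExpInt_secS hΔ (hΓ 0).isEven (hΓ 0).ordGE j) m hp0, mul_zero]
  · rw [← coordS_apply, hp l p hp0, SS.zero_apply]

theorem coordS_eq_zero {X : SS deg (parityL 𝒜)} (h : ∀ m l, coord Tr G α l (X m) = 0) (l : Fin μ)
    (p : ℤ) : coordS Tr G α l p X = 0 :=
  SS.ext fun m => by rw [coordS_apply, h, HahnSeries.coeff_zero, SS.zero_apply]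

/-- The coordinates of `ħ e^{Γ/ħ}` in nonnegative degrees: those of `ħ + ∑ τ_i α_i`. -/
theorem coord_exp [CharZero K] (hTr : IsCyclicBV 𝒜 n Δ Tr) (hF : IsFrame 𝒜 n Δ Tr deg G α)
    (hΓ : ∀ N, IsPartial 𝒜 Δ α N Γ) {e : Fin μ → K}
    (he : ∃ g, ∑ i, e i • α i = 1 + deltaPS Δ g) (l : Fin μ) {p : ℤ} (hp : -1 ≤ p) :
    coordS Tr G α l p (SS.exp (overH Γ)) =
      if p = 0 then const _ (e l) else if p = -1 then tau K deg l else 0 := by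
  obtain ⟨g, hg⟩ := he
  have hone : coord Tr G α l 1 = HahnSeries.C (e l) := by
    have h := congrArg (fun f => coord Tr G α l (toLaurent f)) hg
    simp only [map_add, ← deltaL_toLaurent, hF.coord_deltaL hTr, add_zero,
      toLaurent_one, toLaurent_sum] at h
    rw [← h]
    have h2 := hF.coord_sum (fun i => HahnSeries.C (e i)) l
    rw [← h2]
    refine congrArg _ (Finset.sum_congr rfl fun i _ => ?_)
    rw [C_eq_toLaurent, scal_toLaurent, ← toLaurent_mul, map_C_mul]
  refine SS.ext fun m => ?_
  obtain ⟨x, hx, u, hu⟩ := (isFlatSolution hΓ).flat m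
  rw [expGamma_eq] at hu
  have h := congrArg (fun f => (coord Tr G α l f).coeff (p + 1)) hu
  simp only [map_sub, map_add, HahnSeries.coeff_sub, HahnSeries.coeff_add, hF.coord_deltaL hTr,
    add_zero, hF.coord_oppSpan hx l (by omega : 0 ≤ p + 1), coord_hbar_mul,
    coeff_hbar_mul, add_sub_cancel_right] at h
  have h1 : (coord Tr G α l (constS (hbar A 1) m)).coeff (p + 1) =
      if m = 0 ∧ p = 0 then e l else 0 := by
    rw [constS]
    split_ifs with hm h2 h2
    · rw [← mul_one (hbar A 1), coord_hbar_mul, coeff_hbar_mul, hone, HahnSeries.C_apply, h2.2]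
      simp
    · rw [← mul_one (hbar A 1), coord_hbar_mul, coeff_hbar_mul, hone, HahnSeries.C_apply,
        HahnSeries.coeff_single_of_ne]
      intro h; exact h2 ⟨hm, by omega⟩
    · exact absurd h2.1 hm
    · rw [map_zero, HahnSeries.coeff_zero]
  have h2 : (coord Tr G α l (linS (fun i => toLaurent (α i)) m)).coeff (p + 1) =
      if p = -1 then tau K deg l m else 0 := by
    rw [linS, map_sum, HahnSeries.coeff_sum, Finset.sum_eq_single l]
    · rw [tau_apply]
      split_ifs with hm hp1 hp1
      · rw [hF.coord_basis, if_pos rfl, hp1]; simp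
      · rw [hF.coord_basis, if_pos rfl, HahnSeries.coeff_one, if_neg (by omega)]
      all_goals rw [map_zero, HahnSeries.coeff_zero]
    · intro i _ hi
      split_ifs
      · rw [hF.coord_basis, if_neg hi, HahnSeries.coeff_zero]
      · rw [map_zero, HahnSeries.coeff_zero]
    · intro h; exact absurd (Finset.mem_univ l) h
  rw [coordS_apply, sub_eq_iff_eq_add.mp h, h1, h2]
  by_cases hp0 : p = 0
  · subst hp0; simp [const_apply]
  · by_cases hp1 : p = -1
    · subst hp1; simp
    · simp [hp0, hp1]

/-- The coordinates of the sections `ħ ∂_j e^{Γ/ħ}` are `δ_{jl} + ħ⁻¹ ∂_j Φ_l + O(ħ⁻²)`. -/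
theorem coordS_secS_of_nonneg [CharZero K] (hTr : IsCyclicBV 𝒜 n Δ Tr)
    (hF : IsFrame 𝒜 n Δ Tr deg G α) (hΓ : ∀ N, IsPartial 𝒜 Δ α N Γ) {e : Fin μ → K}
    (he : ∃ g, ∑ i, e i • α i = 1 + deltaPS Δ g) (j l : Fin μ) {p : ℤ} (hp : 0 ≤ p) :
    coordS Tr G α l p (secS Γ j) = if p = 0 ∧ l = j then 1 else 0 := by
  rw [coordS_secS, coord_exp hTr hF hΓ he l (by omega)]
  by_cases h1 : p - 1 = 0
  · rw [if_pos h1, d_const, if_neg (by omega)]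
  · rw [if_neg h1]
    by_cases h0 : p = 0
    · subst h0; simp [d_tau]
    · rw [if_neg (by omega), map_zero, if_neg (fun h => h0 h.1)]

theorem coordS_secS_neg_one (j l : Fin μ) :
    coordS Tr G α l (-1) (secS Γ j) = d j (firstOrder Tr G α Γ l) := by
  rw [coordS_secS]; rfl

/-- The product formula `ħ ∂_i ħ ∂_j e^{Γ/ħ} = ∑_k A_{ij}^k ħ ∂_k e^{Γ/ħ}` in cohomology. -/
theorem coord_product [CharZero K] (hΔ : IsCommBV 𝒜 Δ) (hTr : IsCyclicBV 𝒜 n Δ Tr)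
    (hF : IsFrame 𝒜 n Δ Tr deg G α) (hΓ : ∀ N, IsPartial 𝒜 Δ α N Γ) {e : Fin μ → K}
    (he : ∃ g, ∑ i, e i • α i = 1 + deltaPS Δ g) (i j : Fin μ) (m) (l : Fin μ) :
    coord Tr G α l ((hbarS deg 𝒜 1 * d i (secS Γ j) -
      ∑ k, liftS (parityL 𝒜) (structConst Tr G α Γ i j k) * secS Γ k) m) = 0 := by
  have hs := isExpInt_secS (𝒜 := 𝒜) hΔ (hΓ 0).isEven (hΓ 0).ordGE
  refine IsExpInt.coord_eq_zero hΔ hTr hF hΓ (((hs j).hbar_d hΔ (hΓ 0).isEven (hΓ 0).ordGE i).sub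
    (IsExpInt.sum fun k => (hs k).liftS_mul _)) (fun m => ?_) (fun l p hp => ?_) m l
  · rw [SS.sub_apply, SS.sum_apply, deltaL_sub, deltaL_sum,
      deltaL_hbarS_mul (deltaL_d (deltaL_secS hΓ j) i), zero_sub, neg_eq_zero]
    exact Finset.sum_eq_zero fun k _ => deltaL_liftS_mul (deltaL_secS hΓ k) _ m
  · rw [map_sub, map_sum, coordS_hbar_d]
    simp only [coordS_liftS_mul, coordS_secS_of_nonneg hTr hF hΓ he _ _ hp]
    by_cases h0 : p = 0
    · subst h0
      rw [zero_sub, coordS_secS_neg_one, Finset.sum_eq_single l]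
      · rw [if_pos ⟨rfl, rfl⟩, mul_one, structConst, sub_self]
      · intro k _ hk
        rw [if_neg (fun h => hk h.2.symm), mul_zero]
      · intro h; exact absurd (Finset.mem_univ l) h
    · rw [coordS_secS_of_nonneg hTr hF hΓ he _ _ (by omega), Finset.sum_eq_zero, sub_zero]
      · split_ifs with h
        · rw [one_eq, d_const]
        · rw [map_zero]
      · intro k _
        rw [if_neg (fun h => h0 h.1), mul_zero]

/-- The product formula in coordinates. -/
theorem d_coordS_secS [CharZero K] (hΔ : IsCommBV 𝒜 Δ) (hTr : IsCyclicBV 𝒜 n Δ Tr)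
    (hF : IsFrame 𝒜 n Δ Tr deg G α) (hΓ : ∀ N, IsPartial 𝒜 Δ α N Γ) {e : Fin μ → K}
    (he : ∃ g, ∑ i, e i • α i = 1 + deltaPS Δ g) (i j l : Fin μ) (p : ℤ) :
    d i (coordS Tr G α l (p - 1) (secS Γ j)) =
      ∑ k, structConst Tr G α Γ i j k * coordS Tr G α l p (secS Γ k) := by
  have h := coordS_eq_zero (coord_product hΔ hTr hF hΓ he i j) l p
  rw [map_sub, map_sum, coordS_hbar_d, sub_eq_zero] at h
  simpa only [coordS_liftS_mul] using h

/-- The unit vector field: `∑ e_i ħ ∂_i e^{Γ/ħ} = e^{Γ/ħ}` in cohomology. -/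
theorem coordS_unit [CharZero K] (hΔ : IsCommBV 𝒜 Δ) (hTr : IsCyclicBV 𝒜 n Δ Tr)
    (hF : IsFrame 𝒜 n Δ Tr deg G α) (hΓ : ∀ N, IsPartial 𝒜 Δ α N Γ) {e : Fin μ → K}
    (he : ∃ g, ∑ i, e i • α i = 1 + deltaPS Δ g) (l : Fin μ) (p : ℤ) :
    ∑ i, e i • coordS Tr G α l p (secS Γ i) = coordS Tr G α l p (SS.exp (overH Γ)) := by
  have hs := isExpInt_secS (𝒜 := 𝒜) hΔ (hΓ 0).isEven (hΓ 0).ordGE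
  have hsmul : ∀ i, IsExpInt Γ (e i • secS Γ i) := fun i => by
    obtain ⟨x, hx⟩ := (hs i).liftS_mul (const _ (e i))
    refine ⟨x, hx ▸ SS.ext fun m => ?_⟩
    rw [liftS_mul_apply, SS.smul_apply, Finset.sum_eq_single (0, m)]
    · by_cases hbad : IsBad deg m
      · rw [(secS Γ i).reduced.of_isBad hbad, smul_zero, smul_zero, smul_zero]
      · rw [koszul_zero_left hbad, one_smul, const_apply, if_pos rfl]
    · rintro ⟨a, b⟩ hq hne
      rw [const_apply, if_neg, zero_smul, smul_zero]
      rintro rfl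
      have hq : 0 + b = m := mem_antidiagonal.mp hq
      exact hne (by rw [← hq, zero_add])
    · intro h; exact absurd (mem_antidiagonal.mpr (zero_add m)) h
  have h := coordS_eq_zero (Tr := Tr) (G := G) (α := α) (IsExpInt.coord_eq_zero hΔ hTr hF hΓ
    ((IsExpInt.sum hsmul).sub (isExpInt_exp Γ)) (fun m => ?_) fun l p hp => ?_) l p
  · rw [map_sub, map_sum, sub_eq_zero] at h
    simpa only [coordS_smul] using h
  · rw [SS.sub_apply, SS.sum_apply, deltaL_sub, deltaL_exp_eq_zero hΓ, deltaL_sum, sub_zero]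
    exact Finset.sum_eq_zero fun i _ => by
      rw [SS.smul_apply, deltaL_smul, deltaL_secS hΓ, smul_zero]
  · rw [map_sub, map_sum]
    simp only [coordS_smul, coordS_secS_of_nonneg hTr hF hΓ he _ _ hp]
    rw [coord_exp hTr hF hΓ he l (by omega), if_neg (by omega : ¬ p = -1)]
    by_cases h0 : p = 0
    · rw [if_pos h0, Finset.sum_eq_single l, if_pos ⟨h0, rfl⟩, sub_eq_zero]
      · refine SS.ext fun m => ?_
        rw [SS.smul_apply, one_apply, const_apply]
        split_ifs <;> simp
      · intro k _ hk
        rw [if_neg (fun h => hk h.2.symm), smul_zero]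
      · intro h; exact absurd (Finset.mem_univ l) h
    · rw [if_neg h0, sub_zero]
      exact Finset.sum_eq_zero fun k _ => by rw [if_neg (fun h => h0 h.1), smul_zero]

end Coordinates

section Frobenius

variable {K A : Type*} [Field K] [Ring A] [Algebra K A] {μ : ℕ} {𝒜 : ℤ → Submodule K A}
  [GradedAlgebra 𝒜] {Δ : ℕ → A →ₗ[K] A} {deg : Fin μ → ℤ} {n : ℤ} {Tr : A →ₗ[K] K}
  {G : Matrix (Fin μ) (Fin μ) K} {α : Fin μ → PowerSeries A} {Γ : SS deg (parityP 𝒜)}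

open Finset.HasAntidiagonal (antidiagonal mem_antidiagonal)

open SS

/-! #### Degrees of the structure constants -/

theorem firstOrder_degree (hTr : IsCyclicBV 𝒜 n Δ Tr) (hF : IsFrame 𝒜 n Δ Tr deg G α)
    (hΓ : ∀ N, IsPartial 𝒜 Δ α N Γ) {l : Fin μ} {m : Fin μ →₀ ℕ}
    (h : firstOrder Tr G α Γ l m ≠ 0) : monDeg deg m = 4 - deg l := by
  have := hF.coord_degree hTr ((hΓ 0).homS.exp m) l h
  omega

theorem d_apply_ne_zero {σ : K →ₐ[K] K} {i : Fin μ} {f : SS deg σ} {m : Fin μ →₀ ℕ}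
    (h : d i f m ≠ 0) : f (m + Finsupp.single i 1) ≠ 0 :=
  fun h0 => h (by rw [d_apply, h0, smul_zero])

theorem d_firstOrder_degree (hTr : IsCyclicBV 𝒜 n Δ Tr) (hF : IsFrame 𝒜 n Δ Tr deg G α)
    (hΓ : ∀ N, IsPartial 𝒜 Δ α N Γ) {j l : Fin μ} {m : Fin μ →₀ ℕ}
    (h : d j (firstOrder Tr G α Γ l) m ≠ 0) : monDeg deg m = 2 + deg j - deg l := by
  have := firstOrder_degree hTr hF hΓ (d_apply_ne_zero h)
  rw [monDeg_add, monDeg_single] at this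
  omega

theorem structConst_degree (hTr : IsCyclicBV 𝒜 n Δ Tr) (hF : IsFrame 𝒜 n Δ Tr deg G α)
    (hΓ : ∀ N, IsPartial 𝒜 Δ α N Γ) {i j k : Fin μ} {m : Fin μ →₀ ℕ}
    (h : structConst Tr G α Γ i j k m ≠ 0) : monDeg deg m = deg i + deg j - deg k := by
  have := d_firstOrder_degree hTr hF hΓ (d_apply_ne_zero h)
  rw [monDeg_add, monDeg_single] at this
  omega

theorem twist_structConst (hTr : IsCyclicBV 𝒜 n Δ Tr) (hF : IsFrame 𝒜 n Δ Tr deg G α)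
    (hΓ : ∀ N, IsPartial 𝒜 Δ α N Γ) (i j k s : Fin μ) :
    twist i (structConst Tr G α Γ j k s) =
      sgn (deg i * (deg j + deg k + deg s)) • structConst Tr G α Γ j k s := by
  refine twist_eq_of_parity (fun m hm => ?_) i
  rw [structConst_degree hTr hF hΓ hm]
  exact sgn_eq_iff.mpr ⟨-deg s, by ring⟩

/-! #### Associativity -/

/-- Associativity comes from the equality of mixed derivatives. The coefficient of `ħ⁻¹` in the
product formula expresses `∂_j` of the coefficient of `ħ⁻²` in the section `ħ ∂_k e^{Γ/ħ}`; the
derivative `∂_i` of the right-hand side consists of terms `∂_i A_{jk}^s ∂_s Φ_l`, which are graded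
symmetric in `i` and `j` by the definition of the structure constants, and of the products
`A_{jk}^s A_{is}^l`, which are therefore graded symmetric as well. -/
theorem sum_twist_structConst [CharZero K] (hΔ : IsCommBV 𝒜 Δ) (hTr : IsCyclicBV 𝒜 n Δ Tr)
    (hF : IsFrame 𝒜 n Δ Tr deg G α) (hΓ : ∀ N, IsPartial 𝒜 Δ α N Γ) {e : Fin μ → K}
    (he : ∃ g, ∑ i, e i • α i = 1 + deltaPS Δ g) (i j k l : Fin μ) :
    ∑ s, twist i (structConst Tr G α Γ j k s) * structConst Tr G α Γ i s l =
      sgn (deg i * deg j) •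
        ∑ s, twist j (structConst Tr G α Γ i k s) * structConst Tr G α Γ j s l := by
  have h : ∀ i j, d i (d j (coordS Tr G α l (-1 - 1) (secS Γ k))) =
      ∑ s, d i (structConst Tr G α Γ j k s) * d s (firstOrder Tr G α Γ l) +
        ∑ s, twist i (structConst Tr G α Γ j k s) * structConst Tr G α Γ i s l := fun i j => by
    rw [d_coordS_secS hΔ hTr hF hΓ he, map_sum, ← Finset.sum_add_distrib]
    exact Finset.sum_congr rfl fun s _ => by rw [d_mul, coordS_secS_neg_one]; rfl
  have h1 := d_comm_sgn i j (coordS Tr G α l (-1 - 1) (secS Γ k))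
  rw [h, h, smul_add, Finset.smul_sum] at h1
  refine add_left_cancel (a := ∑ s, d i (structConst Tr G α Γ j k s) *
    d s (firstOrder Tr G α Γ l)) (h1.trans ?_)
  congr 1
  refine Finset.sum_congr rfl fun s _ => ?_
  rw [structConst, structConst, d_comm_sgn i j, smul_mul_assoc]

theorem structConst_assoc [CharZero K] (hΔ : IsCommBV 𝒜 Δ) (hTr : IsCyclicBV 𝒜 n Δ Tr)
    (hF : IsFrame 𝒜 n Δ Tr deg G α) (hΓ : ∀ N, IsPartial 𝒜 Δ α N Γ) {e : Fin μ → K}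
    (he : ∃ g, ∑ i, e i • α i = 1 + deltaPS Δ g) (i j k l : Fin μ) :
    ∑ s, structConst Tr G α Γ i j s * structConst Tr G α Γ s k l =
      ∑ s, sgn (deg i * (deg j + deg k + deg s)) •
        (structConst Tr G α Γ j k s * structConst Tr G α Γ i s l) := by
  have h := sum_twist_structConst hΔ hTr hF hΓ he i k j l
  simp only [twist_structConst hTr hF hΓ, smul_mul_assoc] at h
  have h1 : ∀ s, sgn (deg i * (deg j + deg k + deg s)) •
      (structConst Tr G α Γ j k s * structConst Tr G α Γ i s l) = sgn (deg j * deg k) •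
        sgn (deg i * (deg k + deg j + deg s)) •
      (structConst Tr G α Γ k j s * structConst Tr G α Γ i s l) := fun s => by
    rw [structConst_comm j k, smul_mul_assoc, smul_comm, add_comm (deg j)]
  simp only [h1]
  rw [← Finset.smul_sum, h, Finset.smul_sum, Finset.smul_sum]
  refine Finset.sum_congr rfl fun s _ => ?_
  rw [structConst_comm s k, mul_smul_comm, smul_smul, smul_smul, ← sgn_add, ← sgn_add]
  congr 1
  exact sgn_eq_iff.mpr ⟨-(deg j * deg k) - deg i * deg k, by ring⟩

/-! #### The metric -/

theorem coeff_mul_of_nonpos {u v : LaurentSeries K} (hu : ∀ p > 0, u.coeff p = 0)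
    (hv : ∀ p > 0, v.coeff p = 0) :
    (∀ p > 0, (u * v).coeff p = 0) ∧ (u * v).coeff 0 = u.coeff 0 * v.coeff 0 ∧
      (u * v).coeff (-1) = u.coeff 0 * v.coeff (-1) + u.coeff (-1) * v.coeff 0 := by
  have hsupp : ∀ {p : ℤ} {q : ℤ × ℤ}, q ∈ Finset.antidiagonal u.isPWO_support v.isPWO_support p →
      q.1 ≤ 0 ∧ q.2 ≤ 0 ∧ q.1 + q.2 = p := fun {p q} hq => by
    obtain ⟨h1, h2, h3⟩ := Finset.mem_antidiagonal.mp hq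
    exact ⟨not_lt.mp fun h => h1 (hu _ h), not_lt.mp fun h => h2 (hv _ h), h3⟩
  have hnot : ∀ {p : ℤ} {q : ℤ × ℤ}, q.1 + q.2 = p →
      q ∉ Finset.antidiagonal u.isPWO_support v.isPWO_support p →
      u.coeff q.1 * v.coeff q.2 = 0 := fun {p q} hp hq => by
    by_contra h
    exact hq (Finset.mem_antidiagonal.mpr ⟨left_ne_zero_of_mul h, right_ne_zero_of_mul h, hp⟩)
  refine ⟨fun p hp => ?_, ?_, ?_⟩
  · rw [HahnSeries.coeff_mul]
    refine Finset.sum_eq_zero fun q hq => ?_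
    obtain ⟨h1, h2, h3⟩ := hsupp hq
    omega
  · rw [HahnSeries.coeff_mul, Finset.sum_subset (s₂ := {(0, 0)}), Finset.sum_singleton]
    · intro q hq
      obtain ⟨h1, h2, h3⟩ := hsupp hq
      rw [Finset.mem_singleton]
      exact Prod.ext (by dsimp only; omega) (by dsimp only; omega)
    · intro q hq hn
      rw [Finset.mem_singleton] at hq
      exact hnot (by rw [hq]; rfl) hn
  · rw [HahnSeries.coeff_mul, Finset.sum_subset (s₂ := {(0, -1), (-1, 0)}),
      Finset.sum_pair (by decide)]
    · intro q hq
      obtain ⟨h1, h2, h3⟩ := hsupp hq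
      rw [Finset.mem_insert, Finset.mem_singleton]
      rcases eq_or_lt_of_le h1 with h | h
      · exact Or.inl (Prod.ext h (by dsimp only; omega))
      · exact Or.inr (Prod.ext (by dsimp only; omega) (by dsimp only; omega))
    · intro q hq hn
      rw [Finset.mem_insert, Finset.mem_singleton] at hq
      refine hnot ?_ hn
      rcases hq with rfl | rfl <;> rfl

/-- The pairing of closed elements in coordinates. -/
theorem IsFrame.pairing_eq_sum (hΔ : IsCommBV 𝒜 Δ) (hTr : IsCyclicBV 𝒜 n Δ Tr)
    (hF : IsFrame 𝒜 n Δ Tr deg G α) {f g : LaurentSeries A} (hf : deltaL Δ f = 0)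
    (hg : deltaL Δ g = 0) : pairing Tr f g = ∑ k, ∑ l, (HahnSeries.C (G k l) : LaurentSeries K) *
      (coord Tr G α k f * bar (coord Tr G α l g)) := by
  obtain ⟨u, hu⟩ := hF.expansion hTr hf
  obtain ⟨v, hv⟩ := hF.expansion hTr hg
  conv_lhs => rw [hu]
  rw [pairing_add_left, pairing_deltaL_left hTr hg, add_zero, pairing_sum_left]
  refine Finset.sum_congr rfl fun k _ => ?_
  conv_lhs => rw [hv]
  rw [pairing_scal_left, pairing_add_right, pairing_deltaL_right hTr hΔ (hF.deltaL_eq_zero k),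
    add_zero, pairing_sum_right, Finset.mul_sum]
  refine Finset.sum_congr rfl fun l _ => ?_
  rw [pairing_scal_right, hF.pair]
  ring

/-- The pairings of the coefficients of `ħ ∂_i e^{Γ/ħ}` and `ħ ∂_j e^{Γ/ħ}`, down to `ħ⁻¹`. -/
theorem coeff_pairing_secS [CharZero K] (hΔ : IsCommBV 𝒜 Δ) (hTr : IsCyclicBV 𝒜 n Δ Tr)
    (hF : IsFrame 𝒜 n Δ Tr deg G α) (hΓ : ∀ N, IsPartial 𝒜 Δ α N Γ) {e : Fin μ → K}
    (he : ∃ g, ∑ i, e i • α i = 1 + deltaPS Δ g) (i j : Fin μ) (a b : Fin μ →₀ ℕ) :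
    (∀ p > 0, (pairing Tr (secS Γ i a) (secS Γ j b)).coeff p = 0) ∧
    ((pairing Tr (secS Γ i a) (secS Γ j b)).coeff 0 = if a = 0 ∧ b = 0 then G i j else 0) ∧
    (pairing Tr (secS Γ i a) (secS Γ j b)).coeff (-1) =
      (if b = 0 then ∑ k, G k j * d i (firstOrder Tr G α Γ k) a else 0) -
        if a = 0 then ∑ l, G i l * d j (firstOrder Tr G α Γ l) b else 0 := by
  have h0 : ∀ i k a, ∀ p ≥ 0, (coord Tr G α k (secS Γ i a)).coeff p =
      if p = 0 ∧ k = i ∧ a = 0 then 1 else 0 := fun i k a p hp => by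
    rw [← coordS_apply, coordS_secS_of_nonneg hTr hF hΓ he i k hp]
    by_cases h1 : p = 0 ∧ k = i
    · rw [if_pos h1, one_apply]
      simp [h1]
    · rw [if_neg h1, if_neg (fun h => h1 ⟨h.1, h.2.1⟩)]; rfl
  have h1 : ∀ i k a, (coord Tr G α k (secS Γ i a)).coeff (-1) =
      d i (firstOrder Tr G α Γ k) a := fun i k a => by
    rw [← coordS_apply, coordS_secS_neg_one]
  have hpos : ∀ i k a, ∀ p > 0, (coord Tr G α k (secS Γ i a)).coeff p = 0 := fun i k a p hp => by
    rw [h0 i k a p hp.le, if_neg (by omega)]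
  have hm := fun k l => coeff_mul_of_nonpos (hpos i k a)
    (v := bar (coord Tr G α l (secS Γ j b))) fun p hp => by
      rw [coeff_bar, hpos j l b p hp, smul_zero]
  rw [hF.pairing_eq_sum hΔ hTr (deltaL_secS hΓ i a) (deltaL_secS hΓ j b)]
  simp only [HahnSeries.coeff_sum, coeff_C_mul]
  refine ⟨fun p hp => ?_, ?_, ?_⟩
  · exact Finset.sum_eq_zero fun k _ => Finset.sum_eq_zero fun l _ => by
      rw [(hm k l).1 p hp, mul_zero]
  · simp only [(hm _ _).2.1, coeff_bar, h0 _ _ _ 0 le_rfl, sgn_zero, one_smul, true_and]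
    by_cases ha : a = 0 <;> by_cases hb : b = 0 <;> simp [ha, hb]
  · simp only [(hm _ _).2.2, coeff_bar, h0 _ _ _ 0 le_rfl, h1, sgn_zero, one_smul, true_and,
      sgn_odd (by decide : Odd (-1 : ℤ)), neg_one_zsmul, mul_add, Finset.sum_add_distrib]
    by_cases ha : a = 0 <;> by_cases hb : b = 0 <;> simp [ha, hb, sub_eq_add_neg, add_comm]

theorem homS_secS (hΓ : ∀ N, IsPartial 𝒜 Δ α N Γ) (i : Fin μ) : HomS deg (deg i) (secS Γ i) :=
  fun m => by
    rw [secS, hbarS_mul_apply, d_apply]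
    have h := (((hΓ 0).homS.exp (m + Finsupp.single i 1)).zsmul
      ((-1) ^ leftCount deg i m * ((m i : ℤ) + 1))).hbar_mul 1
    rwa [monDeg_add, monDeg_single, show 0 - (monDeg deg m + (2 - deg i)) + 2 * 1 =
      deg i - monDeg deg m by ring] at h

theorem HomL.parityL_pow {i : ℤ} {x : LaurentSeries A} (hx : HomL 𝒜 i x) (p : ℕ) :
    (parityL 𝒜 ^ p) x = sgn (i * p) • x := by
  induction p with
  | zero => simp
  | succ p ih =>
    have h1 : parityL 𝒜 x = sgn i • x := hx.parity
    rw [pow_succ', AlgHom.mul_apply, ih, map_zsmul, h1, smul_smul, ← sgn_add]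
    congr 2; push_cast; ring

theorem pairing_secS_apply (hΓ : ∀ N, IsPartial 𝒜 Δ α N Γ) (i j : Fin μ) (m : Fin μ →₀ ℕ) :
    trL Tr ((secS Γ i * barS (secS Γ j)) m) = ∑ q ∈ antidiagonal m, (koszul deg q.1 q.2 *
      sgn ((deg i - monDeg deg q.1) * oddPart deg q.2)) •
        pairing Tr (secS Γ i q.1) (secS Γ j q.2) := by
  rw [pairing_series_apply]
  exact Finset.sum_congr rfl fun q _ => by
    rw [(homS_secS hΓ i q.1).parityL_pow, pairing_zsmul_left, smul_smul]

/-- The metric is constant: the pairing of two sections has no poles by integrality, and no terms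
`ħ^p τ^m` with `p > 0`, or with `p = 0` and `m ≠ 0`, by the shape of their coordinates. -/
theorem pairing_secS [CharZero K] (hΔ : IsCommBV 𝒜 Δ) (hTr : IsCyclicBV 𝒜 n Δ Tr)
    (hF : IsFrame 𝒜 n Δ Tr deg G α) (hΓ : ∀ N, IsPartial 𝒜 Δ α N Γ) {e : Fin μ → K}
    (he : ∃ g, ∑ i, e i • α i = 1 + deltaPS Δ g) (i j : Fin μ) (m : Fin μ →₀ ℕ) :
    trL Tr ((secS Γ i * barS (secS Γ j)) m) = constS (HahnSeries.C (G i j)) m := by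
  have hs := isExpInt_secS (𝒜 := 𝒜) hΔ (hΓ 0).isEven (hΓ 0).ordGE
  have hR : ∀ p : ℤ, (constS (HahnSeries.C (G i j)) m : LaurentSeries K).coeff p =
      if m = 0 ∧ p = 0 then G i j else 0 := fun p => by
    rw [constS, HahnSeries.C_apply]
    split_ifs with h1 h2 h2
    · rw [h2.2, HahnSeries.coeff_single_same]
    · exact HahnSeries.coeff_single_of_ne fun h => h2 ⟨h1, h⟩
    · exact absurd h2.1 h1
    · rw [HahnSeries.coeff_zero]
  ext p
  rw [hR]
  rcases lt_trichotomy p 0 with hp | rfl | hp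
  · rw [coeff_pairing_of_isExpInt hΔ (hΓ 0).isEven (hΓ 0).ordGE Tr (hs i) (hs j) m hp,
      if_neg (by omega)]
  · rw [pairing_secS_apply hΓ, HahnSeries.coeff_sum]
    simp only [HahnSeries.coeff_smul, (coeff_pairing_secS hΔ hTr hF hΓ he i j _ _).2.1]
    by_cases hm : m = 0
    · subst hm
      rw [Finsupp.antidiagonal_zero, Finset.sum_singleton, koszul_zero_left (by
        rintro ⟨_, _, h⟩; simp at h)]
      simp
    · rw [if_neg (fun h => hm h.1)]
      refine Finset.sum_eq_zero fun q hq => ?_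
      rw [if_neg, smul_zero]
      rintro ⟨h1, h2⟩
      exact hm (by rw [← mem_antidiagonal.mp hq, h1, h2, add_zero])
  · rw [pairing_secS_apply hΓ, HahnSeries.coeff_sum, if_neg (by omega)]
    exact Finset.sum_eq_zero fun q _ => by
      rw [HahnSeries.coeff_smul, (coeff_pairing_secS hΔ hTr hF hΓ he i j _ _).1 p hp, smul_zero]

/-! #### The potential -/

/-- The one-form whose primitive is the potential. -/
def lowered (Tr : A →ₗ[K] K) (G : Matrix (Fin μ) (Fin μ) K) (α : Fin μ → PowerSeries A)
    (Γ : SS deg (parityP 𝒜)) (j : Fin μ) : SS deg (AlgHom.id K K) :=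
  ∑ k, G k j • firstOrder Tr G α Γ k

theorem d_lowered (i j : Fin μ) : d i (lowered Tr G α Γ j) =
    ∑ k, G k j • d i (firstOrder Tr G α Γ k) := by
  rw [lowered, map_sum]
  exact Finset.sum_congr rfl fun k _ => d_smul _ _ _

/-- The one-form `lowered` is closed, since there is no `ħ⁻¹` in the pairing of the sections
`ħ ∂_i e^{Γ/ħ}`. -/
theorem lowered_closed [CharZero K] (hΔ : IsCommBV 𝒜 Δ) (hTr : IsCyclicBV 𝒜 n Δ Tr)
    (hF : IsFrame 𝒜 n Δ Tr deg G α) (hΓ : ∀ N, IsPartial 𝒜 Δ α N Γ) {e : Fin μ → K}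
    (he : ∃ g, ∑ i, e i • α i = 1 + deltaPS Δ g) (i j : Fin μ) :
    d i (lowered Tr G α Γ j) = sgn (deg i * deg j) • d j (lowered Tr G α Γ i) := by
  refine SS.ext fun m => ?_
  by_cases hbad : IsBad deg m
  · rw [(d i _).reduced.of_isBad hbad, SS.zsmul_apply, (d j _).reduced.of_isBad hbad, smul_zero]
  have h := congrArg (fun f => f.coeff (-1)) (pairing_secS hΔ hTr hF hΓ he i j m)
  simp only [pairing_secS_apply hΓ, HahnSeries.coeff_sum, HahnSeries.coeff_smul,
    (coeff_pairing_secS hΔ hTr hF hΓ he i j _ _).2.2, smul_sub, Finset.sum_sub_distrib] at h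
  have hR : (constS (HahnSeries.C (G i j)) m : LaurentSeries K).coeff (-1) = 0 := by
    rw [constS]
    split_ifs
    · rw [HahnSeries.C_apply, HahnSeries.coeff_single_of_ne (by decide)]
    · rw [HahnSeries.coeff_zero]
  rw [hR, sub_eq_zero, Finset.sum_eq_single (m, 0), Finset.sum_eq_single (0, m)] at h
  · simp only [koszul_zero_right hbad, koszul_zero_left hbad, oddPart_zero, if_true, monDeg_zero,
      Nat.cast_zero, mul_zero, sgn_zero, one_mul, one_smul, sub_zero] at h
    rw [d_lowered, d_lowered, SS.zsmul_apply, SS.sum_apply, SS.sum_apply, Finset.smul_sum]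
    refine h.trans ?_
    rw [Finset.smul_sum]
    refine Finset.sum_congr rfl fun l _ => ?_
    by_cases h0 : d j (firstOrder Tr G α Γ l) m = 0
    · rw [SS.smul_apply, h0, mul_zero, smul_zero, smul_zero, smul_zero]
    · have hm := congrArg sgn (d_firstOrder_degree hTr hF hΓ h0)
      rw [SS.smul_apply, hF.symm i l, smul_mul_assoc, smul_smul, smul_eq_mul]
      congr 1
      have h1 : sgn (oddPart deg m) = sgn (deg j + deg l) := by
        rw [sgn_natCast, ← sgn_monDeg, hm]
        exact sgn_eq_iff.mpr ⟨1 - deg l, by ring⟩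
      have h2 := sgn_eq_iff.mp h1
      rw [← sgn_add]
      refine sgn_eq_iff.mpr ?_
      obtain ⟨r, hr⟩ := h2
      exact ⟨deg i * (r + deg l), by linear_combination deg i * hr⟩
  · rintro ⟨a, b⟩ hq hne
    rw [if_neg, smul_zero]
    intro h0
    have hq : a + b = m := mem_antidiagonal.mp hq
    have h0 : a = 0 := h0
    exact hne (by rw [← hq, h0, zero_add])
  · intro h; exact absurd (mem_antidiagonal.mpr (zero_add m)) h
  · rintro ⟨a, b⟩ hq hne
    rw [if_neg, smul_zero]
    intro h0
    have hq : a + b = m := mem_antidiagonal.mp hq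
    have h0 : b = 0 := h0
    exact hne (by rw [← hq, h0, add_zero])
  · intro h; exact absurd (mem_antidiagonal.mpr (add_zero m)) h

theorem d_d_lowered (i j k : Fin μ) : d i (d j (lowered Tr G α Γ k)) =
    ∑ s, G s k • structConst Tr G α Γ i j s := by
  rw [d_lowered, map_sum]
  exact Finset.sum_congr rfl fun s _ => d_smul _ _ _

/-- Invariance of the metric: `∂_i ∂_j θ_k = g(∂_i ∘ ∂_j, ∂_k)` for the closed one-form `θ`, so this is
graded symmetric in all indices. -/
theorem structConst_invariant [CharZero K] (hΔ : IsCommBV 𝒜 Δ) (hTr : IsCyclicBV 𝒜 n Δ Tr)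
    (hF : IsFrame 𝒜 n Δ Tr deg G α) (hΓ : ∀ N, IsPartial 𝒜 Δ α N Γ) {e : Fin μ → K}
    (he : ∃ g, ∑ i, e i • α i = 1 + deltaPS Δ g) (i j k : Fin μ) :
    ∑ s, G s k • structConst Tr G α Γ i j s =
      ∑ s, sgn (deg i * (deg j + deg k + deg s)) • (G i s • structConst Tr G α Γ j k s) := by
  rw [← d_d_lowered]
  have h : ∀ s, sgn (deg i * (deg j + deg k + deg s)) • (G i s • structConst Tr G α Γ j k s) =
      sgn (deg i * (deg j + deg k)) • (G s i • structConst Tr G α Γ j k s) := fun s => by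
    rw [hF.symm i s, smul_assoc, smul_smul, ← sgn_add]
    congr 1
    exact sgn_eq_iff.mpr ⟨deg i * deg s, by ring⟩
  simp only [h]
  rw [← Finset.smul_sum, ← d_d_lowered, lowered_closed hΔ hTr hF hΓ he k i, map_zsmul,
    d_comm_sgn j i, smul_smul, smul_smul, ← sgn_add, ← sgn_add, sgn_even, one_smul]
  exact ⟨deg i * (deg j + deg k), by ring⟩

theorem structConst_unit [CharZero K] (hΔ : IsCommBV 𝒜 Δ) (hTr : IsCyclicBV 𝒜 n Δ Tr)
    (hF : IsFrame 𝒜 n Δ Tr deg G α) (hΓ : ∀ N, IsPartial 𝒜 Δ α N Γ) {e : Fin μ → K}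
    (he : ∃ g, ∑ i, e i • α i = 1 + deltaPS Δ g) (he0 : ∀ i, e i ≠ 0 → deg i = 0) (j k : Fin μ) :
    ∑ i, e i • structConst Tr G α Γ i j k = if j = k then 1 else 0 := by
  have h := congrArg (d j) (coordS_unit hΔ hTr hF hΓ he k (-1))
  rw [coord_exp hTr hF hΓ he k le_rfl, if_neg (by decide), if_pos rfl, d_tau, map_sum] at h
  simp only [eq_comm (a := k)] at h
  rw [← h]
  refine Finset.sum_congr rfl fun i _ => ?_
  rw [d_smul, coordS_secS_neg_one, structConst_comm]
  by_cases h0 : e i = 0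
  · rw [h0, zero_smul, zero_smul]
  · rw [he0 i h0, zero_mul, sgn_zero, one_smul]; rfl

theorem sum_val {B : Type*} [Ring B] [Algebra K B] {σ : B →ₐ[K] B} {ι : Type*} (s : Finset ι)
    (f : ι → SS deg σ) : (∑ i ∈ s, f i).val = ∑ i ∈ s, (f i).val := by
  funext m
  rw [SS.sum_apply, Finset.sum_apply]

/-- The Frobenius manifold structure defined by a solution of the master equation in flat
coordinates. -/
theorem exists_formalFrobenius [CharZero K] (hΔ : IsCommBV 𝒜 Δ) (hTr : IsCyclicBV 𝒜 n Δ Tr)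
    (hF : IsFrame 𝒜 n Δ Tr deg G α) (hΓ : ∀ N, IsPartial 𝒜 Δ α N Γ) {e : Fin μ → K}
    (he : ∃ g, ∑ i, e i • α i = 1 + deltaPS Δ g) (he0 : ∀ i, e i ≠ 0 → deg i = 0) :
    ∃ F : FormalFrobenius K deg n, F.metric = G ∧ F.unit = e ∧ IsInducedBy 𝒜 Δ Tr Γ.val F := by
  obtain ⟨Φ, hΦ⟩ := exists_potential (lowered_closed hΔ hTr hF hΓ he)
  let F : FormalFrobenius K deg n :=
    { metric := G
      prod := fun i j k => (structConst Tr G α Γ i j k).val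
      unit := e
      potential := Φ.val
      prod_reduced := fun i j k => (structConst Tr G α Γ i j k).reduced
      potential_reduced := Φ.reduced
      metric_symm := hF.symm
      metric_nondegenerate := hF.det
      prod_comm := fun i j k => congrArg SS.val (structConst_comm i j k)
      prod_assoc := fun i j k l => by
        have h := congrArg SS.val (structConst_assoc hΔ hTr hF hΓ he i j k l)
        rw [sum_val, sum_val] at h
        exact h
      invariant := fun i j k => by
        have h := congrArg SS.val (structConst_invariant hΔ hTr hF hΓ he i j k)
        rw [sum_val, sum_val] at h
        exact h
      potential_eq := fun i j k => by
        have h := congrArg SS.val (d_d_lowered (Tr := Tr) (G := G) (α := α) (Γ := Γ) i j k)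
        rw [sum_val, ← hΦ k] at h
        exact h.symm
      unit_eq := fun j k => by
        have h := congrArg SS.val (structConst_unit hΔ hTr hF hΓ he he0 j k)
        rw [sum_val] at h
        refine Eq.trans h ?_
        split_ifs
        · rfl
        · funext m
          change (0 : K) = if m = 0 then 0 else 0
          rw [ite_self]
      unit_degree := he0
      metric_degree := hF.degree
      prod_degree := fun i j k => by
        funext m
        rw [eulerS, Pi.smul_apply, smul_eq_mul]
        by_cases h0 : structConst Tr G α Γ i j k m = 0
        · rw [h0, mul_zero, mul_zero]
        · rw [structConst_degree hTr hF hΓ h0] }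
  refine ⟨F, rfl, rfl, ⟨fun i j m => ?_, fun i j m => ?_⟩⟩
  · have hc : deltaL Δ ((hbarS deg 𝒜 1 * d i (secS Γ j) -
        ∑ k, liftS (parityL 𝒜) (structConst Tr G α Γ i j k) * secS Γ k) m) = 0 := by
      rw [SS.sub_apply, SS.sum_apply, deltaL_sub, deltaL_sum,
        deltaL_hbarS_mul (deltaL_d (deltaL_secS hΓ j) i), zero_sub, neg_eq_zero]
      exact Finset.sum_eq_zero fun k _ => deltaL_liftS_mul (deltaL_secS hΓ k) _ m
    obtain ⟨u, hu⟩ := hF.exists_eq_deltaL hTr hc (coord_product hΔ hTr hF hΓ he i j m)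
    refine ⟨u, ?_⟩
    rw [SS.sub_apply, SS.sum_apply, sub_eq_iff_eq_add', hbarS_mul_apply, d_val, secS_val] at hu
    rw [hu]
    congr 1
    refine Finset.sum_congr rfl fun k _ => ?_
    rw [liftS_mul_apply, secS_val]; rfl
  · rw [← secS_val, ← secS_val]
    exact pairing_secS hΔ hTr hF hΓ he i j m

end Frobenius

end BVInfty

end

theorem mainTheorem1 {K A : Type*} [Field K] [CharZero K] [Ring A] [Algebra K A]
    (𝒜 : ℤ → Submodule K A) [GradedAlgebra 𝒜]
    (Δ : ℕ → A →ₗ[K] A) (hΔ : IsCommBV 𝒜 Δ)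
    (n : ℤ) (Tr : A →ₗ[K] K) (hTr : IsCyclicBV 𝒜 n Δ Tr)
    (R : HomotopyRetract 𝒜 (Δ 0)) (hR : IsHodgeDeRham Δ R) (hcompat : IsCompatible Tr R)
    {μ : ℕ} (a : Module.Basis (Fin μ) K (Coh (Δ 0))) (deg : Fin μ → ℤ)
    (ha : ∀ i, a i ∈ cohDeg 𝒜 (Δ 0) (deg i)) :
    IsGoodBasis Δ Tr (fun i => splitting Δ R (a i)) ∧
    ∃ α : Fin μ → PowerSeries A,
      IsGoodBasis Δ Tr α ∧
      (∀ (i : Fin μ) (k : ℕ), PowerSeries.coeff k (α i) ∈ 𝒜 (deg i - 2 * k)) ∧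
      (∀ i, ∃ z : LinearMap.ker (Δ 0), PowerSeries.coeff 0 (α i) = z ∧ cls (Δ 0) z = a i) ∧
      ((∃ g, splitting Δ R (R.p 1) = 1 + deltaPS Δ g) →
        ∀ i, α i = splitting Δ R (a i)) ∧
      IsGoodOpposite Δ Tr (oppSpan K α) ∧
      ∃ Γ : Series μ (PowerSeries A), IsFlatSolution 𝒜 Δ deg α Γ ∧
      ∃ F : FormalFrobenius K deg n,
        (∀ i j, ∀ z w : LinearMap.ker (Δ 0), cls (Δ 0) z = a i → cls (Δ 0) w = a j →
          F.metric i j = Tr (z * w)) ∧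
        (∑ i, F.unit i • a i = R.p 1) ∧
        IsInducedBy 𝒜 Δ Tr Γ F := by
  refine ⟨(isFrame_splitting hΔ hTr hR hcompat ha).isGoodBasis hTr, ?_⟩
  obtain ⟨α, hF, he, hcls, hsplit⟩ := exists_frame hΔ hTr hR hcompat ha
  obtain ⟨Γ, hΓ⟩ := exists_isPartial hΔ hTr hF
  have hone : ∀ i, a.repr (R.p 1) i ≠ 0 → deg i = 0 := fun i hi =>
    repr_degree R ha (R.p_degree 0 1 SetLike.GradedOne.one_mem) hi
  obtain ⟨F, hmetric, hunit, hind⟩ := exists_formalFrobenius hΔ hTr hF hΓ he hone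
  refine ⟨α, hF.isGoodBasis hTr, fun i => homL_toLaurent.mp (hF.mem i), fun i => ?_, hsplit,
    hF.isGoodOpposite hTr, Γ.val, isFlatSolution hΓ, F, fun i j z w hz hw => ?_, ?_, hind⟩
  · obtain ⟨u, hu⟩ := hcls i
    have hz : Δ 0 (PowerSeries.coeff 0 (α i)) = 0 := by
      have h := congrArg (PowerSeries.coeff 0) (hF.closed i)
      rw [coeff_deltaPS, Finset.Nat.antidiagonal_zero, Finset.sum_singleton] at h
      exact h
    refine ⟨⟨_, hz⟩, rfl, ?_⟩
    rw [← p_eq_cls R]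
    change R.p (PowerSeries.coeff 0 (α i)) = a i
    rw [hu, map_add, retract_p_ι, retract_p_d, add_zero]
  · rw [hmetric]
    exact trace_mul_eq_gram hΔ hTr i j z w hz hw
  · rw [hunit]
    exact a.sum_repr _
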